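/- Let $k=\mathbb F_q$ be a finite field with $q=p^a$ elements, $\bar k$ an algebraic closure of $k$, and $\Gamma=\mathrm{Gal}(\bar k/k)$ with its generator $\gamma\colon x\mapsto x^q$. For a prime $l\neq p$ let $\mathcal R_l$ be the abelian category of continuous linear representations of $\Gamma$ on finitely generated $\mathbb Z_l$-modules. For $l=p$ let $\mathcal R_p$ be the abelian category of $F$-crystals over $k$: finitely generated modules $M$ over the Witt ring $W=W(k)$ with a $\sigma$-linear map $F\colon M\to M$ whose kernel is torsion ($\sigma$ the Frobenius of $W$). For $M$ in $\mathcal R_l$ let $\pi_M$ be the action of $\gamma$ if $l\ne p$, and $F^a$ if $l=p$. Let $m_M(t)$ and $P_M(t)$ be the minimum and the characteristic polynomial of $\pi_M$ acting on $M\otimes_{\mathbb Z_l}\mathbb Q_l$ if $l\ne p$, and on the vector space $M\otimes_W\mathrm{Frac}(W)$ over $\mathrm{Frac}(W)$ if $l=p$; in the latter case $P_M$ has coefficients in $\mathbb Q_p$. Let $r(M)=\deg P_M$ be the rank of $M$. Let $s(M)=0$ if $l\ne p$, and if $l=p$ let $s(M)=\mathrm{ord}_p(P_M(0))/a$, the sum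 of the slopes of $M$. Let $(a_i)$ and $(b_j)$ be the families of roots of $P_M$ and $P_N$, with multiplicity. Let $|\cdot|_l$ be the $l$-adic absolute value with $|l|_l=1/l$. For a homomorphism $f$ of abelian groups, $z(f)=[\mathrm{Ker} f]/[\mathrm{Coker} f]$ is defined if $\mathrm{Ker} f$ and $\mathrm{Coker} f$ are finite. For $l\ne p$ let $\bar M$ be the $\mathbb Z_l$-module underlying $M$; for $l=p$ let $\bar M=W(\bar k)\otimes_W M$, an $F$-crystal over $\bar k$ with an action of $\Gamma$. Let $$f\colon \mathrm{Hom}_{\mathcal R_l}(M,N)=\mathrm{Hom}(\bar M,\bar N)^{\Gamma}\to \mathrm{Hom}(\bar M,\bar N)_{\Gamma}\cong H^1(\Gamma,\mathrm{Hom}(\bar M,\bar N))\to \mathrm{Ext}^1_{\mathcal R_l}(M,N)$$ be the composite of the map induced by the identity with the edge map. That is, $f(u)$ is the class of the extension $0\to N\to E\to M\to 0$, unique up to equivalence, for which there is a section $s\colon\bar M\to\bar E$ ($\mathbb Z_l$-linear if $l\ne p$, a morphism of $F$-crystals over $\bar k$ if $l=p$) with $\gamma s\gamma^{-1}-s=\bar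 u$. **Theorem.** Let $l$ be any prime (equal to $p$ or not), and let $M,N$ be objects of $\mathcal R_l$. Then the map $f$ is a well-defined homomorphism, $\mathrm{Ext}^i_{\mathcal R_l}(M,N)=0$ for $i>2$, and $\mathrm{Ext}^2_{\mathcal R_l}(M,N)$ is finite. If no common root of $m_M$ and $m_N$ is a multiple root of $m_M$ or of $m_N$, then $z(f)$ is defined and $$z(f)\cdot[\mathrm{Ext}^2_{\mathcal R_l}(M,N)]=\Big|\,q^{s(M)r(N)}\prod_{a_i\neq b_j}\Big(1-\frac{b_j}{a_i}\Big)\Big|_l .$$ -/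

import Mathlib

set_option linter.unusedSectionVars false
set_option linter.style.haveILetI false

open CategoryTheory Limits TensorProduct Polynomial

universe u

noncomputable section

/-! ### General notions -/

/-- `z(f)` is defined if the kernel and the cokernel of `f` are finite. -/
def ZDefined {A B : Type*} [AddCommGroup A] [AddCommGroup B] (f : A →+ B) : Prop :=
  Finite f.ker ∧ Finite (B ⧸ f.range)

/-- `z(f) = [Ker f] / [Coker f]`. -/
def zInv {A B : Type*} [AddCommGroup A] [AddCommGroup B] (f : A →+ B) : ℚ :=
  (Nat.card f.ker : ℚ) / Nat.card (B ⧸ f.range)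

/-- No common root (in an algebraic closure) of `f` and `g` is a multiple root of `f` or of `g`. -/
def NoCommonMultipleRoot {K : Type*} [Field K] (f g : K[X]) : Prop :=
  ∀ x : AlgebraicClosure K,
    (f.map (algebraMap K (AlgebraicClosure K))).IsRoot x →
    (g.map (algebraMap K (AlgebraicClosure K))).IsRoot x →
      (f.map (algebraMap K (AlgebraicClosure K))).rootMultiplicity x = 1 ∧
      (g.map (algebraMap K (AlgebraicClosure K))).rootMultiplicity x = 1

open Classical in
/-- `∏ (1 - b_j / a_i)` over the pairs `(i, j)` with `a_i ≠ b_j`, where `(a_i)` and `(b_j)` are the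
families of roots of `P` and `Q` in an algebraic closure of `ℚ_l`, repeated according to
multiplicity. -/
def rootProduct {l : ℕ} [Fact l.Prime] (P Q : ℚ_[l][X]) : PadicAlgCl l :=
  (((P.aroots (PadicAlgCl l) ×ˢ Q.aroots (PadicAlgCl l)).filter fun x => x.1 ≠ x.2).map
    fun x => 1 - x.2 / x.1).prod

/-! ### Continuous `l`-adic representations -/

namespace LRep

variable (l : ℕ) [Fact l.Prime] (Γ : Type u) [Group Γ] [TopologicalSpace Γ] [IsTopologicalGroup Γ]

/-- The continuous linear representations of `Γ` on finitely generated `ℤ_l`-modules: the action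
`Γ × V → V` is continuous for the `l`-adic topology of `V`. -/
def IsCont : ObjectProperty (Rep.{u} ℤ_[l] Γ) := fun V =>
  Module.Finite ℤ_[l] V ∧
    letI : TopologicalSpace V := (Ideal.span {(l : ℤ_[l])}).adicModuleTopology V
    Continuous fun x : Γ × V => V.ρ x.1 x.2

variable {l Γ}

theorem hasBasis_nhds {R : Type*} [CommRing R] {c : R} {V : Type*} [AddCommGroup V] [Module R V]
    (x : V) :
    (@nhds V ((Ideal.span {c}).adicModuleTopology V) x).HasBasis (fun _ : ℕ => True)
      fun n => {y | ∃ v : V, y - x = c ^ n • v} := by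
  let _ : TopologicalSpace R := (Ideal.span {c}).adicTopology
  have h := AddGroupFilterBasis.nhds_hasBasis (((Ideal.span {c}).ringFilterBasis.moduleFilterBasis
    ((Ideal.span {c}).adic_module_basis V)).toAddGroupFilterBasis) x
  have key (n : ℕ) (z : V) :
      z ∈ (Ideal.span {c}) ^ n • (⊤ : Submodule R V) ↔ ∃ v, z = c ^ n • v := by
    rw [Ideal.span_singleton_pow, Submodule.ideal_span_singleton_smul]
    constructor
    · rintro ⟨y, -, rfl⟩
      exact ⟨y, rfl⟩
    · rintro ⟨y, rfl⟩
      exact ⟨y, trivial, rfl⟩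
  refine h.to_hasBasis ?_ ?_
  · rintro _ ⟨n, rfl⟩
    refine ⟨n, trivial, fun y hy => ⟨y - x, (key n _).2 hy, by simp⟩⟩
  · intro n _
    refine ⟨_, ⟨n, rfl⟩, ?_⟩
    rintro _ ⟨z, hz, rfl⟩
    obtain ⟨v, hv⟩ := (key n z).1 hz
    exact ⟨v, by simpa using hv⟩

theorem isCont_iff (V : Rep.{u} ℤ_[l] Γ) : IsCont l Γ V ↔ Module.Finite ℤ_[l] V ∧
    ∀ n : ℕ, ∀ᶠ g in nhds (1 : Γ), ∀ v : V, ∃ w : V, V.ρ g v - v = (l : ℤ_[l]) ^ n • w := by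
  refine and_congr_right fun hfin => ?_
  let _ : TopologicalSpace V := (Ideal.span {(l : ℤ_[l])}).adicModuleTopology V
  constructor
  · intro hc n
    obtain ⟨S, hS⟩ := hfin.fg_top
    have h1 : ∀ v ∈ S, ∀ᶠ g in nhds (1 : Γ), ∃ w : V, V.ρ g v - v = (l : ℤ_[l]) ^ n • w := by
      intro v _
      have hc' : Continuous fun g : Γ => V.ρ g v :=
        hc.comp (Continuous.prodMk continuous_id continuous_const)
      have h2 := hc'.tendsto 1
      simp only [map_one, Module.End.one_apply] at h2
      exact h2 ((hasBasis_nhds v).mem_of_mem (i := n) trivial)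
    rw [← Filter.eventually_all_finset S] at h1
    filter_upwards [h1] with g hg v
    have hv : v ∈ Submodule.span ℤ_[l] (S : Set V) := hS ▸ Submodule.mem_top
    induction hv using Submodule.span_induction with
    | mem x hx => exact hg x hx
    | zero => exact ⟨0, by simp⟩
    | add x y _ _ hx hy =>
      obtain ⟨a, ha⟩ := hx
      obtain ⟨b, hb⟩ := hy
      exact ⟨a + b, by rw [smul_add, ← ha, ← hb, map_add]; abel⟩
    | smul c x _ hx =>
      obtain ⟨a, ha⟩ := hx
      exact ⟨c • a, by rw [smul_comm, ← ha, map_smul, smul_sub]⟩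
  · intro h
    refine continuous_iff_continuousAt.2 fun ⟨g₀, v₀⟩ => ?_
    refine ((hasBasis_nhds _).tendsto_right_iff).2 fun n _ => ?_
    have h1 : ∀ᶠ g in nhds g₀, ∀ v : V, ∃ w : V, V.ρ (g₀⁻¹ * g) v - v = (l : ℤ_[l]) ^ n • w := by
      have : Filter.Tendsto (fun g : Γ => g₀⁻¹ * g) (nhds g₀) (nhds 1) := by
        have := (continuous_const_mul g₀⁻¹ : Continuous fun g : Γ => g₀⁻¹ * g).tendsto g₀
        simpa using this
      exact this.eventually (h n)
    rw [nhds_prod_eq]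
    filter_upwards [h1.prod_mk ((hasBasis_nhds v₀).mem_of_mem (i := n) trivial)]
    rintro ⟨g, v⟩ ⟨hg, ⟨b, hb⟩⟩
    obtain ⟨a, ha⟩ := hg v
    refine ⟨V.ρ g₀ (a + b), ?_⟩
    simp only at hb ha ⊢
    rw [← map_smul, smul_add, ← ha, ← hb, map_add, map_sub, map_sub, ← Module.End.mul_apply,
      ← map_mul, mul_inv_cancel_left]
    abel

instance : (IsCont l Γ).IsClosedUnderSubobjects where
  prop_of_mono {X Y} f _ hY := by
    rw [isCont_iff] at hY ⊢
    obtain ⟨hfin, hc⟩ := hY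
    have hinj := (Rep.mono_iff_injective f).1 inferInstance
    let j : X →ₗ[ℤ_[l]] Y := f.hom.toLinearMap
    have hj : Function.Injective j := hinj
    refine ⟨Module.Finite.of_injective j hj, fun n => ?_⟩
    obtain ⟨k, hk⟩ := (Ideal.span {(l : ℤ_[l])}).exists_pow_inf_eq_pow_smul (LinearMap.range j)
    filter_upwards [hc (n + k)] with g hg v
    obtain ⟨w, hw⟩ := hg (j v)
    have h1 : j (X.ρ g v) = Y.ρ g (j v) := Rep.hom_comm_apply f g v
    have h2 : j (X.ρ g v - v) ∈ (Ideal.span {(l : ℤ_[l])}) ^ (n + k) • (⊤ : Submodule ℤ_[l] Y) ⊓ LinearMap.range j := by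
      refine ⟨?_, ⟨_, rfl⟩⟩
      rw [map_sub, h1, hw, Ideal.span_singleton_pow]
      exact Submodule.smul_mem_smul (Ideal.mem_span_singleton_self _) trivial
    rw [hk _ (Nat.le_add_left _ _), Nat.add_sub_cancel, Ideal.span_singleton_pow,
      Submodule.ideal_span_singleton_smul] at h2
    obtain ⟨y, ⟨-, ⟨x, rfl⟩⟩, hx⟩ := h2
    exact ⟨x, hj (by rw [map_smul, ← hx]; rfl)⟩

instance : (IsCont l Γ).IsClosedUnderQuotients where
  prop_of_epi {X Y} f _ hX := by
    rw [isCont_iff] at hX ⊢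
    obtain ⟨hfin, hc⟩ := hX
    have hs := (Rep.epi_iff_surjective f).1 inferInstance
    let j : X →ₗ[ℤ_[l]] Y := f.hom.toLinearMap
    have hj : Function.Surjective j := hs
    refine ⟨Module.Finite.of_surjective j hj, fun n => ?_⟩
    filter_upwards [hc n] with g hg v
    obtain ⟨v, rfl⟩ := hj v
    obtain ⟨w, hw⟩ := hg v
    have h1 : j (X.ρ g v) = Y.ρ g (j v) := Rep.hom_comm_apply f g v
    exact ⟨j w, by rw [← h1, ← map_sub, hw, map_smul]⟩

instance : (IsCont l Γ).ContainsZero where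
  exists_zero := by
    refine ⟨Rep.trivial ℤ_[l] Γ PUnit.{u + 1}, (Rep.isZero_iff _ _ _).2 (inferInstanceAs (Subsingleton PUnit.{u + 1})), ?_⟩
    rw [isCont_iff]
    exact ⟨inferInstanceAs (Module.Finite ℤ_[l] PUnit.{u + 1}), fun n => .of_forall fun g v => ⟨0, rfl⟩⟩

theorem isCont_prod {A B : Rep.{u} ℤ_[l] Γ} (hA : IsCont l Γ A) (hB : IsCont l Γ B) :
    IsCont l Γ (Rep.of (A.ρ.prod B.ρ)) := by
  rw [isCont_iff] at hA hB ⊢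
  obtain ⟨_, hA⟩ := hA
  obtain ⟨_, hB⟩ := hB
  refine ⟨inferInstanceAs (Module.Finite ℤ_[l] (A × B)), fun n => ?_⟩
  filter_upwards [hA n, hB n] with g h1 h2
  rintro ⟨a, b⟩
  obtain ⟨c, hc⟩ := h1 a
  obtain ⟨d, hd⟩ := h2 b
  exact ⟨(c, d), Prod.ext hc hd⟩

instance : (IsCont l Γ).IsClosedUnderBinaryProducts where
  limitsOfShape_le := by
    rintro X ⟨p⟩
    let f₁ := p.π.app ⟨.left⟩
    let f₂ := p.π.app ⟨.right⟩
    let φ : X ⟶ Rep.of ((p.diag.obj ⟨.left⟩).ρ.prod (p.diag.obj ⟨.right⟩).ρ) :=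
      Rep.ofHom ⟨f₁.hom.toLinearMap.prod f₂.hom.toLinearMap, fun g => by
        ext x
        exacts [Rep.hom_comm_apply f₁ g x, Rep.hom_comm_apply f₂ g x]⟩
    have : Mono φ := ⟨fun a b hab => p.isLimit.hom_ext fun j => by
      rcases j with ⟨_ | _⟩
      · ext x
        exact congrArg Prod.fst (congrArg (fun h => h.hom x) hab)
      · ext x
        exact congrArg Prod.snd (congrArg (fun h => h.hom x) hab)⟩
    exact (IsCont l Γ).prop_of_mono φ (isCont_prod (p.prop_diag_obj _) (p.prop_diag_obj _))

instance : (IsCont l Γ).IsClosedUnderFiniteProducts := .mk'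

variable (l Γ) in
/-- The abelian category `R(Γ; ℤ_l)` of continuous linear representations of `Γ` on finitely
generated `ℤ_l`-modules. -/
abbrev Cat : Type (u + 1) := (IsCont l Γ).FullSubcategory

instance : HasExt.{u + 1} (Cat l Γ) := HasExt.standard _

/-- The group `Ext^i(M, N)` in `R(Γ; ℤ_l)`. -/
abbrev Ext (M N : Cat l Γ) (i : ℕ) : Type (u + 1) := Abelian.Ext.{u + 1} M N i

/-- The underlying equivariant linear map of a morphism. -/
def linMap {M N : Cat l Γ} (f : M ⟶ N) : M.obj →ₗ[ℤ_[l]] N.obj := f.hom.hom.toLinearMap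

section FiniteField

variable {k : Type u} [Field k] [Fintype k]

/-- The Frobenius `x ↦ x ^ q` in `Gal(k̄/k)`. -/
abbrev frobGen (k : Type u) [Field k] [Fintype k] : Gal(AlgebraicClosure k/k) :=
  FiniteField.frobeniusAlgEquivOfAlgebraic k (AlgebraicClosure k)

/-- `R_l = R(Gal(k̄/k); ℤ_l)`. -/
abbrev FF (l : ℕ) [Fact l.Prime] (k : Type u) [Field k] [Fintype k] : Type (u + 1) :=
  Cat l Gal(AlgebraicClosure k/k)

/-- The Frobenius endomorphism `π_M` on `M ⊗ ℚ_l`. -/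
def frobQ (M : FF l k) : ℚ_[l] ⊗[ℤ_[l]] M.obj →ₗ[ℚ_[l]] ℚ_[l] ⊗[ℤ_[l]] M.obj :=
  (M.obj.ρ (frobGen k)).baseChange ℚ_[l]

/-- The characteristic polynomial `P_M` of `π_M`. -/
def charPoly (M : FF l k) : ℚ_[l][X] :=
  haveI := M.property.1
  (frobQ M).charpoly

/-- The minimum polynomial `m_M` of `π_M`. -/
def minPoly (M : FF l k) : ℚ_[l][X] := minpoly ℚ_[l] (frobQ M)

/-- The (graph of the) composite
`Hom(M, N) = Hom(M̄, N̄)^Γ → Hom(M̄, N̄)_Γ ≅ H¹(Γ, Hom(M̄, N̄)) → Ext¹(M, N)`,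
where `M̄` is the `ℤ_l`-module underlying `M`.
The class of a cocycle `φ` in `H¹` corresponds to the class of `φ(γ)` in the coinvariants, `γ` being
the Frobenius generator of `Γ`, and the last map, the edge map of the spectral sequence
`H^r(Γ, Ext^s(M̄, N̄)) ⇒ Ext^{r+s}(M, N)`, sends the class of the cocycle `g ↦ g s g⁻¹ - s`
defined by an extension `E` of `M` by `N` and a section `s : M̄ → Ē` to the class of `E`.
So `u` goes to the class of `E` when `γ s γ⁻¹ - s = u` for some section `s`. -/
def IsEdge {M N : FF l k} (u : M ⟶ N) (e : Ext M N 1) : Prop :=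
  ∃ (E : FF l k) (i : N ⟶ E) (q : E ⟶ M) (w : i ≫ q = 0)
    (hS : (ShortComplex.mk i q w).ShortExact) (s : M.obj →ₗ[ℤ_[l]] E.obj),
    (∀ x, linMap q (s x) = x) ∧
    (∀ x, E.obj.ρ (frobGen k) (s x) =
      s (M.obj.ρ (frobGen k) x) + linMap i (linMap u (M.obj.ρ (frobGen k) x))) ∧
    hS.extClass = e

end FiniteField

end LRep

/-! ### `F`-crystals -/

namespace FCrystal

variable (p : ℕ) [Fact p.Prime] (k : Type u) [Field k]

/-- The powers of the Frobenius `σ` of `W(k)`, as an action of the monoid `ℕ`. -/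
instance : MulSemiringAction (Multiplicative ℕ) (WittVector p k) where
  smul n x := (WittVector.frobenius : WittVector p k →+* WittVector p k)^[n.toAdd] x
  one_smul _ := rfl
  mul_smul m n x := Function.iterate_add_apply _ m.toAdd n.toAdd x
  smul_zero _ := iterate_map_zero _ _
  smul_add _ _ _ := iterate_map_add _ _ _ _
  smul_one _ := iterate_map_one _ _
  smul_mul _ _ _ := iterate_map_mul _ _ _ _

/-- The skew polynomial ring `A = W(k)[F, σ]`, with the relation `F · a = σ(a) · F`. -/
abbrev DRing : Type u := SkewPolynomial (WittVector p k)

variable {p k}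

/-- The underlying `W(k)`-module of a left `A`-module. -/
instance (M : ModuleCat.{u} (DRing p k)) : Module (WittVector p k) M :=
  Module.compHom M (SkewPolynomial.CRingHom : WittVector p k →+* DRing p k)

theorem smul_def {M : ModuleCat.{u} (DRing p k)} (a : WittVector p k) (m : M) :
    a • m = (SkewPolynomial.C a : DRing p k) • m := rfl

theorem X_mul_C (a : WittVector p k) :
    (SkewPolynomial.X * SkewPolynomial.C a : DRing p k) =
      SkewPolynomial.C (WittVector.frobenius a) * SkewPolynomial.X := by
  rw [← SkewPolynomial.monomial_zero_left, SkewPolynomial.X_mul_monomial,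
    ← SkewPolynomial.monomial_zero_left, SkewPolynomial.monomial_mul_X]
  rfl

/-- The `σ`-linear endomorphism `F` of a left `A`-module. -/
def frob (M : ModuleCat.{u} (DRing p k)) :
    M →ₛₗ[(WittVector.frobenius : WittVector p k →+* WittVector p k)] M where
  toFun m := (SkewPolynomial.X : DRing p k) • m
  map_add' := smul_add _
  map_smul' a m := by rw [smul_def, smul_def, ← mul_smul, ← mul_smul, X_mul_C]

variable [CharP k p] [PerfectRing k p]

variable (p k) in
/-- The `F`-crystals over the perfect field `k`: finitely generated `W(k)`-modules with a `σ`-linear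
endomorphism `F` (i.e. left `A`-modules that are finitely generated over `W(k)`) such that the
kernel of `F` is torsion. -/
def IsFCrystal : ObjectProperty (ModuleCat.{u} (DRing p k)) := fun M =>
  Module.Finite (WittVector p k) M ∧
    ∀ m : M, frob M m = 0 → m ∈ Submodule.torsion (WittVector p k) M

/-- The `W(k)`-linear map underlying an `A`-linear map. -/
def linMap {M N : ModuleCat.{u} (DRing p k)} (f : M ⟶ N) : M →ₗ[WittVector p k] N where
  toFun := f.hom
  map_add' := map_add f.hom
  map_smul' a m := by rw [smul_def, map_smul]; rfl

theorem linMap_frob {M N : ModuleCat.{u} (DRing p k)} (f : M ⟶ N) (m : M) :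
    linMap f (frob M m) = frob N (linMap f m) := map_smul f.hom _ _

theorem mem_torsion {M : ModuleCat.{u} (DRing p k)} (m : M) :
    m ∈ Submodule.torsion (WittVector p k) M ↔ ∃ a : WittVector p k, a ≠ 0 ∧ a • m = 0 := by
  rw [Submodule.mem_torsion_iff]
  constructor
  · rintro ⟨a, ha⟩
    exact ⟨a, nonZeroDivisors.coe_ne_zero a, ha⟩
  · rintro ⟨a, h0, ha⟩
    exact ⟨⟨a, mem_nonZeroDivisors_of_ne_zero h0⟩, ha⟩

theorem mem_torsion_of_injective {M N : ModuleCat.{u} (DRing p k)} (f : M ⟶ N)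
    (hf : Function.Injective (linMap f)) {m : M}
    (hm : linMap f m ∈ Submodule.torsion (WittVector p k) N) :
    m ∈ Submodule.torsion (WittVector p k) M := by
  rw [mem_torsion] at hm ⊢
  obtain ⟨a, h0, ha⟩ := hm
  exact ⟨a, h0, hf (by rw [map_smul, ha, map_zero])⟩

instance : (IsFCrystal p k).IsClosedUnderSubobjects where
  prop_of_mono {X Y} f _ hY := by
    obtain ⟨_, h⟩ := hY
    have hinj : Function.Injective (linMap f) := (ModuleCat.mono_iff_injective f).1 inferInstance
    exact ⟨Module.Finite.of_injective (linMap f) hinj, fun m hm =>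
      mem_torsion_of_injective f hinj (h _ (by rw [← linMap_frob, hm, map_zero]))⟩

instance : (IsFCrystal p k).ContainsZero where
  exists_zero := by
    refine ⟨ModuleCat.of (DRing p k) PUnit.{u + 1}, ModuleCat.isZero_of_subsingleton _, ?_, ?_⟩
    · exact @Module.Finite.of_finite _ _ _ _ _ (inferInstanceAs (Finite PUnit.{u + 1}))
    · intro m _
      rw [show m = 0 from Subsingleton.elim (α := PUnit.{u + 1}) _ _]
      exact zero_mem _

theorem isFCrystal_prod {M N : ModuleCat.{u} (DRing p k)} (hM : IsFCrystal p k M)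
    (hN : IsFCrystal p k N) : IsFCrystal p k (ModuleCat.of (DRing p k) (M × N)) := by
  obtain ⟨_, hM⟩ := hM
  obtain ⟨_, hN⟩ := hN
  refine ⟨?_, ?_⟩
  · let e : (M × N) →ₗ[WittVector p k] ModuleCat.of (DRing p k) (M × N) :=
      { toFun := id, map_add' := fun _ _ => rfl, map_smul' := fun _ _ => rfl }
    exact Module.Finite.of_surjective e Function.surjective_id
  · rintro ⟨m, n⟩ h
    obtain ⟨a, ha0, ha⟩ := (mem_torsion m).1 (hM m (congrArg Prod.fst h))
    obtain ⟨b, hb0, hb⟩ := (mem_torsion n).1 (hN n (congrArg Prod.snd h))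
    refine (mem_torsion _).2 ⟨b * a, mul_ne_zero hb0 ha0, Prod.ext ?_ ?_⟩
    · exact (mul_smul b a m).trans (by rw [ha, smul_zero]; rfl)
    · rw [mul_comm]
      exact (mul_smul a b n).trans (by rw [hb, smul_zero]; rfl)

instance : (IsFCrystal p k).IsClosedUnderBinaryProducts where
  limitsOfShape_le := by
    rintro X ⟨q⟩
    let f₁ := q.π.app ⟨.left⟩
    let f₂ := q.π.app ⟨.right⟩
    let φ : X ⟶ ModuleCat.of (DRing p k) ((q.diag.obj ⟨.left⟩ : ModuleCat.{u} (DRing p k)) ×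
        (q.diag.obj ⟨.right⟩ : ModuleCat.{u} (DRing p k))) :=
      ModuleCat.ofHom (f₁.hom.prod f₂.hom)
    have : Mono φ := ⟨fun a b hab => q.isLimit.hom_ext fun j => by
      rcases j with ⟨_ | _⟩
      · ext x
        exact congrArg Prod.fst (congrArg (fun h => h.hom x) hab)
      · ext x
        exact congrArg Prod.snd (congrArg (fun h => h.hom x) hab)⟩
    exact (IsFCrystal p k).prop_of_mono φ (isFCrystal_prod (q.prop_diag_obj _) (q.prop_diag_obj _))

/-! The isocrystal attached to an `F`-crystal -/

/-- The Frobenius `σ ⊗ F` of `Frac(W(k)) ⊗ M`. -/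
def isocFrob (M : ModuleCat.{u} (DRing p k)) :
    FractionRing (WittVector p k) ⊗[WittVector p k] M
      →ₛₗ[WittVector.FractionRing.frobeniusRingHom p k]
      FractionRing (WittVector p k) ⊗[WittVector p k] M :=
  let φ : FractionRing (WittVector p k)
      →ₛₗ[(WittVector.frobenius : WittVector p k →+* WittVector p k)]
      FractionRing (WittVector p k) :=
    { toFun := WittVector.FractionRing.frobeniusRingHom p k
      map_add' := map_add _
      map_smul' := fun a x => by
        rw [Algebra.smul_def, Algebra.smul_def, map_mul]
        congr 1
        exact IsFractionRing.ringEquivOfRingEquiv_algebraMap (WittVector.frobeniusEquiv p k) a }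
  { toFun := TensorProduct.map φ (frob M)
    map_add' := map_add _
    map_smul' := fun a x => by
      induction x with
      | zero => simp
      | add x y hx hy => rw [smul_add, map_add, hx, hy, map_add, smul_add]
      | tmul x m =>
        rw [smul_tmul', map_tmul, map_tmul, smul_tmul']
        congr 1
        exact map_mul (WittVector.FractionRing.frobeniusRingHom p k) a x }

theorem isocFrob_tmul (M : ModuleCat.{u} (DRing p k)) (a : FractionRing (WittVector p k)) (m : M) :
    isocFrob M (a ⊗ₜ m) = WittVector.FractionRing.frobeniusRingHom p k a ⊗ₜ frob M m := rfl

theorem tmul_eq_zero {M : ModuleCat.{u} (DRing p k)} {m : M} :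
    (1 : FractionRing (WittVector p k)) ⊗ₜ[WittVector p k] m = 0 ↔
      m ∈ Submodule.torsion (WittVector p k) M := by
  have h := IsLocalizedModule.eq_zero_iff (nonZeroDivisors (WittVector p k))
    (TensorProduct.mk (WittVector p k) (FractionRing (WittVector p k)) M 1) (m := m)
  rw [Submodule.mem_torsion_iff]
  exact h

theorem exists_smul_eq {M : ModuleCat.{u} (DRing p k)}
    (x : FractionRing (WittVector p k) ⊗[WittVector p k] M) :
    ∃ a : WittVector p k, a ≠ 0 ∧ ∃ m : M, a • x = 1 ⊗ₜ m := by
  obtain ⟨⟨m, a⟩, h⟩ := IsLocalizedModule.surj (nonZeroDivisors (WittVector p k))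
    (TensorProduct.mk (WittVector p k) (FractionRing (WittVector p k)) M 1) x
  exact ⟨a, nonZeroDivisors.coe_ne_zero a, m, h⟩

theorem isocFrob_smul {M : ModuleCat.{u} (DRing p k)} (a : WittVector p k)
    (x : FractionRing (WittVector p k) ⊗[WittVector p k] M) :
    isocFrob M (a • x) = WittVector.frobenius a • isocFrob M x := by
  rw [← algebraMap_smul (FractionRing (WittVector p k)) a x, LinearMap.map_smulₛₗ,
    ← algebraMap_smul (FractionRing (WittVector p k)) (WittVector.frobenius a)]
  congr 1
  exact IsFractionRing.ringEquivOfRingEquiv_algebraMap (WittVector.frobeniusEquiv p k) a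

theorem frobenius_ne_zero {a : WittVector p k} (ha : a ≠ 0) : WittVector.frobenius a ≠ 0 :=
  fun h => ha ((WittVector.frobenius_bijective p k).1 (h.trans (map_zero _).symm))

theorem isocFrob_injective {M : ModuleCat.{u} (DRing p k)} (hM : IsFCrystal p k M) :
    Function.Injective (isocFrob M) := by
  refine (injective_iff_map_eq_zero _).2 fun x hx => ?_
  obtain ⟨a, ha, m, hm⟩ := exists_smul_eq x
  have h1 : isocFrob M (1 ⊗ₜ m) = 0 := by rw [← hm, isocFrob_smul, hx, smul_zero]
  rw [isocFrob_tmul, map_one, tmul_eq_zero, mem_torsion] at h1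
  obtain ⟨c, hc, h1⟩ := h1
  obtain ⟨c, rfl⟩ := (WittVector.frobenius_bijective p k).2 c
  rw [← LinearMap.map_smulₛₗ] at h1
  have h2 := (mem_torsion _).1 (hM.2 _ h1)
  obtain ⟨d, hd, h2⟩ := h2
  have h3 : (1 : FractionRing (WittVector p k)) ⊗ₜ[WittVector p k] m = 0 :=
    tmul_eq_zero.2 ((mem_torsion _).2 ⟨d * c, mul_ne_zero hd
      (fun h => hc (by rw [h, map_zero])), by rw [mul_smul, h2]⟩)
  rw [h3] at hm
  rw [← algebraMap_smul (FractionRing (WittVector p k)) a x] at hm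
  exact (smul_eq_zero.1 hm).resolve_left (by
    simpa using ha)

theorem isocFrob_basis {M : ModuleCat.{u} (DRing p k)} (hM : IsFCrystal p k M)
    {ι : Type*} [Finite ι] (b : Module.Basis ι (FractionRing (WittVector p k))
      (FractionRing (WittVector p k) ⊗[WittVector p k] M)) :
    ∃ b' : Module.Basis ι (FractionRing (WittVector p k))
      (FractionRing (WittVector p k) ⊗[WittVector p k] M), ∀ i, b' i = isocFrob M (b i) := by
  have := hM.1
  have hli : LinearIndependent (FractionRing (WittVector p k)) fun i => isocFrob M (b i) := by
    have := Fintype.ofFinite ι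
    rw [Fintype.linearIndependent_iff]
    intro g hg i
    have hsurj := (WittVector.FractionRing.frobenius p k).surjective
    choose g' hg' using fun i => hsurj (g i)
    have h1 : isocFrob M (∑ i, g' i • b i) = 0 := by
      rw [map_sum, ← hg]
      refine Finset.sum_congr rfl fun i _ => ?_
      rw [LinearMap.map_smulₛₗ, ← hg' i]
      rfl
    have h2 := isocFrob_injective hM (h1.trans (map_zero _).symm)
    have h3 := Fintype.linearIndependent_iff.1 b.linearIndependent g' h2 i
    rw [← hg', h3, map_zero]
  have := Fintype.ofFinite ι
  rcases isEmpty_or_nonempty ι with h | h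
  · exact ⟨b, fun i => h.elim i⟩
  · exact ⟨basisOfLinearIndependentOfCardEqFinrank hli (Module.finrank_eq_card_basis b).symm,
      fun i => by simp⟩

theorem exists_frob_eq {M : ModuleCat.{u} (DRing p k)} (hM : IsFCrystal p k M) (m : M) :
    ∃ a : WittVector p k, a ≠ 0 ∧ ∃ n : M, frob M n = a • m := by
  have := hM.1
  obtain ⟨b', hb'⟩ := isocFrob_basis hM (Module.finBasis (FractionRing (WittVector p k))
      (FractionRing (WittVector p k) ⊗[WittVector p k] M))
  have hsurj : ∀ y, ∃ x, isocFrob M x = y := by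
    intro y
    choose g' hg' using fun i => (WittVector.FractionRing.frobenius p k).surjective (b'.repr y i)
    refine ⟨∑ i, g' i • Module.finBasis (FractionRing (WittVector p k))
      (FractionRing (WittVector p k) ⊗[WittVector p k] M) i, ?_⟩
    rw [map_sum]
    conv_rhs => rw [← b'.sum_repr y]
    refine Finset.sum_congr rfl fun i _ => ?_
    rw [LinearMap.map_smulₛₗ, ← hg' i, hb']
    rfl
  obtain ⟨x, hx⟩ := hsurj (1 ⊗ₜ m)
  obtain ⟨a, ha, n, hn⟩ := exists_smul_eq x
  have h1 : (1 : FractionRing (WittVector p k)) ⊗ₜ[WittVector p k]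
      (frob M n - WittVector.frobenius a • m) = 0 := by
    rw [tmul_sub, tmul_smul, ← hx, ← isocFrob_smul, hn, isocFrob_tmul, map_one, sub_self]
  obtain ⟨c, hc, h1⟩ := (mem_torsion _).1 (tmul_eq_zero.1 h1)
  obtain ⟨c, rfl⟩ := (WittVector.frobenius_bijective p k).2 c
  rw [smul_sub, sub_eq_zero, ← LinearMap.map_smulₛₗ, ← mul_smul] at h1
  exact ⟨_, mul_ne_zero hc (frobenius_ne_zero ha), _, h1⟩

instance : (IsFCrystal p k).IsClosedUnderQuotients where
  prop_of_epi {X Y} f _ hX := by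
    have := hX.1
    have hs : Function.Surjective (linMap f) := (ModuleCat.epi_iff_surjective f).1 inferInstance
    refine ⟨Module.Finite.of_surjective (linMap f) hs, fun y hy => ?_⟩
    obtain ⟨x, rfl⟩ := hs y
    obtain ⟨K, i, _, x', hx', hi⟩ : ∃ (K : ModuleCat.{u} (DRing p k)) (i : K ⟶ X) (_ : Mono i)
        (x' : K), linMap i x' = frob X x ∧ ∀ n, linMap f (linMap i n) = 0 := by
      refine ⟨ModuleCat.of (DRing p k) (LinearMap.ker f.hom),
        ModuleCat.ofHom (LinearMap.ker f.hom).subtype,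
        (ModuleCat.mono_iff_injective _).2 Subtype.val_injective, ⟨frob X x, ?_⟩, rfl,
        fun n => n.2⟩
      rw [← linMap_frob] at hy
      exact hy
    obtain ⟨a, ha, n, hn⟩ := exists_frob_eq ((IsFCrystal p k).prop_of_mono i hX) x'
    obtain ⟨a, rfl⟩ := (WittVector.frobenius_bijective p k).2 a
    have h1 : frob X (linMap i n) = WittVector.frobenius a • frob X x := by
      rw [← linMap_frob, hn, map_smul, hx']
    rw [← LinearMap.map_smulₛₗ, ← sub_eq_zero, ← map_sub] at h1
    obtain ⟨d, hd, h2⟩ := (mem_torsion _).1 (hX.2 _ h1)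
    have h3 : linMap f (linMap i n) = 0 := hi n
    refine (mem_torsion _).2 ⟨d * a, mul_ne_zero hd (fun h => ha (by rw [h, map_zero])), ?_⟩
    have h4 := congrArg (linMap f) h2
    rw [map_smul, map_sub, h3, zero_sub, smul_neg, map_zero, neg_eq_zero, map_smul, ← mul_smul] at h4
    exact h4

instance : (IsFCrystal p k).IsClosedUnderFiniteProducts := .mk'

variable (p k) in
/-- The abelian category `Crys⁺(k)` of `F`-crystals over `k`. -/
abbrev Cat : Type (u + 1) := (IsFCrystal p k).FullSubcategory

instance : HasExt.{u + 1} (Cat p k) := HasExt.standard _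

/-- The group `Ext^i(M, N)` in `Crys⁺(k)`. -/
abbrev Ext (M N : Cat p k) (i : ℕ) : Type (u + 1) := Abelian.Ext.{u + 1} M N i

/-- The rank `r(M)` of the underlying `W(k)`-module. -/
def rank (M : Cat p k) : ℕ := Module.finrank (WittVector p k) M.obj

end FCrystal

namespace FCrystal

variable {p : ℕ} [Fact p.Prime] {k : Type u} [Field k] [Fintype k] [CharP k p]

variable (p k) in
/-- The exponent `a` in `q = [k] = p ^ a`. -/
def deg : ℕ := Nat.log p (Fintype.card k)

theorem card_eq : Fintype.card k = p ^ deg p k := by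
  obtain ⟨n, hp, hn⟩ := FiniteField.card k p
  rw [deg, hn, Nat.log_pow hp.one_lt]

theorem frobenius_iterate_deg (x : WittVector p k) :
    (WittVector.frobenius : WittVector p k →+* WittVector p k)^[deg p k] x = x := by
  ext n
  rw [WittVector.iterate_frobenius_coeff, ← card_eq, FiniteField.pow_card]

/-- The `W(k)`-linear endomorphism `π_M = F ^ a` of `M`. -/
def frobPow (M : ModuleCat.{u} (DRing p k)) : M →ₗ[WittVector p k] M where
  toFun := (frob M)^[deg p k]
  map_add' := iterate_map_add (frob M) _
  map_smul' c m := by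
    have h (n : ℕ) : (frob M)^[n] (c • m) =
        (WittVector.frobenius : WittVector p k →+* WittVector p k)^[n] c • (frob M)^[n] m := by
      induction n with
      | zero => rfl
      | succ n ih =>
        rw [Function.iterate_succ_apply', ih, LinearMap.map_smulₛₗ, Function.iterate_succ_apply',
          Function.iterate_succ_apply']
    rw [h, frobenius_iterate_deg]
    rfl

/-- The Frobenius endomorphism `π_M` on `Frac(W(k)) ⊗ M`. -/
def frobQ (M : Cat p k) : FractionRing (WittVector p k) ⊗[WittVector p k] M.obj
    →ₗ[FractionRing (WittVector p k)] FractionRing (WittVector p k) ⊗[WittVector p k] M.obj :=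
  (frobPow M.obj).baseChange _

/-- The minimum polynomial `m_M` of `π_M`. -/
def minPoly (M : Cat p k) : (FractionRing (WittVector p k))[X] := minpoly _ (frobQ M)

theorem isocFrob_frobQ (M : Cat p k) (x) :
    isocFrob M.obj (frobQ M x) = frobQ M (isocFrob M.obj x) := by
  induction x with
  | zero => simp
  | add x y hx hy => rw [map_add, map_add, hx, hy, map_add, map_add]
  | tmul b m =>
    rw [isocFrob_tmul]
    change isocFrob M.obj (b ⊗ₜ (frobPow M.obj m)) = _ ⊗ₜ (frobPow M.obj (frob M.obj m))
    rw [isocFrob_tmul]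
    congr 1
    exact (Function.iterate_succ_apply' (frob M.obj) (deg p k) m).symm.trans
      (Function.iterate_succ_apply (frob M.obj) (deg p k) m)

variable (p k) in
/-- The inclusion of `ℤ_p = W(𝔽_p)` into `W(k)`. -/
def ofZp : ℤ_[p] →+* WittVector p k :=
  (WittVector.map (ZMod.castHom dvd_rfl k)).comp (WittVector.equiv p).symm.toRingHom

theorem ofZp_injective : Function.Injective (ofZp p k) :=
  (WittVector.map_injective _ (RingHom.injective _)).comp (WittVector.equiv p).symm.injective

variable (p k) in
/-- The inclusion of `ℚ_p` into `Frac(W(k))`. -/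
def ofQp : ℚ_[p] →+* FractionRing (WittVector p k) :=
  IsFractionRing.map (K := ℚ_[p]) (L := FractionRing (WittVector p k)) (ofZp_injective (k := k))

theorem ofQp_coe (x : ℤ_[p]) : ofQp p k x = algebraMap _ _ (ofZp p k x) :=
  IsLocalization.map_eq (Q := FractionRing (WittVector p k))
    (nonZeroDivisors_le_comap_nonZeroDivisors_of_injective _ (ofZp_injective (k := k))) x

theorem exists_ofZp {x : WittVector p k} (hx : WittVector.frobenius x = x) :
    ∃ y, ofZp p k y = x := by
  have h (n : ℕ) : ∃ z : ZMod p, ZMod.castHom dvd_rfl k z = x.coeff n := by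
    have h1 : x.coeff n ^ p = x.coeff n := by
      rw [← WittVector.coeff_frobenius_charP, hx]
    rw [← Subfield.mem_bot_iff_pow_eq_self k p, ← ZMod.fieldRange_castHom_eq_bot p] at h1
    exact h1
  choose z hz using h
  refine ⟨WittVector.equiv p (WittVector.mk p z), ?_⟩
  ext n
  simp [ofZp, hz]

theorem exists_ofQp {x : FractionRing (WittVector p k)}
    (hx : WittVector.FractionRing.frobeniusRingHom p k x = x) : ∃ y, ofQp p k y = x := by
  obtain ⟨a, b, hb, rfl⟩ := IsFractionRing.div_surjective (A := WittVector p k) x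
  obtain ⟨n, c, hc, rfl⟩ := WittVector.exists_eq_pow_p_mul b (nonZeroDivisors.ne_zero hb)
  obtain ⟨c, rfl⟩ := WittVector.isUnit_of_coeff_zero_ne_zero c hc
  have hp : (p : FractionRing (WittVector p k)) ≠ 0 := WittVector.FractionRing.p_nonzero p k
  have h1 : algebraMap (WittVector p k) (FractionRing (WittVector p k)) a /
      algebraMap _ _ ((p : WittVector p k) ^ n * c) =
      algebraMap _ _ (a * ((c⁻¹ : (WittVector p k)ˣ) : WittVector p k)) / (p : FractionRing (WittVector p k)) ^ n := by
    have hc' : algebraMap (WittVector p k) (FractionRing (WittVector p k)) c ≠ 0 :=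
      (c.isUnit.map _).ne_zero
    rw [div_eq_div_iff (by rw [map_mul, map_pow, map_natCast]; exact mul_ne_zero (pow_ne_zero _ hp) hc') (pow_ne_zero _ hp), map_mul, map_mul, map_pow, map_natCast]
    have : algebraMap (WittVector p k) (FractionRing (WittVector p k)) ((c⁻¹ : (WittVector p k)ˣ) : WittVector p k) * algebraMap _ _ (c : WittVector p k) = 1 := by
      rw [← map_mul, Units.inv_mul, map_one]
    linear_combination (-(algebraMap _ _ a * (p : FractionRing (WittVector p k)) ^ n)) * this
  rw [h1] at hx ⊢
  generalize a * ((c⁻¹ : (WittVector p k)ˣ) : WittVector p k) = y at hx ⊢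
  rw [map_div₀, map_pow, map_natCast, div_left_inj' (pow_ne_zero _ hp)] at hx
  have h2 : algebraMap (WittVector p k) (FractionRing (WittVector p k)) (WittVector.frobenius y) = algebraMap _ _ y := by
    rw [← hx]
    exact (IsFractionRing.ringEquivOfRingEquiv_algebraMap (WittVector.frobeniusEquiv p k) y).symm
  obtain ⟨z, rfl⟩ := exists_ofZp (IsFractionRing.injective _ _ h2)
  exact ⟨z / (p : ℚ_[p]) ^ n, by rw [map_div₀, map_pow, map_natCast, ofQp_coe]⟩

theorem exists_charPoly (M : Cat p k) :
    ∃ P : ℚ_[p][X], P.map (ofQp p k) =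
      haveI := M.property.1
      (frobQ M).charpoly := by
  have := M.property.1
  let b := Module.finBasis (FractionRing (WittVector p k))
      (FractionRing (WittVector p k) ⊗[WittVector p k] M.obj)
  obtain ⟨b', hb'⟩ := isocFrob_basis M.property b
  have h1 : LinearMap.toMatrix b' b' (frobQ M) =
      (LinearMap.toMatrix b b (frobQ M)).map (WittVector.FractionRing.frobeniusRingHom p k) := by
    ext i j
    rw [LinearMap.toMatrix_apply, hb', ← isocFrob_frobQ, ← b.sum_repr (frobQ M (b j)), map_sum]
    simp_rw [LinearMap.map_smulₛₗ, ← hb']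
    rw [b'.repr_sum_self, Matrix.map_apply, LinearMap.toMatrix_apply]
  have h2 : (frobQ M).charpoly.map (WittVector.FractionRing.frobeniusRingHom p k) =
      (frobQ M).charpoly := by
    conv_rhs => rw [← LinearMap.charpoly_toMatrix (frobQ M) b', h1]
    rw [← LinearMap.charpoly_toMatrix (frobQ M) b, Matrix.charpoly_map]
  have h3 : (frobQ M).charpoly ∈ Polynomial.lifts (ofQp p k) := by
    rw [Polynomial.lifts_iff_coeff_lifts]
    intro n
    exact exists_ofQp (by rw [← Polynomial.coeff_map, h2])
  exact (Polynomial.mem_lifts _).1 h3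

/-- The characteristic polynomial `P_M` of `π_M` on `Frac(W(k)) ⊗ M`, as a polynomial with
coefficients in `ℚ_p`. -/
def charPoly (M : Cat p k) : ℚ_[p][X] := (exists_charPoly M).choose

theorem charPoly_map (M : Cat p k) : (charPoly M).map (ofQp p k) =
    haveI := M.property.1
    (frobQ M).charpoly := (exists_charPoly M).choose_spec

/-- The sum `s(M)` of the slopes of `M`, that is `ord_p(c) / a`, where `c` is the constant term of
`P_M` and `q = p ^ a`. -/
def slopeSum (M : Cat p k) : ℚ := ((charPoly M).coeff 0).valuation / deg p k

/-! Base change to the algebraic closure `k̄` -/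

instance : Algebra (WittVector p k) (WittVector p (AlgebraicClosure k)) :=
  (WittVector.map (algebraMap k (AlgebraicClosure k))).toAlgebra

variable (p k) in
/-- The Frobenius `σ` of `W(k̄)`. -/
def frobBar : WittVector p (AlgebraicClosure k)
    →ₛₗ[(WittVector.frobenius : WittVector p k →+* WittVector p k)]
    WittVector p (AlgebraicClosure k) where
  toFun := WittVector.frobenius
  map_add' := map_add _
  map_smul' a x := by
    rw [Algebra.smul_def, Algebra.smul_def, map_mul]
    congr 1
    ext n
    change _ = (WittVector.map (algebraMap k (AlgebraicClosure k)) (WittVector.frobenius a)).coeff n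
    rw [WittVector.coeff_frobenius_charP, WittVector.map_coeff, WittVector.coeff_frobenius_charP,
      map_pow]
    rfl

variable (p k) in
/-- The automorphism of `W(k̄)` induced by the Frobenius generator `γ : x ↦ x ^ q` of
`Gal(k̄/k)`. -/
def galBar : WittVector p (AlgebraicClosure k) →ₗ[WittVector p k]
    WittVector p (AlgebraicClosure k) where
  toFun := WittVector.map (LRep.frobGen k : AlgebraicClosure k →+* AlgebraicClosure k)
  map_add' := map_add _
  map_smul' a x := by
    rw [Algebra.smul_def, Algebra.smul_def, map_mul]
    congr 1
    ext n
    exact (LRep.frobGen k).commutes (a.coeff n)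

/-- The underlying `W(k̄)`-module of the `F`-crystal `M̄` over `k̄` deduced from `M`. -/
abbrev Bar (M : Cat p k) : Type u := WittVector p (AlgebraicClosure k) ⊗[WittVector p k] M.obj

/-- The Frobenius `σ ⊗ F` of `M̄`. -/
def barFrob (M : Cat p k) : Bar M
    →ₛₗ[(WittVector.frobenius : WittVector p k →+* WittVector p k)] Bar M :=
  TensorProduct.map (frobBar p k) (frob M.obj)

/-- The action `γ ⊗ 1` of the Frobenius generator `γ` of `Gal(k̄/k)` on `M̄`. -/
def barGal (M : Cat p k) : Bar M →ₗ[WittVector p k] Bar M := (galBar p k).rTensor M.obj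

/-- The map `M̄ → N̄` deduced from `f : M → N`. -/
def barMap {M N : Cat p k} (f : M ⟶ N) : Bar M →ₗ[WittVector p (AlgebraicClosure k)] Bar N :=
  (linMap f.hom).baseChange _

/-- The (graph of the) composite
`Hom(M, N) = Hom(M̄, N̄)^Γ → Hom(M̄, N̄)_Γ ≅ H¹(Γ, Hom(M̄, N̄)) → Ext¹(M, N)`,
where `Γ = Gal(k̄/k)` and `M̄` is the `F`-crystal over `k̄` deduced from `M`.
The class of a cocycle `φ` in `H¹` corresponds to the class of `φ(γ)` in the coinvariants, `γ` being
the Frobenius generator of `Γ`, and the last map, the edge map of the spectral sequence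
`H^r(Γ, Ext^s(M̄, N̄)) ⇒ Ext^{r+s}(M, N)`, sends the class of the cocycle `g ↦ g s g⁻¹ - s`
defined by an extension `E` of `M` by `N` and a section `s : M̄ → Ē` in the category of
`F`-crystals over `k̄` to the class of `E`.
So `u` goes to the class of `E` when `γ s γ⁻¹ - s = u` for some section `s`. -/
def IsEdge {M N : Cat p k} (u : M ⟶ N) (e : Ext M N 1) : Prop :=
  ∃ (E : Cat p k) (i : N ⟶ E) (q : E ⟶ M) (w : i ≫ q = 0)
    (hS : (ShortComplex.mk i q w).ShortExact)
    (s : Bar M →ₗ[WittVector p (AlgebraicClosure k)] Bar E),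
    (∀ x, s (barFrob M x) = barFrob E (s x)) ∧
    (∀ x, barMap q (s x) = x) ∧
    (∀ x, barGal E (s x) = s (barGal M x) + barMap i (barMap u (barGal M x))) ∧
    hS.extClass = e

end FCrystal

end

/-! Both categories are instances of one situation: finitely generated modules over a principal
ideal domain `R` with a `σ`-linear endomorphism `F`. For representations `R = ℤ_l`, `σ = id` and `F`
is the action of `γ`; for `F`-crystals `R = W(k)`. This is axiomatized by `IsSemilinearCat`. If `M`
is free over `R`, an extension of `M` by `N` has an `R`-linear section `s`, and its class is
determined by the defect `F s - s F`. Hence Hom and Ext¹ are the kernel and cokernel of `d : s ↦ F s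
- s F`, from linear to `σ`-linear maps. Ext² vanishes because a defect extends along a linearly
split inclusion (`ext_eq_zero_of_free`). Every object has a two-term resolution by free ones, so Ext
vanishes above degree 2.

In these terms the edge map sends `u` to the class of `c u F` up to sign. For representations `c =
1`. For `F`-crystals one takes `β` in `W(k̄)` with `γ β = β + 1`: if a section over `k̄` satisfies
`γ s γ⁻¹ - s = u`, then `s - β u` descends to `W(k)` and has defect `-c u F`, where `c = σ β - β`
lies in `W(k)` and has trace 1 (`exists_trace_eq_one`, `FCrystal.isEdge_iff`).

A torsion first argument gives `[Ext⁰][Ext²] = [Ext¹]`, because there are as many linear as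
`σ`-linear maps into a given finite module. With the multiplicativity of `z` this reduces everything
to the free quotients and produces the factor `[Ext²]` (`edgeHom_of_free`).

In the free case let `ρ u = u F`. The number `z` of the map `ker d → coker d` induced by `ρ` is the
leading coefficient of `|det(d - x ρ)|` as `x = l^k` tends to 0 (`tendsto_det_sub_smul`); the
assumption on multiple roots makes this map injective (`NoCommonMultipleRoot.eq_zero`). Now `d - x
ρ` is `s ↦ F s - (1 + x) s F`, and the `n`-th power of `s ↦ F s F⁻¹`, with `n` the degree of `R`
over `ℤ_l`, is linear with eigenvalues `b_j / a_i`. So the determinant has absolute value `|det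
π_M|^{r(N)}` times the product of the `|b_j / a_i - (1 + x)^n|`. Pairs with `a_i ≠ b_j` contribute
`|1 - b_j / a_i|` in the limit, and the others contribute `|n| |x|`. The factors `|n|` cancel
against multiplication by `n` on `ker d`, since `n c u F` and `u F` have the same class when `c` has
trace 1 (`IsFrobeniusExt.zInv_matrix`). Finally `|det π_M|` is 1 for representations and
`|q|^{s(M)}` for `F`-crystals. -/

noncomputable section

/-! ### Effacing Ext classes by epimorphisms -/

section Effaceable

universe v₁ u₁ w₁

variable {C : Type u₁} [Category.{v₁} C] [Abelian C]

-- As `K` vanishes in positive degrees, `K.X 0` consists of cycles and maps onto `H⁰(K) ≅ X`. The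
-- same vanishing makes the identity of `K.X 0` a chain map from the single complex to `K`.
open HomologicalComplex in
theorem exists_epi_single_map_eq_comp {X : C} {K : CochainComplex C ℤ} [K.IsStrictlyLE 0]
    (π : K ⟶ (single C (ComplexShape.up ℤ) 0).obj X) (hπ : QuasiIso π) :
    ∃ (α : K.X 0 ⟶ X) (_ : Epi α) (t : (single C (ComplexShape.up ℤ) 0).obj (K.X 0) ⟶ K),
      (single C (ComplexShape.up ℤ) 0).map α = t ≫ π := by
  have hd : K.d 0 1 = 0 := (K.isZero_of_isStrictlyLE 0 1 (by simp)).eq_of_tgt _ _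
  let e := K.iCyclesIso 0 1 (by simp) hd
  let α := e.inv ≫ K.homologyπ 0 ≫ homologyMap π 0 ≫ (singleObjHomologySelfIso _ _ _).hom
  have hf : π.f 0 = α ≫ (singleObjXSelf (ComplexShape.up ℤ) 0 X).inv := by
    rw [← cancel_epi e.hom]
    dsimp [α, e]
    rw [Category.assoc, Category.assoc, Category.assoc, Iso.hom_inv_id_assoc, iCyclesIso_hom,
      homologyπ_naturality_assoc, homologyπ_singleObjHomologySelfIso_hom_assoc,
      ← singleObjCyclesSelfIso_inv_iCycles, Iso.hom_inv_id_assoc, ← cyclesMap_i]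
  let t : (single C (ComplexShape.up ℤ) 0).obj (K.X 0) ⟶ K :=
    mkHomFromSingle (𝟙 _) (by
      rintro j hj
      obtain rfl : (1 : ℤ) = j := by simpa using hj
      simpa using hd)
  refine ⟨α, inferInstance, t, ?_⟩
  apply from_single_hom_ext
  rw [HomologicalComplex.comp_f, hf]
  dsimp [t]
  rw [mkHomFromSingle_f, Category.comp_id]
  simp [HomologicalComplex.single_map_f_self]

-- Write `φ` as a right fraction `Q(π)⁻¹ Q(g)` whose middle complex lives in degrees at most 0.
-- Restricted to the single complex on its degree 0 term, `g` vanishes because `L` is zero in degree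
-- 0.
open DerivedCategory HomologicalComplex in
theorem exists_epi_single_comp_eq_zero [HasDerivedCategory.{w₁} C] {X : C}
    {L : CochainComplex C ℤ} (φ : Q.obj ((CochainComplex.singleFunctor C 0).obj X) ⟶ Q.obj L)
    (n : ℤ) (hn : n < 0) [L.IsStrictlyLE n] :
    ∃ (A : C) (α : A ⟶ X) (_ : Epi α),
      Q.map ((CochainComplex.singleFunctor C 0).map α) ≫ φ = 0 := by
  obtain ⟨K, _, π, h, g, rfl⟩ := right_fac_of_isStrictlyLE φ 0
  have hq : QuasiIso π := by rwa [isIso_Q_map_iff_quasiIso] at h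
  obtain ⟨α, hα, t, h1⟩ := exists_epi_single_map_eq_comp (X := X) π hq
  have h2 : t ≫ g = 0 := by
    apply from_single_hom_ext
    apply (L.isZero_of_isStrictlyLE n 0 hn).eq_of_tgt
  refine ⟨K.X 0, α, hα, ?_⟩
  refine (congrArg (fun x => Q.map x ≫ inv (Q.map π) ≫ Q.map g) h1).trans ?_
  refine (congrArg (· ≫ inv (Q.map π) ≫ Q.map g) (Q.map_comp t π)).trans ?_
  rw [Category.assoc, IsIso.hom_inv_id_assoc]
  exact (Q.map_comp t g).symm.trans ((congrArg Q.map h2).trans (Q.map_zero _ _))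

open DerivedCategory in
/-- Every class of positive degree is effaced by an epimorphism onto the source. -/
theorem exists_epi_comp_eq_zero [HasExt.{w₁} C] {X Y : C} {n : ℕ} (e : Abelian.Ext X Y (n + 1)) :
    ∃ (A : C) (α : A ⟶ X) (_ : Epi α), (Abelian.Ext.mk₀ α).comp e (zero_add _) = 0 := by
  let := HasDerivedCategory.standard C
  -- The class is a map to the shift of `Y` by `n + 1`, which is concentrated in degree `-(n + 1) <
  -- 0`.
  let ψ := ((singleFunctors C).shiftIso (n + 1) (-(n + 1)) 0 (by lia)).hom.app Y
  obtain ⟨A, α, hα, h⟩ := exists_epi_single_comp_eq_zero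
    (L := (CochainComplex.singleFunctor C (-(n + 1))).obj Y) (e.hom ≫ ψ) (-(n + 1)) (by lia)
  refine ⟨A, α, hα, Abelian.Ext.homEquiv.injective ?_⟩
  have h1 : ((singleFunctor C 0).map α ≫ e.hom) ≫ ψ = 0 := (Category.assoc _ _ _).trans h
  have h2 : (singleFunctor C 0).map α ≫ e.hom = 0 := by
    rw [← cancel_mono ψ]
    exact h1.trans Limits.zero_comp.symm
  refine Eq.trans ?_ (h2.trans (Abelian.Ext.zero_hom ..).symm)
  exact (Abelian.Ext.comp_hom _ _ _).trans (by simp [ShiftedHom.mk₀_comp])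

end Effaceable

/-! ### Categories of modules with a semilinear endomorphism, and twisted extensions -/

section Semilinear

universe v₁ u₁ w₁ u₂

variable {R : Type u₂} [CommRing R] {σ : R →+* R}
variable {C : Type u₁} [Category.{v₁} C] [Abelian C]

section Exact

variable (U : C ⥤ ModuleCat.{u} R) [U.Additive] [PreservesFiniteLimits U]
  [PreservesFiniteColimits U] {S : ShortComplex C} (hS : S.ShortExact)

include hS

theorem CategoryTheory.ShortComplex.ShortExact.injective_map :
    Function.Injective (U.map S.f).hom :=
  (hS.map_of_exact U).moduleCat_injective_f

theorem CategoryTheory.ShortComplex.ShortExact.surjective_map :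
    Function.Surjective (U.map S.g).hom :=
  (hS.map_of_exact U).moduleCat_surjective_g

theorem CategoryTheory.ShortComplex.ShortExact.exact_map :
    Function.Exact (U.map S.f).hom (U.map S.g).hom :=
  (ShortComplex.ShortExact.moduleCat_exact_iff_function_exact _).1 (hS.map_of_exact U).exact

end Exact

section

variable {U : C ⥤ ModuleCat.{u} R} [U.Additive] [PreservesFiniteLimits U]
  [PreservesFiniteColimits U] [U.Faithful]

theorem exists_retraction {S : ShortComplex C} (hS : S.ShortExact)
    (s : U.obj S.X₃ →ₗ[R] U.obj S.X₂) (hs : ∀ x, (U.map S.g).hom (s x) = x) :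
    ∃ r : U.obj S.X₂ →ₗ[R] U.obj S.X₁,
      (∀ x, (U.map S.f).hom (r x) = x - s ((U.map S.g).hom x)) ∧
      (∀ n, r ((U.map S.f).hom n) = n) ∧ ∀ m, r (s m) = 0 := by
  have hi := hS.injective_map U
  have hx := hS.exact_map U
  let t : U.obj S.X₂ →ₗ[R] U.obj S.X₂ := LinearMap.id - s ∘ₗ (U.map S.g).hom
  have ht : ∀ x, t x ∈ LinearMap.range (U.map S.f).hom := fun x => by
    obtain ⟨n, hn⟩ := (hx (t x)).1 (by simp [t, hs])
    exact ⟨n, hn⟩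
  let r := (LinearEquiv.ofInjective _ hi).symm.toLinearMap ∘ₗ t.codRestrict _ ht
  have h1 : ∀ x, (U.map S.f).hom (r x) = x - s ((U.map S.g).hom x) := fun x => by
    have := LinearEquiv.ofInjective_symm_apply (U.map S.f).hom (h := hi) (t.codRestrict _ ht x)
    exact this
  refine ⟨r, h1, fun n => hi ?_, fun m => hi ?_⟩
  · rw [h1, hx.apply_apply_eq_zero, map_zero, sub_zero]
  · rw [h1, hs, sub_self, map_zero]

end

variable [HasExt.{w₁} C]

/-- The extension classes of `M` by `N` that are given by an extension `E` with an `R`-linear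
section `s` such that `F s = s F + φ`. -/
def IsTwist (U : C ⥤ ModuleCat.{u} R) (F : ∀ M, U.obj M →ₛₗ[σ] U.obj M) {M N : C}
    (φ : U.obj M →ₛₗ[σ] U.obj N) (e : Abelian.Ext M N 1) : Prop :=
  ∃ (E : C) (i : N ⟶ E) (q : E ⟶ M) (w : i ≫ q = 0) (hS : (ShortComplex.mk i q w).ShortExact)
    (s : U.obj M →ₗ[R] U.obj E),
    (∀ x, (U.map q).hom (s x) = x) ∧
    (∀ x, F E (s x) = s (F M x) + (U.map i).hom (φ x)) ∧ hS.extClass = e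

/-- `U` presents the abelian category `C` as a category of finitely generated `R`-modules with a
`σ`-linear endomorphism, closed under extensions, with enough free objects and free quotients. -/
structure IsSemilinearCat (U : C ⥤ ModuleCat.{u} R) (F : ∀ M, U.obj M →ₛₗ[σ] U.obj M) : Prop where
  nat : ∀ {M N : C} (f : M ⟶ N) (x : U.obj M), (U.map f).hom (F M x) = F N ((U.map f).hom x)
  full : ∀ {M N : C} (g : U.obj M →ₗ[R] U.obj N), (∀ x, g (F M x) = F N (g x)) →
    ∃ f : M ⟶ N, (U.map f).hom = g
  finite : ∀ M, Module.Finite R (U.obj M)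
  exists_isTwist : ∀ {M N : C} (φ : U.obj M →ₛₗ[σ] U.obj N), ∃ e, IsTwist U F φ e
  exists_cover : ∀ M, ∃ (P : C) (q : P ⟶ M), Epi q ∧ Module.Free R (U.obj P)
  exists_quotient : ∀ M, ∃ (N : C) (q : M ⟶ N), Epi q ∧ Module.Free R (U.obj N) ∧
    ∀ x, (U.map q).hom x = 0 → ∃ a : R, a ≠ 0 ∧ a • x = 0

variable {U : C ⥤ ModuleCat.{u} R} [U.Additive] [PreservesFiniteLimits U]
  [PreservesFiniteColimits U] [U.Faithful] {F : ∀ M, U.obj M →ₛₗ[σ] U.obj M}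

namespace IsSemilinearCat

variable (hU : IsSemilinearCat U F)

include hU

/-- The linear map `i n + s m ↦ i' (v n) + s' (w m) + i' (g m)` commutes with `F` precisely because
of `hg`, so it is a morphism of extensions over `v` and `w`. All the functoriality of twists, and
the triviality of the twists `F g - g F`, are special cases. -/
theorem isTwist_naturality {M N M' N' : C} {φ : U.obj M →ₛₗ[σ] U.obj N}
    {φ' : U.obj M' →ₛₗ[σ] U.obj N'} {e : Abelian.Ext M N 1} {e' : Abelian.Ext M' N' 1}
    (h : IsTwist U F φ e) (h' : IsTwist U F φ' e') (v : N ⟶ N') (w : M ⟶ M')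
    (g : U.obj M →ₗ[R] U.obj N')
    (hg : ∀ x, (U.map v).hom (φ x) - φ' ((U.map w).hom x) = F N' (g x) - g (F M x)) :
    e.comp (Abelian.Ext.mk₀ v) (add_zero 1) = (Abelian.Ext.mk₀ w).comp e' (zero_add 1) := by
  obtain ⟨E, i, q, wz, hS, s, hs, hF, rfl⟩ := h
  obtain ⟨E', i', q', wz', hS', s', hs', hF', rfl⟩ := h'
  obtain ⟨r, hr, hri, hrs⟩ := exists_retraction hS s hs
  let T : U.obj E →ₗ[R] U.obj E' := (U.map i').hom ∘ₗ (U.map v).hom ∘ₗ r +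
    (s' ∘ₗ (U.map w).hom + (U.map i').hom ∘ₗ g) ∘ₗ (U.map q).hom
  have hqi : ∀ n, (U.map q).hom ((U.map i).hom n) = 0 := (hS.exact_map U).apply_apply_eq_zero
  have hqi' : ∀ n, (U.map q').hom ((U.map i').hom n) = 0 := (hS'.exact_map U).apply_apply_eq_zero
  have hTi : ∀ n, T ((U.map i).hom n) = (U.map i').hom ((U.map v).hom n) := fun n => by
    simp [T, hqi]
    exact congrArg (fun y => (U.map i').hom ((U.map v).hom y)) (hri n)
  have hTs : ∀ m, T (s m) = s' ((U.map w).hom m) + (U.map i').hom (g m) := fun m => by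
    have := hrs m
    simp [T, hs, this]
  have hx : ∀ x, ∃ n m, x = (U.map i).hom n + s m := fun x =>
    ⟨r x, (U.map q).hom x, by have := hr x; simp only at this; rw [this]; abel⟩
  have hTF : ∀ x, T (F E x) = F E' (T x) := fun x => by
    obtain ⟨n, m, rfl⟩ := hx x
    have hgm : (U.map v).hom (φ m) + g (F M m) = φ' ((U.map w).hom m) + F N' (g m) := by
      have := hg m
      rw [sub_eq_sub_iff_add_eq_add] at this
      rw [this, add_comm]
    rw [map_add, hF, ← hU.nat, map_add, hTi, map_add, map_add, hTs, hTi, hTi, hTs, map_add,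
      map_add, hF', ← hU.nat, ← hU.nat, ← hU.nat, ← hU.nat]
    have := congrArg (U.map i').hom hgm
    rw [map_add, map_add] at this
    generalize (U.map i').hom ((U.map v).hom (φ m)) = y₁ at this ⊢
    rw [add_assoc, add_comm _ y₁, this]
    abel
  obtain ⟨t, ht⟩ := hU.full T hTF
  refine ShortComplex.ShortExact.extClass_naturality hS hS' ⟨v, t, w, ?_, ?_⟩
  · apply U.map_injective
    ext x
    simp [ht, hTi]
  · apply U.map_injective
    ext x
    obtain ⟨n, m, rfl⟩ := hx x
    simp [ht, hTi, hTs, hqi, hqi', hs, hs']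

end IsSemilinearCat

end Semilinear

/-! ### Hom and Ext¹ as kernel and cokernel of `s ↦ F s - s F`; vanishing of higher Ext -/

section Semilinear

universe v₁ u₁ w₁ u₂

variable {R : Type u₂} [CommRing R] {σ : R →+* R}

section Module

variable {A B A' B' : Type*} [AddCommGroup A] [AddCommGroup B] [Module R A] [Module R B]
  [AddCommGroup A'] [AddCommGroup B'] [Module R A'] [Module R B']

/-- The map `s ↦ F s - s F`. -/
def semilinearComm (FA : A →ₛₗ[σ] A) (FB : B →ₛₗ[σ] B) : (A →ₗ[R] B) →+ (A →ₛₗ[σ] B) where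
  toFun s := FB.comp s - s.comp FA
  map_zero' := by ext; simp
  map_add' s t := by ext; simp; abel

@[simp]
theorem semilinearComm_apply (FA : A →ₛₗ[σ] A) (FB : B →ₛₗ[σ] B) (s : A →ₗ[R] B) (x : A) :
    semilinearComm FA FB s x = FB (s x) - s (FA x) := rfl

theorem mem_ker_semilinearComm {FA : A →ₛₗ[σ] A} {FB : B →ₛₗ[σ] B} {s : A →ₗ[R] B} :
    s ∈ (semilinearComm FA FB).ker ↔ ∀ x, s (FA x) = FB (s x) := by
  rw [AddMonoidHom.mem_ker]
  constructor
  · intro h x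
    have := LinearMap.congr_fun h x
    rw [semilinearComm_apply, LinearMap.zero_apply, sub_eq_zero] at this
    exact this.symm
  · intro h
    ext x
    rw [semilinearComm_apply, h, sub_self, LinearMap.zero_apply]

/-- A semilinear map on a submodule with a complement extends. -/
theorem exists_semilinear_extension {j : A →ₗ[R] A'} {r : A' →ₗ[R] A} (hr : ∀ x, r (j x) = x)
    (φ : A →ₛₗ[σ] B) : ∃ ψ : A' →ₛₗ[σ] B, ∀ x, ψ (j x) = φ x :=
  ⟨φ.comp r, fun x => by simp [hr]⟩

end Module

variable {C : Type u₁} [Category.{v₁} C] [Abelian C] [HasExt.{w₁} C]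
variable {U : C ⥤ ModuleCat.{u} R} [U.Additive] [PreservesFiniteLimits U]
  [PreservesFiniteColimits U] [U.Faithful] {F : ∀ M, U.obj M →ₛₗ[σ] U.obj M}

theorem extClass_eq_zero_iff {S : ShortComplex C} (hS : S.ShortExact) :
    hS.extClass = 0 ↔ ∃ r : S.X₃ ⟶ S.X₂, r ≫ S.g = 𝟙 _ := by
  constructor
  · intro h
    obtain ⟨x, hx⟩ := Abelian.Ext.covariant_sequence_exact₃ S.X₃ hS (Abelian.Ext.mk₀ (𝟙 S.X₃))
      (zero_add 1) (by rw [Abelian.Ext.mk₀_id_comp, h])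
    obtain ⟨r, rfl⟩ := (Abelian.Ext.mk₀_bijective _ _).2 x
    rw [Abelian.Ext.mk₀_comp_mk₀] at hx
    exact ⟨r, (Abelian.Ext.mk₀_bijective _ _).1 hx⟩
  · rintro ⟨r, hr⟩
    rw [← Abelian.Ext.mk₀_id_comp hS.extClass, ← hr, ← Abelian.Ext.mk₀_comp_mk₀]
    rw [Abelian.Ext.comp_assoc_of_second_deg_zero]
    simp

namespace IsSemilinearCat

variable (hU : IsSemilinearCat U F)

include hU

theorem isTwist_unique {M N : C} {φ : U.obj M →ₛₗ[σ] U.obj N} {e e' : Abelian.Ext M N 1}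
    (h : IsTwist U F φ e) (h' : IsTwist U F φ e') : e = e' := by
  simpa using hU.isTwist_naturality h h' (𝟙 _) (𝟙 _) 0 (by simp)

theorem isTwist_postcomp {M N N' : C} {φ : U.obj M →ₛₗ[σ] U.obj N} {e : Abelian.Ext M N 1}
    (h : IsTwist U F φ e) (v : N ⟶ N') : IsTwist U F ((U.map v).hom.comp φ)
      (e.comp (Abelian.Ext.mk₀ v) (add_zero 1)) := by
  obtain ⟨e', he'⟩ := hU.exists_isTwist ((U.map v).hom.comp φ)
  have := hU.isTwist_naturality h he' v (𝟙 _) 0 (by simp)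
  rw [Abelian.Ext.mk₀_id_comp] at this
  rwa [this]

theorem isTwist_precomp {M M' N : C} {φ : U.obj M →ₛₗ[σ] U.obj N} {e : Abelian.Ext M N 1}
    (h : IsTwist U F φ e) (v : M' ⟶ M) : IsTwist U F (φ.comp (U.map v).hom)
      ((Abelian.Ext.mk₀ v).comp e (zero_add 1)) := by
  obtain ⟨e', he'⟩ := hU.exists_isTwist (φ.comp (U.map v).hom)
  have := hU.isTwist_naturality he' h (𝟙 _) v 0 (by simp)
  rw [Abelian.Ext.comp_mk₀_id] at this
  rwa [← this]

/-- Twist by `(φ, φ')` into `N ⊞ N` and push out along the two projections and their sum; additivity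
of composition in Ext then replaces a computation with Baer sums. -/
theorem isTwist_add {M N : C} {φ φ' : U.obj M →ₛₗ[σ] U.obj N} {e e' : Abelian.Ext M N 1}
    (h : IsTwist U F φ e) (h' : IsTwist U F φ' e') : IsTwist U F (φ + φ') (e + e') := by
  let ψ : U.obj M →ₛₗ[σ] U.obj (N ⊞ N) :=
    (U.map biprod.inl).hom.comp φ + (U.map biprod.inr).hom.comp φ'
  obtain ⟨c, hc⟩ := hU.exists_isTwist ψ
  have key : ∀ {X Y Z : C} (f : X ⟶ Y) (g : Y ⟶ Z) (x : U.obj X),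
      (U.map g).hom ((U.map f).hom x) = (U.map (f ≫ g)).hom x := fun f g x => by simp
  have h1 : (U.map biprod.fst).hom.comp ψ = φ := by
    ext x
    simp [ψ, key]
  have h2 : (U.map biprod.snd).hom.comp ψ = φ' := by
    ext x
    simp [ψ, key]
  have h3 := hU.isTwist_postcomp hc biprod.fst
  have h4 := hU.isTwist_postcomp hc biprod.snd
  have h5 := hU.isTwist_postcomp hc (biprod.fst + biprod.snd)
  rw [h1] at h3
  rw [h2] at h4
  rw [hU.isTwist_unique h h3, hU.isTwist_unique h' h4, ← Abelian.Ext.comp_add,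
    ← Abelian.Ext.mk₀_add]
  convert h5
  rw [← h1, ← h2]
  ext x
  simp

/-- The class of the extension of `M` by `N` twisted by a `σ`-linear map `M → N`. -/
def twistHom (M N : C) : (U.obj M →ₛₗ[σ] U.obj N) →+ Abelian.Ext M N 1 :=
  AddMonoidHom.mk' (fun φ => (hU.exists_isTwist φ).choose) fun φ ψ =>
    hU.isTwist_unique (hU.exists_isTwist _).choose_spec
      (hU.isTwist_add (hU.exists_isTwist φ).choose_spec (hU.exists_isTwist ψ).choose_spec)

theorem isTwist_twistHom {M N : C} (φ : U.obj M →ₛₗ[σ] U.obj N) :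
    IsTwist U F φ (hU.twistHom M N φ) := (hU.exists_isTwist φ).choose_spec

theorem isTwist_iff {M N : C} {φ : U.obj M →ₛₗ[σ] U.obj N} {e : Abelian.Ext M N 1} :
    IsTwist U F φ e ↔ hU.twistHom M N φ = e :=
  ⟨fun h => hU.isTwist_unique (hU.isTwist_twistHom φ) h, fun h => h ▸ hU.isTwist_twistHom φ⟩

theorem twistHom_postcomp {M N N' : C} (φ : U.obj M →ₛₗ[σ] U.obj N) (v : N ⟶ N') :
    (hU.twistHom M N φ).comp (Abelian.Ext.mk₀ v) (add_zero 1) =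
      hU.twistHom M N' ((U.map v).hom.comp φ) :=
  (hU.isTwist_iff.1 (hU.isTwist_postcomp (hU.isTwist_twistHom φ) v)).symm

theorem twistHom_precomp {M M' N : C} (φ : U.obj M →ₛₗ[σ] U.obj N) (v : M' ⟶ M) :
    (Abelian.Ext.mk₀ v).comp (hU.twistHom M N φ) (zero_add 1) =
      hU.twistHom M' N (φ.comp (U.map v).hom) :=
  (hU.isTwist_iff.1 (hU.isTwist_precomp (hU.isTwist_twistHom φ) v)).symm

/-- A splitting that commutes with `F` differs from the linear section by some `i ∘ g`, and
comparing the defects of the two sections writes `φ` as `F g - g F` up to the sign of `g`. The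
converse is naturality with `v = w = 1`. -/
theorem ker_twistHom (M N : C) :
    (hU.twistHom M N).ker = (semilinearComm (F M) (F N)).range := by
  ext φ
  rw [AddMonoidHom.mem_ker, AddMonoidHom.mem_range]
  constructor
  · intro h
    obtain ⟨E, i, q, w, hS, s, hs, hF, he⟩ := hU.isTwist_iff.2 h
    obtain ⟨r, hr⟩ := (extClass_eq_zero_iff hS).1 he
    obtain ⟨t, ht, hti, hts⟩ := exists_retraction hS s hs
    have hqr : ∀ x, (U.map q).hom ((U.map r).hom x) = x := fun x => by
      have := congrArg (fun f => (U.map f).hom x) hr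
      simpa using this
    have hi : ∀ x, (U.map i).hom (t ((U.map r).hom x)) = (U.map r).hom x - s x := fun x => by
      have := ht ((U.map r).hom x)
      simp only [hqr] at this
      exact this
    refine ⟨-(t ∘ₗ (U.map r).hom), ?_⟩
    ext x
    apply hS.injective_map U
    have h1 := hU.nat i (t ((U.map r).hom x))
    have h2 := hU.nat r x
    have h3 := hi (F M x)
    have h4 := hF x
    simp only [semilinearComm_apply, map_sub, map_neg, LinearMap.neg_apply, LinearMap.comp_apply]
    simp only at h1 h2 h3 h4 ⊢
    rw [h1, hi, h3, map_sub, h4, h2]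
    abel
  · rintro ⟨g, rfl⟩
    have h0 := hU.isTwist_naturality (hU.isTwist_twistHom (semilinearComm (F M) (F N) g))
      (hU.isTwist_twistHom 0) (𝟙 _) (𝟙 _) g (by simp)
    simpa using h0

/-- Morphisms are the linear maps that commute with `F`. -/
def homEquiv (M N : C) : (M ⟶ N) ≃+ (semilinearComm (F M) (F N)).ker :=
  AddEquiv.ofBijective
    (AddMonoidHom.mk' (fun f => ⟨(U.map f).hom, mem_ker_semilinearComm.2 (hU.nat f)⟩)
      fun f g => Subtype.ext (by simp)) (by
    constructor
    · intro f g h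
      exact U.map_injective (ModuleCat.hom_ext (congrArg Subtype.val h))
    · rintro ⟨g, hg⟩
      obtain ⟨f, hf⟩ := hU.full g (mem_ker_semilinearComm.1 hg)
      exact ⟨f, Subtype.ext hf⟩)

@[simp]
theorem homEquiv_coe {M N : C} (f : M ⟶ N) : (hU.homEquiv M N f : _ →ₗ[R] _) = (U.map f).hom := rfl

/-- An epimorphism `α` that effaces the class exhibits it as a pushout of the extension given by
`α`. As `M` is projective over `R`, that extension has a linear section, hence is a twist, and
twists are stable under pushout. -/
theorem twistHom_surjective (M N : C) [Module.Projective R (U.obj M)] :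
    Function.Surjective (hU.twistHom M N) := by
  intro e
  obtain ⟨A, α, hα, he⟩ := exists_epi_comp_eq_zero e
  have hS : (ShortComplex.mk _ _ (kernel.condition α)).ShortExact :=
    { exact := ShortComplex.exact_of_f_is_kernel _ (kernelIsKernel α) }
  obtain ⟨x, rfl⟩ := Abelian.Ext.contravariant_sequence_exact₃ hS N e he (add_zero 1)
  obtain ⟨x, rfl⟩ := (Abelian.Ext.mk₀_bijective _ _).2 x
  obtain ⟨s, hs⟩ := LinearMap.exists_rightInverse_of_surjective (U.map α).hom
    (LinearMap.range_eq_top.2 (hS.surjective_map U))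
  have hs' : ∀ y, (U.map α).hom (s y) = y := fun y => LinearMap.congr_fun hs y
  obtain ⟨r, hr, -, -⟩ := exists_retraction hS s hs'
  have hT : IsTwist U F (r.comp (semilinearComm (F M) (F A) s)) hS.extClass := by
    refine ⟨A, _, _, _, hS, s, hs', fun y => ?_, rfl⟩
    have h1 := hU.nat α (s y)
    have h2 := hr (semilinearComm (F M) (F A) s y)
    simp only [semilinearComm_apply] at h1 h2
    simp only [hs', map_sub, h1, sub_self, map_zero, sub_zero] at h1 h2
    simp only [LinearMap.comp_apply, semilinearComm_apply, map_sub]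
    rw [h2]
    abel
  exact ⟨_, hU.isTwist_iff.1 (hU.isTwist_postcomp hT x)⟩

variable [IsDomain R] [IsPrincipalIdealRing R]

theorem free_of_injective {M N : C} (f : M ⟶ N) (hf : Function.Injective (U.map f).hom)
    [Module.Free R (U.obj N)] : Module.Free R (U.obj M) :=
  haveI := hU.finite N
  Module.Free.of_equiv (LinearEquiv.ofInjective _ hf).symm

/-- The kernel of a free cover of `M` is free over `R`, a submodule of a free module over a
principal ideal domain. The cover is chosen to factor through `α`, so that it effaces every class
effaced by `α`. -/
theorem exists_resolution {M A : C} (α : A ⟶ M) [Epi α] :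
    ∃ (S : ShortComplex C) (_ : S.ShortExact) (h : S.X₃ = M) (t : S.X₂ ⟶ A),
      Module.Free R (U.obj S.X₁) ∧ Module.Free R (U.obj S.X₂) ∧ t ≫ α = S.g ≫ eqToHom h := by
  obtain ⟨P, q, hq, hP⟩ := hU.exists_cover A
  have hS : (ShortComplex.mk _ _ (kernel.condition (q ≫ α))).ShortExact :=
    { exact := ShortComplex.exact_of_f_is_kernel _ (kernelIsKernel _) }
  exact ⟨_, hS, rfl, q, hU.free_of_injective _ (hS.injective_map U), hP, by simp⟩

/-- Dimension shifting along a free resolution adapted to `e`: the class dies on the cover, so it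
comes from the connecting map. No projectives in the category are needed. -/
theorem exists_ext_eq_extClass_comp {M N : C} {n : ℕ} (e : Abelian.Ext M N (n + 1)) :
    ∃ (S : ShortComplex C) (hS : S.ShortExact) (h : S.X₃ = M) (x : Abelian.Ext S.X₁ N n),
      Module.Free R (U.obj S.X₁) ∧ Module.Free R (U.obj S.X₂) ∧
      e = (Abelian.Ext.mk₀ (eqToHom h.symm)).comp (hS.extClass.comp x (add_comm 1 n))
        (zero_add _) := by
  obtain ⟨A, α, hα, he⟩ := exists_epi_comp_eq_zero e
  obtain ⟨S, hS, rfl, t, h1, h2, h3⟩ := hU.exists_resolution α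
  simp only [eqToHom_refl, Category.comp_id] at h3
  have he' : (Abelian.Ext.mk₀ S.g).comp e (zero_add _) = 0 := by
    rw [← h3, ← Abelian.Ext.mk₀_comp_mk₀, Abelian.Ext.comp_assoc_of_second_deg_zero, he,
      Abelian.Ext.comp_zero]
  obtain ⟨x, rfl⟩ := Abelian.Ext.contravariant_sequence_exact₃ hS N e he' (add_comm 1 n)
  exact ⟨S, hS, rfl, x, h1, h2, by simp⟩

/-- In degree 2 the class is the connecting map applied to a twist `φ` on the first term of a
resolution. As `M` is free, that term is a linear direct summand of the middle one, so the twist is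
a restriction from the middle term, and restrictions are killed by the connecting map. Higher
degrees follow by shifting. -/
theorem ext_eq_zero_of_free {M N : C} [Module.Free R (U.obj M)] {n : ℕ}
    (e : Abelian.Ext M N (n + 2)) : e = 0 := by
  induction n generalizing M with
  | zero =>
    obtain ⟨S, hS, rfl, x, h1, h2, rfl⟩ := hU.exists_ext_eq_extClass_comp (n := 1) e
    obtain ⟨φ, rfl⟩ := hU.twistHom_surjective _ _ x
    obtain ⟨s, hs⟩ := LinearMap.exists_rightInverse_of_surjective (U.map S.g).hom
      (LinearMap.range_eq_top.2 (hS.surjective_map U))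
    obtain ⟨r, -, hr, -⟩ := exists_retraction hS s (fun y => LinearMap.congr_fun hs y)
    -- Only semilinearity is required of `ψ`: any semilinear map defines a twist, so no
    -- compatibility with `F` obstructs the extension.
    obtain ⟨ψ, hψ⟩ := exists_semilinear_extension hr φ
    obtain rfl : φ = ψ.comp (U.map S.f).hom := LinearMap.ext fun x => (hψ x).symm
    rw [← hU.twistHom_precomp, ← Abelian.Ext.comp_assoc (a₁₂ := 1) _ _ _ rfl rfl rfl]
    simp
  | succ n ih =>
    obtain ⟨S, hS, rfl, x, h1, h2, rfl⟩ := hU.exists_ext_eq_extClass_comp (n := n + 2) e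
    simp [ih x]

theorem ext_eq_zero {M N : C} {n : ℕ} (e : Abelian.Ext M N (n + 3)) : e = 0 := by
  obtain ⟨S, hS, rfl, x, h1, h2, rfl⟩ := hU.exists_ext_eq_extClass_comp (n := n + 2) e
  simp [hU.ext_eq_zero_of_free x]

end IsSemilinearCat

end Semilinear

/-! ### Multiplicativity of `z(f)` -/

section KernelCokernel

section SixTerm

variable {A B C X₁ X₂ X₃ X₄ X₅ X₆ : Type*} [AddCommGroup A] [AddCommGroup B] [AddCommGroup C]
  [AddCommGroup X₁] [AddCommGroup X₂] [AddCommGroup X₃]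
  [AddCommGroup X₄] [AddCommGroup X₅] [AddCommGroup X₆]

theorem Finite.of_exact {f : A →+ B} {g : B →+ C} (h : Function.Exact f g) [Finite A] [Finite C] :
    Finite B := by
  have h1 : Finite f.range := Set.finite_range f
  have h2 : Finite g.ker := by
    refine Set.Finite.subset (s := (f.range : Set B)) h1 fun x hx => ?_
    exact (h x).1 hx
  have h3 : Finite (B ⧸ g.ker) :=
    Finite.of_injective _ (QuotientAddGroup.kerLift_injective g)
  exact Finite.of_addSubgroup_quotient g.ker

theorem card_eq_card_range_mul_card_range {f : A →+ B} {g : B →+ C} (h : Function.Exact f g) :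
    Nat.card B = Nat.card f.range * Nat.card g.range := by
  have : g.ker = f.range := by
    ext x
    exact h x
  rw [← AddSubgroup.card_mul_index g.ker, AddSubgroup.index_ker, this]

/-- The order of each middle term is the product of the orders of the two adjacent images. Infinite
groups, whose `Nat.card` is 0, cause no harm. -/
theorem card_six_term {f₁ : X₁ →+ X₂} {f₂ : X₂ →+ X₃} {f₃ : X₃ →+ X₄} {f₄ : X₄ →+ X₅}
    {f₅ : X₅ →+ X₆} (h₁ : Function.Injective f₁) (h₁₂ : Function.Exact f₁ f₂)
    (h₂₃ : Function.Exact f₂ f₃) (h₃₄ : Function.Exact f₃ f₄) (h₄₅ : Function.Exact f₄ f₅)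
    (h₅ : Function.Surjective f₅) :
    Nat.card X₁ * Nat.card X₃ * Nat.card X₅ = Nat.card X₂ * Nat.card X₄ * Nat.card X₆ := by
  rw [card_eq_card_range_mul_card_range h₁₂, card_eq_card_range_mul_card_range h₂₃,
    card_eq_card_range_mul_card_range h₃₄, card_eq_card_range_mul_card_range h₄₅,
    ← Nat.card_congr (AddMonoidHom.ofInjective h₁).toEquiv,
    (AddMonoidHom.range_eq_top (f := f₅)).2 h₅, AddSubgroup.card_top]
  ring

end SixTerm

variable {A B C A' B' C' : Type*} [AddCommGroup A] [AddCommGroup B] [AddCommGroup C]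
  [AddCommGroup A'] [AddCommGroup B'] [AddCommGroup C']

/-- The map induced on the kernels by a commutative square. -/
def kerMap {f : A →+ B} {f' : A' →+ B'} {u : A →+ A'} {v : B →+ B'}
    (h : f'.comp u = v.comp f) : f.ker →+ f'.ker :=
  (u.comp f.ker.subtype).codRestrict f'.ker fun x => by
    have := DFunLike.congr_fun h x.1
    rw [AddMonoidHom.comp_apply, AddMonoidHom.comp_apply, (AddMonoidHom.mem_ker).1 x.2,
      map_zero] at this
    exact this

@[simp]
theorem kerMap_coe {f : A →+ B} {f' : A' →+ B'} {u : A →+ A'} {v : B →+ B'}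
    (h : f'.comp u = v.comp f) (x : f.ker) : (kerMap h x : A') = u x := rfl

/-- The map induced on the cokernels by a commutative square. -/
def cokerMap {f : A →+ B} {f' : A' →+ B'} {u : A →+ A'} {v : B →+ B'}
    (h : f'.comp u = v.comp f) : B ⧸ f.range →+ B' ⧸ f'.range :=
  QuotientAddGroup.map _ _ v (by
    rintro _ ⟨x, rfl⟩
    exact ⟨u x, DFunLike.congr_fun h x⟩)

@[simp]
theorem cokerMap_mk {f : A →+ B} {f' : A' →+ B'} {u : A →+ A'} {v : B →+ B'}
    (h : f'.comp u = v.comp f) (x : B) :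
    cokerMap h (QuotientAddGroup.mk x) = QuotientAddGroup.mk (v x) := rfl

theorem mk_eq_zero_iff_mem_range {f : A →+ B} {x : B} :
    (QuotientAddGroup.mk x : B ⧸ f.range) = 0 ↔ ∃ y, f y = x :=
  QuotientAddGroup.eq_zero_iff x

theorem exists_mk_eq {f : A →+ B} (x : B ⧸ f.range) : ∃ y : B, QuotientAddGroup.mk y = x :=
  QuotientAddGroup.mk_surjective x

theorem ZDefined.ne_zero {f : A →+ B} (h : ZDefined f) : zInv f ≠ 0 := by
  obtain ⟨h1, h2⟩ := h
  have := Nat.card_pos (α := f.ker)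
  have := Nat.card_pos (α := B ⧸ f.range)
  unfold zInv
  positivity

/-- Both `[A] / [Ker f]` and `[B] / [Coker f]` are the order of the image. -/
theorem zInv_of_finite [Finite A] [Finite B] (f : A →+ B) :
    zInv f = (Nat.card A : ℚ) / Nat.card B := by
  have h1 := AddSubgroup.card_mul_index f.ker
  have h2 := AddSubgroup.card_mul_index f.range
  rw [AddSubgroup.index_ker] at h1
  have h3 : f.range.index = Nat.card (B ⧸ f.range) := rfl
  have := Nat.card_pos (α := f.range)
  have := Nat.card_pos (α := B ⧸ f.range)
  unfold zInv
  rw [← h1, ← h2, h3]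
  push_cast
  field_simp

section Comp

variable (f : A →+ B) (g : B →+ C)

/-- This kernel-cokernel sequence of a composite yields both the two-out-of-three property of
`ZDefined` and the multiplicativity of `z`. -/
theorem comp_six_term :
    ∃ (f₁ : f.ker →+ (g.comp f).ker) (f₂ : (g.comp f).ker →+ g.ker) (f₃ : g.ker →+ B ⧸ f.range)
      (f₄ : B ⧸ f.range →+ C ⧸ (g.comp f).range) (f₅ : C ⧸ (g.comp f).range →+ C ⧸ g.range),
      Function.Injective f₁ ∧ Function.Exact f₁ f₂ ∧ Function.Exact f₂ f₃ ∧ Function.Exact f₃ f₄ ∧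
      Function.Exact f₄ f₅ ∧ Function.Surjective f₅ := by
  refine ⟨kerMap (u := AddMonoidHom.id A) (v := g) rfl, kerMap (u := f) (v := AddMonoidHom.id C) rfl,
    (QuotientAddGroup.mk' _).comp g.ker.subtype, cokerMap (u := AddMonoidHom.id A) (v := g) rfl,
    cokerMap (u := f) (v := AddMonoidHom.id C) rfl, fun x y h => ?_, fun x => ?_, fun x => ?_,
    fun x => ?_, fun x => ?_, fun x => ?_⟩
  · have h' := congrArg Subtype.val h
    exact Subtype.ext h'
  · constructor
    · intro h
      exact ⟨⟨x, congrArg Subtype.val h⟩, rfl⟩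
    · rintro ⟨y, rfl⟩
      exact Subtype.ext y.2
  · constructor
    · intro h
      obtain ⟨y, hy⟩ := mk_eq_zero_iff_mem_range.1 h
      exact ⟨⟨y, by
        rw [AddMonoidHom.mem_ker, AddMonoidHom.comp_apply, hy]
        exact x.2⟩, Subtype.ext hy⟩
    · rintro ⟨y, rfl⟩
      exact mk_eq_zero_iff_mem_range.2 ⟨y, rfl⟩
  · obtain ⟨x, rfl⟩ := exists_mk_eq x
    constructor
    · intro h
      obtain ⟨y, hy⟩ := mk_eq_zero_iff_mem_range.1 h
      refine ⟨⟨x - f y, by rw [AddMonoidHom.mem_ker, map_sub, ← AddMonoidHom.comp_apply, hy, sub_self]⟩, ?_⟩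
      change QuotientAddGroup.mk (x - f y) = _
      rw [QuotientAddGroup.mk_sub, sub_eq_self]
      exact mk_eq_zero_iff_mem_range.2 ⟨y, rfl⟩
    · rintro ⟨y, hy⟩
      rw [← hy]
      refine mk_eq_zero_iff_mem_range.2 ⟨0, ?_⟩
      rw [map_zero]
      exact y.2.symm
  · obtain ⟨x, rfl⟩ := exists_mk_eq x
    constructor
    · intro h
      obtain ⟨y, hy⟩ := mk_eq_zero_iff_mem_range.1 h
      exact ⟨QuotientAddGroup.mk y, congrArg QuotientAddGroup.mk hy⟩
    · rintro ⟨y, hy⟩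
      obtain ⟨y, rfl⟩ := exists_mk_eq y
      rw [← hy]
      exact mk_eq_zero_iff_mem_range.2 ⟨y, rfl⟩
  · obtain ⟨x, rfl⟩ := exists_mk_eq x
    exact ⟨QuotientAddGroup.mk x, rfl⟩

variable {f g}

theorem ZDefined.comp (hg : ZDefined g) (hf : ZDefined f) : ZDefined (g.comp f) := by
  obtain ⟨f₁, f₂, f₃, f₄, f₅, h₁, h₁₂, h₂₃, h₃₄, h₄₅, h₅⟩ := comp_six_term f g
  obtain ⟨_, _⟩ := hf
  obtain ⟨_, _⟩ := hg
  exact ⟨Finite.of_exact h₁₂, Finite.of_exact h₄₅⟩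

theorem ZDefined.of_comp_right (hg : ZDefined g) (h : ZDefined (g.comp f)) : ZDefined f := by
  obtain ⟨f₁, f₂, f₃, f₄, f₅, h₁, h₁₂, h₂₃, h₃₄, h₄₅, h₅⟩ := comp_six_term f g
  obtain ⟨_, _⟩ := h
  obtain ⟨_, _⟩ := hg
  exact ⟨Finite.of_injective f₁ h₁, Finite.of_exact h₃₄⟩

theorem ZDefined.of_comp_left (hf : ZDefined f) (h : ZDefined (g.comp f)) : ZDefined g := by
  obtain ⟨f₁, f₂, f₃, f₄, f₅, h₁, h₁₂, h₂₃, h₃₄, h₄₅, h₅⟩ := comp_six_term f g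
  obtain ⟨_, _⟩ := h
  obtain ⟨_, _⟩ := hf
  exact ⟨Finite.of_exact h₂₃, Finite.of_surjective f₅ h₅⟩

theorem zInv_comp (hg : ZDefined g) (hf : ZDefined f) : zInv (g.comp f) = zInv g * zInv f := by
  obtain ⟨f₁, f₂, f₃, f₄, f₅, h₁, h₁₂, h₂₃, h₃₄, h₄₅, h₅⟩ := comp_six_term f g
  obtain ⟨_, _⟩ := hg.comp hf
  obtain ⟨_, _⟩ := hf
  obtain ⟨_, _⟩ := hg
  have h := card_six_term h₁ h₁₂ h₂₃ h₃₄ h₄₅ h₅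
  have := Nat.card_pos (α := B ⧸ f.range)
  have := Nat.card_pos (α := C ⧸ g.range)
  have := Nat.card_pos (α := C ⧸ (g.comp f).range)
  unfold zInv
  rw [div_mul_div_comm, div_eq_div_iff (by positivity) (by positivity)]
  norm_cast
  rw [show Nat.card g.ker * Nat.card f.ker = Nat.card f.ker * Nat.card g.ker from mul_comm _ _, h]
  ring

end Comp

theorem zDefined_equiv (e : A ≃+ B) : ZDefined (e : A →+ B) := by
  have h1 : (e : A →+ B).ker = ⊥ := (AddMonoidHom.ker_eq_bot_iff _).2 e.injective
  have h2 : (e : A →+ B).range = ⊤ := AddMonoidHom.range_eq_top.2 e.surjective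
  refine ⟨?_, ?_⟩
  · rw [h1]
    infer_instance
  · rw [h2]
    infer_instance

section Square

variable {f : A →+ B} {f' : A' →+ B'} {u : A →+ A'} {v : B →+ B'} (h : f'.comp u = v.comp f)

include h

theorem ZDefined.of_square (hf' : ZDefined f') (hu : ZDefined u) (hv : ZDefined v) :
    ZDefined f := hv.of_comp_right (h ▸ hf'.comp hu)

theorem ZDefined.of_square' (hf : ZDefined f) (hu : ZDefined u) (hv : ZDefined v) :
    ZDefined f' := hu.of_comp_left (h.symm ▸ hv.comp hf)

theorem zInv_square (hu : ZDefined u) (hv : ZDefined v) (hf' : ZDefined f') :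
    zInv f * zInv v = zInv f' * zInv u := by
  rw [← zInv_comp hf' hu, h, zInv_comp hv (ZDefined.of_square h hf' hu hv), mul_comm]

end Square

section EquivSquare

variable {f : A →+ B} {f' : A' →+ B'} (u : A ≃+ A') (v : B ≃+ B') (h : ∀ x, f' (u x) = v (f x))

include h

theorem zDefined_congr : ZDefined f ↔ ZDefined f' :=
  have h' : f'.comp (u : A →+ A') = (v : B →+ B').comp f := AddMonoidHom.ext h
  ⟨fun hf => ZDefined.of_square' h' hf (zDefined_equiv u) (zDefined_equiv v),
    fun hf => ZDefined.of_square h' hf (zDefined_equiv u) (zDefined_equiv v)⟩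

theorem card_ker_congr : Nat.card f.ker = Nat.card f'.ker := by
  refine Nat.card_congr (u.toEquiv.subtypeEquiv fun x => ?_)
  change f x = 0 ↔ f' (u x) = 0
  rw [h, map_eq_zero_iff _ v.injective]

theorem card_coker_congr : Nat.card (B ⧸ f.range) = Nat.card (B' ⧸ f'.range) := by
  refine Nat.card_congr (QuotientAddGroup.congr _ _ v ?_).toEquiv
  ext y
  constructor
  · rintro ⟨_, ⟨x, rfl⟩, rfl⟩
    exact ⟨u x, h x⟩
  · rintro ⟨x, rfl⟩
    obtain ⟨x, rfl⟩ := u.surjective x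
    exact ⟨f x, ⟨x, rfl⟩, (h x).symm⟩

theorem zInv_congr : zInv f = zInv f' := by
  unfold zInv
  rw [card_ker_congr u v h, card_coker_congr u v h]

end EquivSquare

section ShortExact

variable {i : A →+ B} {p : B →+ C} {i' : A' →+ B'} {p' : B' →+ C'} {α : A →+ A'} {β : B →+ B'}
  {γ : C →+ C'} (hi : Function.Injective i) (hip : Function.Exact i p) (hp : Function.Surjective p)
  (hi' : Function.Injective i') (hip' : Function.Exact i' p') (hp' : Function.Surjective p')
  (h₁ : i'.comp α = β.comp i) (h₂ : p'.comp β = γ.comp p)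

include hi hip hp hi' hip' hp' h₁ h₂

/-- The snake lemma, of which only the two places around the connecting map are not direct diagram
chases. -/
theorem snake_six_term :
    ∃ (f₁ : α.ker →+ β.ker) (f₂ : β.ker →+ γ.ker) (f₃ : γ.ker →+ A' ⧸ α.range)
      (f₄ : A' ⧸ α.range →+ B' ⧸ β.range) (f₅ : B' ⧸ β.range →+ C' ⧸ γ.range),
      Function.Injective f₁ ∧ Function.Exact f₁ f₂ ∧ Function.Exact f₂ f₃ ∧ Function.Exact f₃ f₄ ∧
      Function.Exact f₄ f₅ ∧ Function.Surjective f₅ := by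
  have e₁ : ∀ x, i' (α x) = β (i x) := DFunLike.congr_fun h₁
  have e₂ : ∀ x, p' (β x) = γ (p x) := DFunLike.congr_fun h₂
  have E₁ : i'.toIntLinearMap.comp α.toIntLinearMap = β.toIntLinearMap.comp i.toIntLinearMap :=
    LinearMap.ext e₁
  have E₂ : p'.toIntLinearMap.comp β.toIntLinearMap = γ.toIntLinearMap.comp p.toIntLinearMap :=
    LinearMap.ext e₂
  let πA : A' →ₗ[ℤ] A' ⧸ α.range := (QuotientAddGroup.mk' α.range).toIntLinearMap
  let πB : B' →ₗ[ℤ] B' ⧸ β.range := (QuotientAddGroup.mk' β.range).toIntLinearMap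
  let ιB : β.ker →ₗ[ℤ] B := β.ker.subtype.toIntLinearMap
  let ιC : γ.ker →ₗ[ℤ] C := γ.ker.subtype.toIntLinearMap
  have hιB : Function.Exact ιB β.toIntLinearMap := fun x =>
    ⟨fun hx => ⟨⟨x, hx⟩, rfl⟩, by rintro ⟨y, rfl⟩; exact y.2⟩
  have hιC : Function.Exact ιC γ.toIntLinearMap := fun x =>
    ⟨fun hx => ⟨⟨x, hx⟩, rfl⟩, by rintro ⟨y, rfl⟩; exact y.2⟩
  have hπA : Function.Exact α.toIntLinearMap πA := fun x => mk_eq_zero_iff_mem_range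
  have hπB : Function.Exact β.toIntLinearMap πB := fun x => mk_eq_zero_iff_mem_range
  let δ := SnakeLemma.δ' α.toIntLinearMap β.toIntLinearMap γ.toIntLinearMap i.toIntLinearMap
    p.toIntLinearMap hip i'.toIntLinearMap p'.toIntLinearMap hip' E₁ E₂ ιC hιC πA hπA hp hi'
  refine ⟨kerMap h₁.symm, kerMap h₂.symm, δ.toAddMonoidHom, cokerMap h₁.symm, cokerMap h₂.symm,
    fun x y h => ?_, fun x => ?_, ?_, ?_, fun x => ?_, fun x => ?_⟩
  · exact Subtype.ext (hi (congrArg Subtype.val h))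
  · constructor
    · intro h
      obtain ⟨a, ha⟩ := (hip x).1 (congrArg Subtype.val h)
      exact ⟨⟨a, hi' (by rw [e₁, ha, map_zero]; exact x.2)⟩, Subtype.ext ha⟩
    · rintro ⟨y, rfl⟩
      exact Subtype.ext (hip.apply_apply_eq_zero _)
  · exact SnakeLemma.exact_δ'_right _ _ _ _ _ hip _ _ hip' E₁ E₂ ιB hιB ιC hιC πA hπA hp hi'
      (kerMap h₂.symm).toIntLinearMap rfl Subtype.val_injective
  · exact SnakeLemma.exact_δ'_left _ _ _ _ _ hip _ _ hip' E₁ E₂ ιC hιC πA hπA πB hπB hp hi'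
      (cokerMap h₁.symm).toIntLinearMap rfl (QuotientAddGroup.mk'_surjective _)
  · obtain ⟨x, rfl⟩ := exists_mk_eq x
    constructor
    · intro h
      obtain ⟨c, hc⟩ := mk_eq_zero_iff_mem_range.1 h
      obtain ⟨b, rfl⟩ := hp c
      obtain ⟨a, ha⟩ := (hip' (x - β b)).1 (by rw [map_sub, e₂, hc, sub_self])
      refine ⟨QuotientAddGroup.mk a, ?_⟩
      rw [cokerMap_mk, ha, QuotientAddGroup.mk_sub, sub_eq_self]
      exact mk_eq_zero_iff_mem_range.2 ⟨b, rfl⟩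
    · rintro ⟨y, hy⟩
      obtain ⟨y, rfl⟩ := exists_mk_eq y
      rw [← hy, cokerMap_mk, cokerMap_mk, hip'.apply_apply_eq_zero]
      rfl
  · obtain ⟨x, rfl⟩ := exists_mk_eq x
    obtain ⟨y, rfl⟩ := hp' x
    exact ⟨QuotientAddGroup.mk y, rfl⟩

theorem zDefined_right_of_shortExact (hα : ZDefined α) (hβ : ZDefined β) : ZDefined γ := by
  obtain ⟨f₁, f₂, f₃, f₄, f₅, g₁, g₁₂, g₂₃, g₃₄, g₄₅, g₅⟩ :=
    snake_six_term hi hip hp hi' hip' hp' h₁ h₂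
  obtain ⟨_, _⟩ := hα
  obtain ⟨_, _⟩ := hβ
  exact ⟨Finite.of_exact g₂₃, Finite.of_surjective _ g₅⟩

theorem zDefined_left_of_shortExact (hβ : ZDefined β) (hγ : ZDefined γ) : ZDefined α := by
  obtain ⟨f₁, f₂, f₃, f₄, f₅, g₁, g₁₂, g₂₃, g₃₄, g₄₅, g₅⟩ :=
    snake_six_term hi hip hp hi' hip' hp' h₁ h₂
  obtain ⟨_, _⟩ := hβ
  obtain ⟨_, _⟩ := hγ
  exact ⟨Finite.of_injective _ g₁, Finite.of_exact g₃₄⟩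

theorem zInv_shortExact (hα : ZDefined α) (hβ : ZDefined β) (hγ : ZDefined γ) :
    zInv β = zInv α * zInv γ := by
  obtain ⟨f₁, f₂, f₃, f₄, f₅, g₁, g₁₂, g₂₃, g₃₄, g₄₅, g₅⟩ :=
    snake_six_term hi hip hp hi' hip' hp' h₁ h₂
  have h := card_six_term g₁ g₁₂ g₂₃ g₃₄ g₄₅ g₅
  obtain ⟨_, _⟩ := hα
  obtain ⟨_, _⟩ := hβ
  obtain ⟨_, _⟩ := hγ
  have := Nat.card_pos (α := A' ⧸ α.range)
  have := Nat.card_pos (α := B' ⧸ β.range)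
  have := Nat.card_pos (α := C' ⧸ γ.range)
  unfold zInv
  rw [div_mul_div_comm, div_eq_div_iff (by positivity) (by positivity)]
  norm_cast
  rw [h]
  ring

end ShortExact

end KernelCokernel

/-! ### Bijective semilinear endomorphisms of finitely generated modules -/

section SemilinearBijection

variable {R : Type*} [CommRing R] {σ : R →+* R}

theorem exists_semilinear_bijective_of_equiv {M N : Type*} [AddCommGroup M] [AddCommGroup N]
    [Module R M] [Module R N] (e : M ≃ₗ[R] N)
    (h : ∃ θ : N →ₛₗ[σ] N, Function.Bijective θ) : ∃ θ : M →ₛₗ[σ] M, Function.Bijective θ := by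
  obtain ⟨θ, hθ⟩ := h
  refine ⟨(e.symm.toLinearMap.comp θ).comp e.toLinearMap, ?_⟩
  exact e.symm.bijective.comp (hθ.comp e.bijective)

theorem exists_semilinear_bijective_prod {M N : Type*} [AddCommGroup M] [AddCommGroup N]
    [Module R M] [Module R N] (h : ∃ θ : M →ₛₗ[σ] M, Function.Bijective θ)
    (h' : ∃ θ : N →ₛₗ[σ] N, Function.Bijective θ) :
    ∃ θ : (M × N) →ₛₗ[σ] (M × N), Function.Bijective θ := by
  obtain ⟨θ, hθ⟩ := h
  obtain ⟨θ', hθ'⟩ := h'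
  exact ⟨{ toFun := Prod.map θ θ'
           map_add' := fun x y => Prod.ext (map_add θ _ _) (map_add θ' _ _)
           map_smul' := fun a x => Prod.ext (θ.map_smulₛₗ _ _) (θ'.map_smulₛₗ _ _) }, hθ.prodMap hθ'⟩

theorem exists_semilinear_bijective_pi {ι : Type*} {M : ι → Type*} [∀ i, AddCommGroup (M i)]
    [∀ i, Module R (M i)] (h : ∀ i, ∃ θ : M i →ₛₗ[σ] M i, Function.Bijective θ) :
    ∃ θ : (∀ i, M i) →ₛₗ[σ] (∀ i, M i), Function.Bijective θ := by
  choose θ hθ using h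
  exact ⟨{ toFun := Pi.map fun i => θ i
           map_add' := fun x y => by ext; simp
           map_smul' := fun a x => by ext; simp }, Function.Bijective.piMap hθ⟩

theorem exists_semilinear_bijective_self (hσ : Function.Bijective σ) :
    ∃ θ : R →ₛₗ[σ] R, Function.Bijective θ :=
  ⟨{ toFun := σ, map_add' := map_add σ, map_smul' := fun a x => by simp }, hσ⟩

theorem exists_semilinear_bijective_quotient [IsDomain R] (hσ : Function.Bijective σ) {x : R}
    (hx : Associated (σ x) x) :
    ∃ θ : (R ⧸ Ideal.span {x}) →ₛₗ[σ] (R ⧸ Ideal.span {x}), Function.Bijective θ := by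
  have h1 : Ideal.span {x} = (Ideal.span {x}).map σ := by
    rw [Ideal.map_span, Set.image_singleton]
    exact (Ideal.span_singleton_eq_span_singleton.2 hx).symm
  let e : (R ⧸ Ideal.span {x}) ≃+* (R ⧸ Ideal.span {x}) :=
    Ideal.quotientEquiv _ _ (RingEquiv.ofBijective σ hσ) h1
  refine ⟨{ toFun := e, map_add' := map_add e, map_smul' := fun a y => ?_ }, e.bijective⟩
  obtain ⟨y, rfl⟩ := Ideal.Quotient.mk_surjective y
  exact congrArg (Ideal.Quotient.mk _) (map_mul σ a y)

/-- By the structure theorem it suffices to treat `R` and its cyclic quotients, to which `σ`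
descends because it preserves every ideal. Such a `θ` identifies linear with `σ`-linear maps into
`N`, so that both can be counted alike. -/
theorem exists_semilinear_bijective [IsDomain R] [IsPrincipalIdealRing R]
    (hσ : Function.Bijective σ) (h : ∀ x, Associated (σ x) x) (N : Type*) [AddCommGroup N]
    [Module R N] [Module.Finite R N] : ∃ θ : N →ₛₗ[σ] N, Function.Bijective θ := by
  classical
  obtain ⟨n, ι, _, p, -, e, ⟨E⟩⟩ := Module.equiv_free_prod_directSum (R := R) (M := N)
  refine exists_semilinear_bijective_of_equiv E (exists_semilinear_bijective_prod ?_ ?_)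
  · exact exists_semilinear_bijective_of_equiv (Finsupp.linearEquivFunOnFinite R R (Fin n))
      (exists_semilinear_bijective_pi fun _ => exists_semilinear_bijective_self hσ)
  · exact exists_semilinear_bijective_of_equiv (DirectSum.linearEquivFunOnFintype R ι _)
      (exists_semilinear_bijective_pi fun _ => exists_semilinear_bijective_quotient hσ (h _))

/-- The module is finitely generated over the finite ring `R / a`. -/
theorem finite_of_smul_eq_zero {N : Type*} [AddCommGroup N] [Module R N] [Module.Finite R N]
    {a : R} [Finite (R ⧸ Ideal.span {a})] (h : ∀ x : N, a • x = 0) : Finite N := by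
  have h1 : Module.IsTorsionBySet R N (Ideal.span {a} : Set R) := by
    rw [Module.isTorsionBySet_span_singleton_iff]
    exact fun x => h x
  let _ := h1.module
  have := h1.isScalarTower (S := R)
  have : Module.Finite (R ⧸ Ideal.span {a}) N := Module.Finite.of_restrictScalars_finite R _ N
  exact Module.finite_of_finite (R ⧸ Ideal.span {a})

end SemilinearBijection

/-! ### Restriction of linear and semilinear maps to a sublattice -/

section Precomp

variable {R : Type*} [CommRing R] {σ : R →+* R} {A A' B : Type*} [AddCommGroup A] [AddCommGroup A']
  [AddCommGroup B] [Module R A] [Module R A'] [Module R B]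

/-- Composition with a linear map, on semilinear maps. -/
def semilinearPrecomp (σ : R →+* R) (B : Type*) [AddCommGroup B] [Module R B] (j : A →ₗ[R] A') :
    (A' →ₛₗ[σ] B) →+ (A →ₛₗ[σ] B) where
  toFun s := s.comp j
  map_zero' := LinearMap.zero_comp _
  map_add' _ _ := LinearMap.add_comp _ _ _

@[simp]
theorem semilinearPrecomp_apply (j : A →ₗ[R] A') (s : A' →ₛₗ[σ] B) (x : A) :
    semilinearPrecomp σ B j s x = s (j x) := rfl

/-- Composition with a bijective semilinear map. -/
def semilinearPostcompEquiv (A : Type*) [AddCommGroup A] [Module R A] {θ : B →ₛₗ[σ] B}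
    (hθ : Function.Bijective θ) : (A →ₗ[R] B) ≃+ (A →ₛₗ[σ] B) :=
  AddEquiv.ofBijective
    (AddMonoidHom.mk' (θ.comp ·) fun _ _ =>
      LinearMap.comp_add _ _ _) (by
    constructor
    · intro _ _ h
      ext x
      exact hθ.1 (LinearMap.congr_fun h x)
    · intro t
      choose g hg using hθ.2
      refine ⟨{ toFun := fun x => g (t x)
                map_add' := fun x y => hθ.1 (by simp [hg])
                map_smul' := fun a x => hθ.1 (by simp [hg]) }, ?_⟩
      ext x
      exact hg _)

variable [IsDomain R] [IsPrincipalIdealRing R] [Module.Finite R B] {j : A →ₗ[R] A'}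
  (hj : Function.Injective j) {a : R} [Finite (R ⧸ Ideal.span {a})] (ha : ∀ x, ∃ y, j y = a • x)

include hj ha

/-- The kernel and the cokernel of restriction along `j` are both killed by `a`. -/
theorem zDefined_linearPrecomp [Module.Finite R A] [Module.Finite R A'] [Module.Free R A]
    [Module.Free R A'] : ZDefined (semilinearPrecomp (RingHom.id R) B j) := by
  let J : (A' →ₗ[R] B) →ₗ[R] (A →ₗ[R] B) := LinearMap.lcomp R B j
  have h1 : Finite (LinearMap.ker J) := by
    refine finite_of_smul_eq_zero (R := R) (a := a) fun s => ?_
    ext x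
    obtain ⟨y, hy⟩ := ha x
    have h2 : s.1 (j y) = 0 := LinearMap.congr_fun s.2 y
    rwa [hy, map_smul] at h2
  have h2 : Finite ((A →ₗ[R] B) ⧸ LinearMap.range J) := by
    refine finite_of_smul_eq_zero (R := R) (a := a) fun s => ?_
    obtain ⟨s, rfl⟩ := Submodule.Quotient.mk_surjective _ s
    rw [← Submodule.Quotient.mk_smul, Submodule.Quotient.mk_eq_zero]
    choose g hg using ha
    -- Since `a A'` lies in the image of `j`, the map `s ∘ (j⁻¹ a)` extends `a s` to `A'`.
    refine ⟨{ toFun := fun x => s (g x)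
              map_add' := fun x y => ?_
              map_smul' := fun c x => ?_ }, ?_⟩
    · rw [← map_add]
      exact congrArg s (hj (by simp [hg]))
    · rw [← map_smul]
      exact congrArg s (hj (by rw [hg, map_smul, hg, smul_comm, RingHom.id_apply]))
    · ext x
      change s (g (j x)) = a • s x
      rw [← map_smul]
      exact congrArg s (hj (by simp [hg]))
  exact ⟨h1, h2⟩

-- Composition with a bijective semilinear `θ` turns restriction of linear maps into restriction of
-- `σ`-linear maps.
variable (σ B) in
theorem zInv_semilinearPrecomp [Module.Finite R A] [Module.Finite R A'] [Module.Free R A]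
    [Module.Free R A'] (hσ : Function.Bijective σ) (h : ∀ x, Associated (σ x) x) :
    ZDefined (semilinearPrecomp (RingHom.id R) B j) ∧ ZDefined (semilinearPrecomp σ B j) ∧
    zInv (semilinearPrecomp (RingHom.id R) B j) = zInv (semilinearPrecomp σ B j) := by
  obtain ⟨θ, hθ⟩ := exists_semilinear_bijective hσ h B
  have h1 := zDefined_linearPrecomp (B := B) hj ha
  have h2 : ∀ s, semilinearPrecomp σ B j (semilinearPostcompEquiv A' hθ s) =
      semilinearPostcompEquiv A hθ (semilinearPrecomp (RingHom.id R) B j s) := fun s => rfl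
  exact ⟨h1, (zDefined_congr _ _ h2).1 h1, zInv_congr _ _ h2⟩

end Precomp

/-! ### The edge map, and restriction on Ext⁰ and Ext¹ -/

section Semilinear

universe v₁ u₁ w₁ u₂

variable {R : Type u₂} [CommRing R] {σ : R →+* R}
variable {C : Type u₁} [Category.{v₁} C] [Abelian C] [HasExt.{w₁} C]
variable {U : C ⥤ ModuleCat.{u} R} [U.Additive] [PreservesFiniteLimits U]
  [PreservesFiniteColimits U] [U.Faithful] {F : ∀ M, U.obj M →ₛₗ[σ] U.obj M}

namespace IsSemilinearCat

variable (hU : IsSemilinearCat U F)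

include hU

/-- The map `Hom(M, N) → Ext¹(M, N)` that sends `u` to the extension twisted by `c u F`. -/
def edgeHom (c : R) (M N : C) : (M ⟶ N) →+ Abelian.Ext M N 1 :=
  (hU.twistHom M N).comp (AddMonoidHom.mk' (fun u => c • (U.map u).hom.comp (F M)) fun u v => by
    ext x
    simp)

theorem edgeHom_apply (c : R) {M N : C} (u : M ⟶ N) :
    hU.edgeHom c M N u = hU.twistHom M N (c • (U.map u).hom.comp (F M)) := rfl

theorem edgeHom_postcomp (c : R) {M N N' : C} (u : M ⟶ N) (v : N ⟶ N') :
    (hU.edgeHom c M N u).comp (Abelian.Ext.mk₀ v) (add_zero 1) = hU.edgeHom c M N' (u ≫ v) := by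
  rw [edgeHom_apply, edgeHom_apply, twistHom_postcomp]
  congr 1
  ext x
  simp

theorem edgeHom_precomp (c : R) {M M' N : C} (u : M ⟶ N) (v : M' ⟶ M) :
    (Abelian.Ext.mk₀ v).comp (hU.edgeHom c M N u) (zero_add 1) = hU.edgeHom c M' N (v ≫ u) := by
  rw [edgeHom_apply, edgeHom_apply, twistHom_precomp]
  congr 1
  ext x
  simp [hU.nat]

/-- The edge map as a map out of `Ext⁰`. -/
def edgeExt (c : R) (M N : C) : Abelian.Ext M N 0 →+ Abelian.Ext M N 1 :=
  (hU.edgeHom c M N).comp (Abelian.Ext.addEquiv₀ (X := M) (Y := N) : _ →+ (M ⟶ N))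

theorem zDefined_edgeExt {c : R} {M N : C} :
    ZDefined (hU.edgeExt c M N) ↔ ZDefined (hU.edgeHom c M N) :=
  zDefined_congr Abelian.Ext.addEquiv₀ (AddEquiv.refl _) fun _ => rfl

theorem zInv_edgeExt {c : R} {M N : C} : zInv (hU.edgeExt c M N) = zInv (hU.edgeHom c M N) :=
  zInv_congr Abelian.Ext.addEquiv₀ (AddEquiv.refl _) fun _ => rfl

theorem edgeExt_mk₀ (c : R) {M N : C} (u : M ⟶ N) :
    hU.edgeExt c M N (Abelian.Ext.mk₀ u) = hU.edgeHom c M N u := by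
  change hU.edgeHom c M N (Abelian.Ext.addEquiv₀ (Abelian.Ext.addEquiv₀.symm u)) = _
  rw [AddEquiv.apply_symm_apply]

theorem edgeExt_comp_precomp (c : R) {M M' N : C} (v : M' ⟶ M) :
    (hU.edgeExt c M' N).comp ((Abelian.Ext.mk₀ v).precomp N (zero_add 0)) =
      ((Abelian.Ext.mk₀ v).precomp N (zero_add 1)).comp (hU.edgeExt c M N) := by
  ext x
  obtain ⟨u, rfl⟩ := (Abelian.Ext.mk₀_bijective _ _).2 x
  simp [edgeExt_mk₀, edgeHom_precomp]

theorem edgeExt_comp_postcomp (c : R) {M N N' : C} (v : N ⟶ N') :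
    (hU.edgeExt c M N').comp ((Abelian.Ext.mk₀ v).postcomp M (add_zero 0)) =
      ((Abelian.Ext.mk₀ v).postcomp M (add_zero 1)).comp (hU.edgeExt c M N) := by
  ext x
  obtain ⟨u, rfl⟩ := (Abelian.Ext.mk₀_bijective _ _).2 x
  simp [edgeExt_mk₀, edgeHom_postcomp]

/-- `Ext⁰` is the kernel of `s ↦ F s - s F`. -/
def extZeroEquiv (M N : C) : Abelian.Ext M N 0 ≃+ (semilinearComm (F M) (F N)).ker :=
  Abelian.Ext.addEquiv₀.trans (hU.homEquiv M N)

/-- `Ext¹` is the cokernel of `s ↦ F s - s F` if `M` is projective over `R`. -/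
def extOneEquiv (M N : C) [Module.Projective R (U.obj M)] :
    (U.obj M →ₛₗ[σ] U.obj N) ⧸ (semilinearComm (F M) (F N)).range ≃+ Abelian.Ext M N 1 :=
  (QuotientAddGroup.quotientAddEquivOfEq (hU.ker_twistHom M N).symm).trans
    (QuotientAddGroup.quotientKerEquivOfSurjective _ (hU.twistHom_surjective M N))

theorem extOneEquiv_mk {M N : C} [Module.Projective R (U.obj M)] (φ : U.obj M →ₛₗ[σ] U.obj N) :
    hU.extOneEquiv M N (QuotientAddGroup.mk φ) = hU.twistHom M N φ := rfl

theorem precomp_square {M M' : C} (i : M ⟶ M') (N : C) :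
    (semilinearComm (F M) (F N)).comp (semilinearPrecomp (RingHom.id R) (U.obj N) (U.map i).hom) =
      (semilinearPrecomp σ (U.obj N) (U.map i).hom).comp (semilinearComm (F M') (F N)) := by
  ext s x
  simp [hU.nat]

section Torsion

variable [IsDomain R] [IsPrincipalIdealRing R] (hσ : Function.Bijective σ)
  (hσ' : ∀ x, Associated (σ x) x)

include hσ hσ'

/-- Restriction acts on linear maps, on `σ`-linear maps, and on the kernel, image and cokernel of `d
: s ↦ F s - s F`. The two short exact sequences through the image of `d` show that `z` on the kernel
and `z` on the cokernel differ by the ratio of `z` on linear and on semilinear maps, which is 1. -/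
theorem zInv_precomp_of_free {M M' N : C} [Module.Free R (U.obj M)] [Module.Free R (U.obj M')]
    (i : M ⟶ M') (hi : Function.Injective (U.map i).hom) {a : R} [Finite (R ⧸ Ideal.span {a})]
    (ha : ∀ x, ∃ y, (U.map i).hom y = a • x) :
    ZDefined ((Abelian.Ext.mk₀ i).precomp N (zero_add 0)) ∧
    ZDefined ((Abelian.Ext.mk₀ i).precomp N (zero_add 1)) ∧
    zInv ((Abelian.Ext.mk₀ i).precomp N (zero_add 0)) =
      zInv ((Abelian.Ext.mk₀ i).precomp N (zero_add 1)) := by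
  have := hU.finite M
  have := hU.finite M'
  have := hU.finite N
  obtain ⟨z0, z1, hz⟩ := zInv_semilinearPrecomp σ (U.obj N) hi ha hσ hσ'
  have sq := hU.precomp_square i N
  have sq' : ∀ s, _ = _ := DFunLike.congr_fun sq
  set d := semilinearComm (F M) (F N)
  set d' := semilinearComm (F M') (F N)
  set j0 := semilinearPrecomp (RingHom.id R) (U.obj N) (U.map i).hom
  set j1 := semilinearPrecomp σ (U.obj N) (U.map i).hom
  let γ : d'.range →+ d.range := (j1.comp d'.range.subtype).codRestrict d.range (by
    rintro ⟨_, s, rfl⟩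
    exact ⟨j0 s, sq' s⟩)
  have zγ : ZDefined γ := by
    obtain ⟨_, _⟩ := z0
    obtain ⟨_, _⟩ := z1
    constructor
    · refine Finite.of_injective (fun x : γ.ker => (⟨x.1.1, ?_⟩ : j1.ker)) fun x y h => ?_
      · exact congrArg Subtype.val x.2
      · have h' := congrArg Subtype.val h
        exact Subtype.ext (Subtype.ext h')
    · refine Finite.of_surjective (cokerMap (f := j0) (f' := γ) (u := d'.rangeRestrict)
        (v := d.rangeRestrict) ?_) fun x => ?_
      · exact AddMonoidHom.ext fun s => Subtype.ext (sq' s).symm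
      · obtain ⟨⟨_, y, rfl⟩, rfl⟩ := exists_mk_eq x
        exact ⟨QuotientAddGroup.mk y, rfl⟩
  have ex1 : ∀ {A B : Type _} [AddCommGroup A] [AddCommGroup B] (f : A →+ B),
      Function.Exact f.ker.subtype f.rangeRestrict := fun f x => by
    constructor
    · intro h
      exact ⟨⟨x, congrArg Subtype.val h⟩, rfl⟩
    · rintro ⟨y, rfl⟩
      exact Subtype.ext y.2
  have ex2 : ∀ {A B : Type _} [AddCommGroup A] [AddCommGroup B] (f : A →+ B),
      Function.Exact f.range.subtype (QuotientAddGroup.mk' f.range) := fun f x => by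
    rw [QuotientAddGroup.mk'_apply, mk_eq_zero_iff_mem_range]
    constructor
    · rintro h
      exact ⟨⟨x, h⟩, rfl⟩
    · rintro ⟨y, rfl⟩
      exact y.2
  have c1 : d.ker.subtype.comp (kerMap sq) = j0.comp d'.ker.subtype := rfl
  have c2 : d.rangeRestrict.comp j0 = γ.comp d'.rangeRestrict :=
    AddMonoidHom.ext fun s => Subtype.ext (sq' s)
  have c3 : d.range.subtype.comp γ = j1.comp d'.range.subtype := rfl
  have c4 : (QuotientAddGroup.mk' d.range).comp j1 =
    (cokerMap sq).comp (QuotientAddGroup.mk' d'.range) := rfl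
  have za : ZDefined (kerMap sq) := zDefined_left_of_shortExact Subtype.val_injective (ex1 d')
    d'.rangeRestrict_surjective Subtype.val_injective (ex1 d) d.rangeRestrict_surjective c1 c2 z0 zγ
  have zb : ZDefined (cokerMap sq) := zDefined_right_of_shortExact Subtype.val_injective (ex2 d')
    (QuotientAddGroup.mk'_surjective _) Subtype.val_injective (ex2 d)
    (QuotientAddGroup.mk'_surjective _) c3 c4 zγ z1
  have e1 := zInv_shortExact Subtype.val_injective (ex1 d')
    d'.rangeRestrict_surjective Subtype.val_injective (ex1 d) d.rangeRestrict_surjective c1 c2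
    za z0 zγ
  have e2 := zInv_shortExact Subtype.val_injective (ex2 d')
    (QuotientAddGroup.mk'_surjective _) Subtype.val_injective (ex2 d)
    (QuotientAddGroup.mk'_surjective _) c3 c4 zγ z1 zb
  -- The contribution `zInv γ` of the image of `d` occurs once in each sequence and cancels.
  have hzz : zInv (kerMap sq) = zInv (cokerMap sq) := by
    have := zγ.ne_zero
    rw [← hz, e1, mul_comm] at e2
    exact mul_left_cancel₀ this e2
  have s0 : ∀ x, kerMap sq (hU.extZeroEquiv M' N x) =
      hU.extZeroEquiv M N ((Abelian.Ext.mk₀ i).precomp N (zero_add 0) x) := fun x => by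
    obtain ⟨u, rfl⟩ := (Abelian.Ext.mk₀_bijective _ _).2 x
    have h1 : ∀ {X Y : C} (f : X ⟶ Y), hU.extZeroEquiv X Y (Abelian.Ext.mk₀ f) = hU.homEquiv X Y f :=
      fun f => congrArg (hU.homEquiv _ _) (Abelian.Ext.addEquiv₀.apply_symm_apply f)
    have h2 : (Abelian.Ext.mk₀ i).precomp N (zero_add 0) (Abelian.Ext.mk₀ u) =
      Abelian.Ext.mk₀ (i ≫ u) := Abelian.Ext.mk₀_comp_mk₀ _ _
    rw [h1, h2, h1]
    refine Subtype.ext ?_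
    ext y
    simp [j0]
  have s1 : ∀ x, (Abelian.Ext.mk₀ i).precomp N (zero_add 1) (hU.extOneEquiv M' N x) =
      hU.extOneEquiv M N (cokerMap sq x) := fun x => by
    obtain ⟨φ, rfl⟩ := exists_mk_eq x
    rw [cokerMap_mk, extOneEquiv_mk, extOneEquiv_mk]
    exact hU.twistHom_precomp φ i
  exact ⟨(zDefined_congr _ _ s0).2 za, (zDefined_congr _ _ s1).1 zb,
    (zInv_congr _ _ s0).trans (hzz.trans (zInv_congr _ _ s1))⟩

end Torsion

end IsSemilinearCat

end Semilinear

/-! ### Euler characteristics of seven-term exact sequences -/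

section EulerCharacteristic

variable {A₀ B₀ A₁ B₁ K₀ K₁ K₂ : Type*} [AddCommGroup A₀] [AddCommGroup B₀] [AddCommGroup A₁]
  [AddCommGroup B₁] [AddCommGroup K₀] [AddCommGroup K₁] [AddCommGroup K₂]
  {i₀ : K₀ →+ A₀} {p₀ : A₀ →+ B₀} {δ₀ : B₀ →+ K₁} {i₁ : K₁ →+ A₁} {p₁ : A₁ →+ B₁} {δ₁ : B₁ →+ K₂}
  (h₀ : Function.Injective i₀) (e₀ : Function.Exact i₀ p₀) (e₁ : Function.Exact p₀ δ₀)
  (e₂ : Function.Exact δ₀ i₁) (e₃ : Function.Exact i₁ p₁) (e₄ : Function.Exact p₁ δ₁)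
  (h₁ : Function.Surjective δ₁)

include h₀ e₀ e₁ e₂ e₃ e₄ h₁

/-- The sequence `0 → K₀ → A₀ → B₀ → K₁ → A₁ → B₁ → K₂ → 0` is cut into the kernels and cokernels of
`p₀` and `p₁`, with `K₁` an extension of `ker p₁` by `coker p₀`. The groups `A` and `B` may be
infinite. -/
theorem longExact_equivs :
    ∃ (_ : K₀ ≃+ p₀.ker) (f : B₀ ⧸ p₀.range →+ K₁) (g : K₁ →+ p₁.ker) (_ : B₁ ⧸ p₁.range ≃+ K₂),
      Function.Injective f ∧ Function.Exact f g ∧ Function.Surjective g := by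
  have k₀ : i₀.range = p₀.ker := by
    ext x
    exact (e₀ x).symm
  have k₁ : δ₀.ker = p₀.range := by
    ext x
    exact e₁ x
  have k₂ : i₁.range = p₁.ker := by
    ext x
    exact (e₃ x).symm
  have k₃ : δ₁.ker = p₁.range := by
    ext x
    exact e₄ x
  refine ⟨(AddMonoidHom.ofInjective h₀).trans (AddEquiv.addSubgroupCongr k₀),
    (QuotientAddGroup.kerLift δ₀).comp (QuotientAddGroup.quotientAddEquivOfEq k₁.symm : _ →+ _),
    (AddEquiv.addSubgroupCongr k₂ : _ →+ _).comp i₁.rangeRestrict,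
    (QuotientAddGroup.quotientAddEquivOfEq k₃.symm).trans
      (QuotientAddGroup.quotientKerEquivOfSurjective _ h₁), ?_, fun x => ?_, ?_⟩
  · exact (QuotientAddGroup.kerLift_injective δ₀).comp
      (QuotientAddGroup.quotientAddEquivOfEq k₁.symm).injective
  · constructor
    · intro h
      obtain ⟨y, rfl⟩ := (e₂ x).1 (congrArg Subtype.val h)
      exact ⟨QuotientAddGroup.mk y, rfl⟩
    · rintro ⟨y, rfl⟩
      obtain ⟨y, rfl⟩ := exists_mk_eq y
      exact Subtype.ext (e₂.apply_apply_eq_zero y)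
  · exact (AddEquiv.addSubgroupCongr k₂).surjective.comp i₁.rangeRestrict_surjective

theorem finite_of_zDefined (z₀ : ZDefined p₀) (z₁ : ZDefined p₁) :
    Finite K₀ ∧ Finite K₁ ∧ Finite K₂ := by
  obtain ⟨a, f, g, b, hf, hfg, hg⟩ := longExact_equivs h₀ e₀ e₁ e₂ e₃ e₄ h₁
  obtain ⟨_, _⟩ := z₀
  obtain ⟨_, _⟩ := z₁
  exact ⟨Finite.of_equiv _ a.symm.toEquiv, Finite.of_exact hfg, Finite.of_equiv _ b.toEquiv⟩

theorem zDefined_of_longExact [Finite K₀] [Finite K₁] [Finite K₂] :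
    ZDefined p₀ ∧ ZDefined p₁ := by
  obtain ⟨a, f, g, b, hf, hfg, hg⟩ := longExact_equivs h₀ e₀ e₁ e₂ e₃ e₄ h₁
  exact ⟨⟨Finite.of_equiv _ a.toEquiv, Finite.of_injective f hf⟩,
    ⟨Finite.of_surjective g hg, Finite.of_equiv _ b.symm.toEquiv⟩⟩

theorem card_mul_card_mul_zInv (z₀ : ZDefined p₀) (z₁ : ZDefined p₁) :
    (Nat.card K₀ : ℚ) * Nat.card K₂ * zInv p₁ = Nat.card K₁ * zInv p₀ := by
  obtain ⟨a, f, g, b, hf, hfg, hg⟩ := longExact_equivs h₀ e₀ e₁ e₂ e₃ e₄ h₁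
  obtain ⟨_, _⟩ := z₀
  obtain ⟨_, _⟩ := z₁
  have h : Nat.card K₁ = Nat.card (B₀ ⧸ p₀.range) * Nat.card p₁.ker := by
    rw [card_eq_card_range_mul_card_range hfg,
      ← Nat.card_congr (AddMonoidHom.ofInjective hf).toEquiv, AddMonoidHom.range_eq_top.2 hg,
      AddSubgroup.card_top]
  have := Nat.card_pos (α := B₀ ⧸ p₀.range)
  have := Nat.card_pos (α := B₁ ⧸ p₁.range)
  unfold zInv
  rw [h, Nat.card_congr a.toEquiv, ← Nat.card_congr b.toEquiv]
  push_cast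
  field_simp

end EulerCharacteristic

/-! ### Long exact sequences and reduction to free modules -/

section Semilinear

universe v₁ u₁ w₁ u₂

variable {C : Type u₁} [Category.{v₁} C] [Abelian C] [HasExt.{w₁} C]

section LongExact

variable {S : ShortComplex C} (hS : S.ShortExact) (X : C)

include hS

theorem exact_precomp (n : ℕ) :
    Function.Exact ((Abelian.Ext.mk₀ S.g).precomp X (zero_add n))
      ((Abelian.Ext.mk₀ S.f).precomp X (zero_add n)) :=
  (ShortComplex.ab_exact_iff_function_exact _).1 (Abelian.Ext.contravariant_sequence_exact₂' hS X n)

theorem exact_precomp_extClass (n m : ℕ) (h : 1 + n = m) :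
    Function.Exact ((Abelian.Ext.mk₀ S.f).precomp X (zero_add n)) (hS.extClass.precomp X h) :=
  (ShortComplex.ab_exact_iff_function_exact _).1
    (Abelian.Ext.contravariant_sequence_exact₁' hS X n m h)

theorem exact_extClass_precomp (n m : ℕ) (h : 1 + n = m) :
    Function.Exact (hS.extClass.precomp X h) ((Abelian.Ext.mk₀ S.g).precomp X (zero_add m)) :=
  (ShortComplex.ab_exact_iff_function_exact _).1
    (Abelian.Ext.contravariant_sequence_exact₃' hS X n m h)

theorem exact_postcomp (n : ℕ) :
    Function.Exact ((Abelian.Ext.mk₀ S.f).postcomp X (add_zero n))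
      ((Abelian.Ext.mk₀ S.g).postcomp X (add_zero n)) :=
  (ShortComplex.ab_exact_iff_function_exact _).1 (Abelian.Ext.covariant_sequence_exact₂' X hS n)

theorem exact_postcomp_extClass (n m : ℕ) (h : n + 1 = m) :
    Function.Exact ((Abelian.Ext.mk₀ S.g).postcomp X (add_zero n)) (hS.extClass.postcomp X h) :=
  (ShortComplex.ab_exact_iff_function_exact _).1
    (Abelian.Ext.covariant_sequence_exact₃' X hS n m h)

theorem exact_extClass_postcomp (n m : ℕ) (h : n + 1 = m) :
    Function.Exact (hS.extClass.postcomp X h) ((Abelian.Ext.mk₀ S.f).postcomp X (add_zero m)) :=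
  (ShortComplex.ab_exact_iff_function_exact _).1
    (Abelian.Ext.covariant_sequence_exact₁' X hS n m h)

theorem precomp_extClass_surjective (n m : ℕ) (h : 1 + n = m)
    [Subsingleton (Abelian.Ext S.X₂ X m)] : Function.Surjective (hS.extClass.precomp X h) :=
  fun x => (exact_extClass_precomp hS X n m h x).1 (Subsingleton.elim _ _)

end LongExact

variable {R : Type u₂} [CommRing R] {σ : R →+* R}
variable {U : C ⥤ ModuleCat.{u} R} [U.Additive] [PreservesFiniteLimits U]
  [PreservesFiniteColimits U] [U.Faithful] {F : ∀ M, U.obj M →ₛₗ[σ] U.obj M}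

namespace IsSemilinearCat

variable (hU : IsSemilinearCat U F) [IsDomain R] [IsPrincipalIdealRing R]

include hU

theorem subsingleton_ext_of_free (M N : C) [Module.Free R (U.obj M)] (n : ℕ) :
    Subsingleton (Abelian.Ext M N (n + 2)) :=
  subsingleton_of_forall_eq 0 hU.ext_eq_zero_of_free

theorem subsingleton_ext (M N : C) {i : ℕ} (hi : 2 < i) : Subsingleton (Abelian.Ext M N i) := by
  obtain ⟨n, rfl⟩ := Nat.exists_eq_add_of_le hi
  rw [add_comm]
  exact subsingleton_of_forall_eq 0 fun e => hU.ext_eq_zero (n := n) e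

/-- Every object is an extension of a free one by one killed by a nonzero scalar. -/
theorem exists_torsion_sequence (M : C) : ∃ (S : ShortComplex C) (_ : S.ShortExact) (_ : S.X₂ = M),
    Module.Free R (U.obj S.X₃) ∧ ∃ a : R, a ≠ 0 ∧ ∀ x : U.obj S.X₁, a • x = 0 := by
  obtain ⟨N, q, hq, hN, h⟩ := hU.exists_quotient M
  have hS : (ShortComplex.mk _ _ (kernel.condition q)).ShortExact :=
    { exact := ShortComplex.exact_of_f_is_kernel _ (kernelIsKernel _) }
  refine ⟨_, hS, rfl, hN, ?_⟩
  have := hU.finite (kernel q)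
  have ht : Module.IsTorsion R (U.obj (kernel q)) := fun {x} => by
    obtain ⟨a, ha, hx⟩ := h ((U.map (kernel.ι q)).hom x)
      ((hS.exact_map U).apply_apply_eq_zero x)
    refine ⟨⟨a, mem_nonZeroDivisors_of_ne_zero ha⟩, hS.injective_map U ?_⟩
    rw [map_zero]
    exact (map_smul _ a x).trans hx
  -- Finite generation gives one scalar that kills the whole torsion module.
  obtain ⟨a, ha, ha'⟩ := Submodule.annihilator_top_inter_nonZeroDivisors ht
  exact ⟨a, nonZeroDivisors.ne_zero ha', fun x => Submodule.mem_annihilator.1 ha x trivial⟩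

variable (hσ : Function.Bijective σ) (hσ' : ∀ x, Associated (σ x) x)

include hσ hσ'

/-- The two groups are kernel and cokernel of a homomorphism between finite groups of the same
order. -/
theorem card_ext_of_free_of_torsion {M N : C} [Module.Free R (U.obj M)] {a : R}
    [Finite (R ⧸ Ideal.span {a})] (ha : ∀ x : U.obj N, a • x = 0) :
    Finite (Abelian.Ext M N 0) ∧ Finite (Abelian.Ext M N 1) ∧
      Nat.card (Abelian.Ext M N 0) = Nat.card (Abelian.Ext M N 1) := by
  have := hU.finite M
  have := hU.finite N
  have h0 : Finite (U.obj M →ₗ[R] U.obj N) :=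
    finite_of_smul_eq_zero (R := R) (a := a) fun s => LinearMap.ext fun x => ha _
  obtain ⟨θ, hθ⟩ := exists_semilinear_bijective hσ hσ' (U.obj N)
  have h1 : Finite (U.obj M →ₛₗ[σ] U.obj N) :=
    Finite.of_equiv _ (semilinearPostcompEquiv (U.obj M) hθ).toEquiv
  have h2 := zInv_of_finite (semilinearComm (F M) (F N))
  rw [Nat.card_congr (semilinearPostcompEquiv (U.obj M) hθ).toEquiv, div_self
    (by exact_mod_cast Nat.card_pos.ne'), zInv, div_eq_one_iff_eq
    (by exact_mod_cast Nat.card_pos.ne')] at h2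
  refine ⟨Finite.of_equiv _ (hU.extZeroEquiv M N).symm.toEquiv,
    Finite.of_equiv _ (hU.extOneEquiv M N).toEquiv, ?_⟩
  rw [Nat.card_congr (hU.extZeroEquiv M N).toEquiv, ← Nat.card_congr (hU.extOneEquiv M N).toEquiv]
  exact_mod_cast h2

/-- Apply Ext(-, N) to a free resolution of `M`. Restriction along its injection has the same `z` in
degrees 0 and 1, and these cancel in the long exact sequence, which ends with Ext²(M, N) because
Ext² of a free object vanishes. -/
theorem card_ext_of_torsion {M N : C} {a : R} [Finite (R ⧸ Ideal.span {a})]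
    (ha : ∀ x : U.obj M, a • x = 0) :
    (Finite (Abelian.Ext M N 0) ∧ Finite (Abelian.Ext M N 1) ∧ Finite (Abelian.Ext M N 2)) ∧
      Nat.card (Abelian.Ext M N 0) * Nat.card (Abelian.Ext M N 2) =
        Nat.card (Abelian.Ext M N 1) := by
  obtain ⟨S, hS, rfl, t, h1, h2, -⟩ := hU.exists_resolution (𝟙 M)
  have hx : ∀ x, ∃ y, (U.map S.f).hom y = a • x := fun x =>
    (hS.exact_map U _).1 (by rw [map_smul, ha])
  obtain ⟨z0, z1, hz⟩ := hU.zInv_precomp_of_free hσ hσ' (N := N) S.f (hS.injective_map U) hx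
  have := hU.subsingleton_ext_of_free S.X₂ N 0
  have := hS.epi_g
  have i0 := Abelian.Ext.precomp_mk₀_injective_of_epi N S.g
  have s1 := precomp_extClass_surjective hS N 1 2 rfl
  have e0 := exact_precomp hS N 0
  have e1 := exact_precomp_extClass hS N 0 1 rfl
  have e2 := exact_extClass_precomp hS N 0 1 rfl
  have e3 := exact_precomp hS N 1
  have e4 := exact_precomp_extClass hS N 1 2 rfl
  have hf := finite_of_zDefined i0 e0 e1 e2 e3 e4 s1 z0 z1
  have hc := card_mul_card_mul_zInv i0 e0 e1 e2 e3 e4 s1 z0 z1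
  refine ⟨hf, ?_⟩
  rw [← hz] at hc
  exact_mod_cast mul_right_cancel₀ z0.ne_zero hc

variable (hfin : ∀ a : R, a ≠ 0 → Finite (R ⧸ Ideal.span {a}))

include hfin

/-- Write `T = S.X₁`. As Ext² and Ext³ of the free quotient vanish, `Ext²(S.X₂, N) ≅ Ext²(T, N)`.
Naturality of the edge map and the long exact sequence change `z` by the factor `[Ext⁰(T, N)] /
[Ext¹(T, N)]`, which is `1 / [Ext²(T, N)]`. -/
theorem edgeExt_of_free_left (c : R) {N : C} {S : ShortComplex C} (hS : S.ShortExact)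
    [Module.Free R (U.obj S.X₃)] {a : R} (ha : a ≠ 0) (h : ∀ x : U.obj S.X₁, a • x = 0) :
    Finite (Abelian.Ext S.X₂ N 2) ∧ (ZDefined (hU.edgeExt c S.X₃ N) →
      ZDefined (hU.edgeExt c S.X₂ N) ∧
      zInv (hU.edgeExt c S.X₂ N) * Nat.card (Abelian.Ext S.X₂ N 2) =
        zInv (hU.edgeExt c S.X₃ N)) := by
  have := hfin a ha
  obtain ⟨⟨_, _, _⟩, hc⟩ := hU.card_ext_of_torsion hσ hσ' (N := N) h
  have := hU.subsingleton_ext_of_free S.X₃ N 0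
  have := hU.subsingleton_ext_of_free S.X₃ N 1
  have := hS.epi_g
  have i0 := Abelian.Ext.precomp_mk₀_injective_of_epi N S.g
  have e1 := exact_precomp hS N 0
  have e2 := exact_precomp_extClass hS N 0 1 rfl
  have e3 := exact_extClass_precomp hS N 0 1 rfl
  have e4 := exact_precomp hS N 1
  have e5 := exact_precomp_extClass hS N 1 2 rfl
  have e6 := exact_precomp hS N 2
  have e7 := exact_precomp_extClass hS N 2 3 rfl
  -- The long exact sequence starts with `Ext⁰(S.X₃, N)`, so the term `K₀` is the trivial group
  -- `PUnit`.
  have k0 : Function.Injective (0 : PUnit.{1} →+ Abelian.Ext S.X₃ N 0) :=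
    fun _ _ _ => Subsingleton.elim _ _
  have e0 : Function.Exact (0 : PUnit.{1} →+ Abelian.Ext S.X₃ N 0)
      ((Abelian.Ext.mk₀ S.g).precomp N (zero_add 0)) := fun x =>
    ⟨fun hx => ⟨0, (i0 (hx.trans (map_zero _).symm)).symm⟩, by rintro ⟨y, rfl⟩; exact map_zero _⟩
  have s1 : Function.Surjective ((Abelian.Ext.mk₀ S.f).precomp N (zero_add 1)) := fun x =>
    (e5 x).1 (Subsingleton.elim _ _)
  have b2 : Function.Bijective ((Abelian.Ext.mk₀ S.f).precomp N (zero_add 2)) := by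
    refine ⟨(injective_iff_map_eq_zero _).2 fun x hx => ?_, fun x => (e7 x).1 (Subsingleton.elim _ _)⟩
    obtain ⟨y, rfl⟩ := (e6 x).1 hx
    rw [Subsingleton.elim y 0, map_zero]
  refine ⟨Finite.of_injective _ b2.1, fun hz => ?_⟩
  obtain ⟨z0, z1⟩ := zDefined_of_longExact k0 e0 e1 e2 e3 e4 s1
  have h1 := card_mul_card_mul_zInv k0 e0 e1 e2 e3 e4 s1 z0 z1
  have sq := hU.edgeExt_comp_precomp c (N := N) S.g
  have z := ZDefined.of_square' sq hz z0 z1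
  refine ⟨z, ?_⟩
  have h2 := zInv_square sq z0 z1 z
  rw [Nat.card_congr (Equiv.ofBijective _ b2)]
  have := Nat.card_pos (α := Abelian.Ext S.X₁ N 1)
  have c1 : (Nat.card (Abelian.Ext S.X₁ N 1) : ℚ) ≠ 0 := by positivity
  have hc' : (Nat.card (Abelian.Ext S.X₁ N 0) : ℚ) * Nat.card (Abelian.Ext S.X₁ N 2) =
    Nat.card (Abelian.Ext S.X₁ N 1) := by exact_mod_cast hc
  simp only [Nat.card_unique, Nat.cast_one, one_mul] at h1
  apply mul_right_cancel₀ (mul_ne_zero c1 z0.ne_zero)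
  linear_combination (-(Nat.card (Abelian.Ext S.X₁ N 1) : ℚ) * Nat.card (Abelian.Ext S.X₁ N 2)) * h2
    + zInv (hU.edgeExt c S.X₃ N) * (Nat.card (Abelian.Ext S.X₁ N 2)) * h1
    + zInv (hU.edgeExt c S.X₃ N) * zInv ((Abelian.Ext.mk₀ S.g).precomp N (zero_add 0)) * hc'

/-- Torsion in the second argument has no effect when the first is free: its Ext⁰ and Ext¹ have the
same order and its Ext² vanishes. -/
theorem edgeExt_of_free_right (c : R) {M : C} [Module.Free R (U.obj M)] {S : ShortComplex C}
    (hS : S.ShortExact) {a : R} (ha : a ≠ 0) (h : ∀ x : U.obj S.X₁, a • x = 0)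
    (hz : ZDefined (hU.edgeExt c M S.X₃)) :
    ZDefined (hU.edgeExt c M S.X₂) ∧
      zInv (hU.edgeExt c M S.X₂) = zInv (hU.edgeExt c M S.X₃) := by
  have := hfin a ha
  obtain ⟨_, _, hc⟩ := hU.card_ext_of_free_of_torsion hσ hσ' (M := M) h
  have : Subsingleton (Abelian.Ext M S.X₁ 2) := hU.subsingleton_ext_of_free M S.X₁ 0
  have := hS.mono_f
  have i0 := Abelian.Ext.postcomp_mk₀_injective_of_mono M S.f
  have e0 := exact_postcomp hS M 0
  have e1 := exact_postcomp_extClass hS M 0 1 rfl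
  have e2 := exact_extClass_postcomp hS M 0 1 rfl
  have e3 := exact_postcomp hS M 1
  have e4 := exact_postcomp_extClass hS M 1 2 rfl
  have s1 : Function.Surjective (hS.extClass.postcomp M (rfl : 1 + 1 = 2)) := fun x =>
    ⟨0, Subsingleton.elim _ _⟩
  obtain ⟨z0, z1⟩ := zDefined_of_longExact i0 e0 e1 e2 e3 e4 s1
  have h1 := card_mul_card_mul_zInv i0 e0 e1 e2 e3 e4 s1 z0 z1
  have sq := hU.edgeExt_comp_postcomp c (M := M) S.g
  refine ⟨ZDefined.of_square sq hz z0 z1, ?_⟩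
  have h2 := zInv_square sq z0 z1 hz
  have := Nat.card_pos (α := Abelian.Ext M S.X₁ 1)
  have c1 : (Nat.card (Abelian.Ext M S.X₁ 1) : ℚ) ≠ 0 := by positivity
  rw [hc, Nat.card_unique (α := Abelian.Ext M S.X₁ 2), Nat.cast_one, mul_one] at h1
  rw [← mul_left_cancel₀ c1 h1] at h2
  exact mul_right_cancel₀ z1.ne_zero h2

/-- Reduction of the Euler characteristic of the edge map to the free quotients. -/
theorem edgeHom_of_free (c : R) (M N : C) : ∃ (M' N' : C) (q : M ⟶ M') (q' : N ⟶ N'),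
    (Module.Free R (U.obj M') ∧ Function.Surjective (U.map q).hom ∧
      ∀ x, (U.map q).hom x = 0 → ∃ a : R, a ≠ 0 ∧ a • x = 0) ∧
    (Module.Free R (U.obj N') ∧ Function.Surjective (U.map q').hom ∧
      ∀ x, (U.map q').hom x = 0 → ∃ a : R, a ≠ 0 ∧ a • x = 0) ∧
    Finite (Abelian.Ext M N 2) ∧ (ZDefined (hU.edgeHom c M' N') →
      ZDefined (hU.edgeHom c M N) ∧
      zInv (hU.edgeHom c M N) * Nat.card (Abelian.Ext M N 2) = zInv (hU.edgeHom c M' N')) := by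
  obtain ⟨S, hS, rfl, h1, a, ha, h2⟩ := hU.exists_torsion_sequence M
  obtain ⟨S', hS', rfl, h1', a', ha', h2'⟩ := hU.exists_torsion_sequence N
  obtain ⟨hf, h3⟩ := hU.edgeExt_of_free_left hσ hσ' hfin c (N := S'.X₂) hS ha h2
  have h3' := hU.edgeExt_of_free_right hσ hσ' hfin c (M := S.X₃) hS' ha' h2'
  have ker : ∀ {S : ShortComplex C} (_ : S.ShortExact) {a : R} (_ : a ≠ 0)
      (_ : ∀ x : U.obj S.X₁, a • x = 0) (x), (U.map S.g).hom x = 0 → ∃ a : R, a ≠ 0 ∧ a • x = 0 := by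
    intro S hS a ha h x hx
    obtain ⟨y, rfl⟩ := (hS.exact_map U x).1 hx
    exact ⟨a, ha, by rw [← map_smul, h, map_zero]⟩
  refine ⟨S.X₃, S'.X₃, S.g, S'.g, ⟨h1, hS.surjective_map U, ker hS ha h2⟩,
    ⟨h1', hS'.surjective_map U, ker hS' ha' h2'⟩, hf, fun hz => ?_⟩
  obtain ⟨z1, e1⟩ := h3' (hU.zDefined_edgeExt.2 hz)
  obtain ⟨z2, e2⟩ := h3 z1
  exact ⟨hU.zDefined_edgeExt.1 z2, by rw [← zInv_edgeExt, e2, e1, zInv_edgeExt]⟩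

end IsSemilinearCat

end Semilinear

/-! ### Indices, determinants and limits for lattices over `ℤ_l` -/

section Lattice

variable {l : ℕ} [Fact l.Prime]

theorem PadicInt.card_quotient_span {a : ℤ_[l]} (ha : a ≠ 0) :
    Finite (ℤ_[l] ⧸ Ideal.span {a}) ∧ (Nat.card (ℤ_[l] ⧸ Ideal.span {a}) : ℝ) = ‖a‖⁻¹ := by
  have h1 : Ideal.span {a} = RingHom.ker (PadicInt.toZModPow (p := l) a.valuation) := by
    rw [PadicInt.ker_toZModPow, Ideal.span_singleton_eq_span_singleton]
    exact ⟨(PadicInt.unitCoeff ha)⁻¹, by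
      nth_rw 1 [PadicInt.unitCoeff_spec ha]
      rw [mul_comm, ← mul_assoc, Units.inv_mul, one_mul]⟩
  have e := (Ideal.quotEquivOfEq h1).trans
    (RingHom.quotientKerEquivOfSurjective (ZMod.ringHom_surjective (PadicInt.toZModPow (p := l) a.valuation)))
  have : NeZero (l ^ a.valuation) := ⟨pow_ne_zero _ (Nat.Prime.ne_zero Fact.out)⟩
  refine ⟨Finite.of_equiv _ e.symm.toEquiv, ?_⟩
  rw [Nat.card_congr e.toEquiv, Nat.card_zmod, PadicInt.norm_eq_zpow_neg_valuation ha, zpow_neg,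
    inv_inv, Nat.cast_pow, zpow_natCast]

variable {D : Type*} [AddCommGroup D] [Module ℤ_[l] D] [Module.Finite ℤ_[l] D] [Module.Free ℤ_[l] D]

/-- In bases adapted by the Smith normal form, `h` becomes diagonal up to an automorphism, whose
determinant is a unit; the index is then a product over the diagonal entries. -/
theorem card_quotient_range {h : D →ₗ[ℤ_[l]] D} (hh : Function.Injective h) :
    Finite (D ⧸ LinearMap.range h) ∧ LinearMap.det h ≠ 0 ∧
      (Nat.card (D ⧸ LinearMap.range h) : ℝ) = ‖LinearMap.det h‖⁻¹ := by
  classical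
  let e := LinearEquiv.ofInjective h hh
  have hr : Module.finrank ℤ_[l] (LinearMap.range h) = Module.finrank ℤ_[l] D := e.symm.finrank_eq
  let b := Module.Free.chooseBasis ℤ_[l] D
  let a := Submodule.smithNormalFormCoeffs b hr
  have ha : ∀ i, a i ≠ 0 := Submodule.smithNormalFormCoeffs_ne_zero b hr
  let b' := Submodule.smithNormalFormTopBasis b hr
  let c := Submodule.smithNormalFormBotBasis b hr
  have hc : ∀ i, (c i : D) = a i • b' i := Submodule.smithNormalFormBotBasis_def b hr
  let φ : D ≃ₗ[ℤ_[l]] D := (b'.equiv c (Equiv.refl _)).trans e.symm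
  have hφ : ∀ i, (h ∘ₗ φ.toLinearMap) (b' i) = a i • b' i := fun i => by
    have h1 : (e (e.symm (c i)) : D) = h (e.symm (c i)) := rfl
    rw [← hc, ← e.apply_symm_apply (c i), h1]
    simp [φ]
  have hdet : LinearMap.det h * LinearMap.det φ.toLinearMap = ∏ i, a i := by
    rw [← LinearMap.det_comp, ← LinearMap.det_toMatrix b']
    have : LinearMap.toMatrix b' b' (h ∘ₗ φ.toLinearMap) = Matrix.diagonal a := by
      ext i j
      rw [LinearMap.toMatrix_apply, hφ, map_smul, b'.repr_self, Finsupp.smul_single, smul_eq_mul,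
        mul_one, Matrix.diagonal_apply, Finsupp.single_apply]
      simp only [eq_comm (a := i)]
      split_ifs with hij
      · rw [hij]
      · rfl
    rw [this, Matrix.det_diagonal]
  have hu : ‖LinearMap.det φ.toLinearMap‖ = 1 :=
    PadicInt.isUnit_iff.1 (by rw [← LinearEquiv.coe_det]; exact Units.isUnit _)
  have hn : ‖LinearMap.det h‖ = ∏ i, ‖a i‖ := by
    rw [← mul_one ‖LinearMap.det h‖, ← hu, ← norm_mul, hdet, norm_prod]
  have f := (LinearMap.range h).quotientEquivPiSpan b hr
  have := fun i => (PadicInt.card_quotient_span (ha i)).1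
  refine ⟨Finite.of_equiv _ f.symm.toEquiv, fun h0 => ?_, ?_⟩
  · rw [h0, norm_zero, eq_comm, Finset.prod_eq_zero_iff] at hn
    obtain ⟨i, -, hi⟩ := hn
    exact ha i (norm_eq_zero.1 hi)
  · rw [Nat.card_congr f.toEquiv, Nat.card_pi, Nat.cast_prod, hn, ← Finset.prod_inv_distrib]
    exact Finset.prod_congr rfl fun i _ => (PadicInt.card_quotient_span (ha i)).2

theorem zDefined_of_injective {h : D →ₗ[ℤ_[l]] D} (hh : Function.Injective h) :
    ZDefined h.toAddMonoidHom ∧ (zInv h.toAddMonoidHom : ℝ) = ‖LinearMap.det h‖ := by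
  obtain ⟨h1, -, h2⟩ := card_quotient_range hh
  have hk : h.toAddMonoidHom.ker = ⊥ := (AddMonoidHom.ker_eq_bot_iff _).2 hh
  refine ⟨⟨?_, h1⟩, ?_⟩
  · rw [hk]
    infer_instance
  · unfold zInv
    rw [hk]
    have h3 : (Nat.card (D ⧸ h.toAddMonoidHom.range) : ℝ) = ‖LinearMap.det h‖⁻¹ := h2
    push_cast
    rw [h3]
    simp

theorem tendsto_pow_prime : Filter.Tendsto (fun k : ℕ => (l : ℤ_[l]) ^ k) Filter.atTop (nhds 0) :=
  tendsto_pow_atTop_nhds_zero_of_norm_lt_one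
    (by rw [PadicInt.norm_p]; exact inv_lt_one_of_one_lt₀ (by exact_mod_cast (Fact.out : l.Prime).one_lt))

theorem continuous_det_add_smul (f g : D →ₗ[ℤ_[l]] D) :
    Continuous fun x : ℤ_[l] => LinearMap.det (f + x • g) := by
  classical
  let b := Module.Free.chooseBasis ℤ_[l] D
  simp only [← LinearMap.det_toMatrix b, map_add, map_smul]
  fun_prop

/-- The image of `d` is projective, being a submodule of a free module over a principal ideal
domain. So `d` splits over its image and `e` is a projection onto its kernel. -/
theorem exists_isCompl_ker (d : D →ₗ[ℤ_[l]] D) : ∃ e : D →ₗ[ℤ_[l]] D,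
    (∀ x, d (e x) = 0) ∧ ∀ x, d x = 0 → e x = x := by
  obtain ⟨s, hs⟩ := Module.projective_lifting_property d.rangeRestrict LinearMap.id
    d.surjective_rangeRestrict
  have hs' : ∀ y, d (s y) = y := fun y => congrArg Subtype.val (LinearMap.congr_fun hs y)
  refine ⟨LinearMap.id - s ∘ₗ d.rangeRestrict, fun x => ?_, fun x hx => ?_⟩
  · simp [hs']
  · have : d.rangeRestrict x = 0 := Subtype.ext hx
    simp [this]

theorem det_id_sub_add_smul (d e : D →ₗ[ℤ_[l]] D) (h1 : ∀ x, d (e x) = 0)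
    (h2 : ∀ x, d x = 0 → e x = x) (x : ℤ_[l]) :
    LinearMap.det (LinearMap.id - e + x • e) = x ^ Module.finrank ℤ_[l] (LinearMap.ker d) := by
  have hp : LinearMap.IsProj (LinearMap.ker d) e := ⟨h1, h2⟩
  have hc := hp.isCompl
  have := Module.Finite.of_injective (LinearMap.ker e).subtype Subtype.val_injective
  let f := Submodule.prodEquivOfIsCompl _ _ hc
  rw [← LinearMap.det_conj _ (f.symm : D ≃ₗ[ℤ_[l]] _)]
  have : f.symm.toLinearMap ∘ₗ (LinearMap.id - e + x • e) ∘ₗ f.symm.symm.toLinearMap =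
      LinearMap.prodMap (x • LinearMap.id) LinearMap.id := by
    rw [← LinearMap.cancel_left f.injective (f := f.toLinearMap)]
    ext y
    · have := h2 y.1 y.2
      simp [f, this]
    · have : e y.1 = 0 := y.2
      simp [f, this]
  rw [this, LinearMap.det_prodMap]
  simp

/-- If the kernel of `d` meets the preimage under `ρ` of the saturation of the image of `d` trivially,
then the map `ker d → coker d` induced by `ρ` is computed by the determinants of `d - x ρ`. -/
theorem tendsto_det_sub_smul (d ρ : D →ₗ[ℤ_[l]] D) (H : ∀ u v : D, d u = 0 → ρ u = d v → u = 0)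
    (g : d.toAddMonoidHom.ker →+ D ⧸ d.toAddMonoidHom.range)
    (hg : ∀ u, g u = QuotientAddGroup.mk (ρ u)) :
    ZDefined g ∧ Filter.Tendsto (fun k : ℕ => ‖LinearMap.det (d - (l : ℤ_[l]) ^ k • ρ)‖ *
      ((l : ℝ) ^ k) ^ Module.finrank ℤ_[l] (LinearMap.ker d)) Filter.atTop (nhds (zInv g : ℝ)) := by
  obtain ⟨e, he, he'⟩ := exists_isCompl_ker d
  -- Here `h 0 = d + ρ e` replaces the zero map on `ker d` by `ρ`; the term in `x` is chosen so that
  -- `h x` divides `d - x ρ`.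
  let h (x : ℤ_[l]) : D →ₗ[ℤ_[l]] D := (d + ρ ∘ₗ e) + x • (ρ ∘ₗ (e - LinearMap.id))
  have hinj : Function.Injective (h 0) := (injective_iff_map_eq_zero _).2 fun v hv => by
    simp only [h, zero_smul, add_zero, LinearMap.add_apply, LinearMap.comp_apply] at hv
    have h1 := H (e v) (-v) (he v) (by rw [map_neg]; exact eq_neg_of_add_eq_zero_right hv)
    rw [h1, map_zero, add_zero] at hv
    rw [← he' v hv, h1]
  obtain ⟨h1, h2, h3⟩ := card_quotient_range hinj
  have hk : g.ker = ⊥ := by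
    rw [AddMonoidHom.ker_eq_bot_iff, injective_iff_map_eq_zero]
    intro u hu
    rw [hg, mk_eq_zero_iff_mem_range] at hu
    obtain ⟨v, hv⟩ := hu
    exact Subtype.ext (H u v u.2 hv.symm)
  -- The image of `h 0` is `d(D) + ρ(ker d)`, so its cokernel is that of `g`.
  have hc : (LinearMap.range (h 0)).toAddSubgroup =
      (((QuotientAddGroup.mk' g.range).comp (QuotientAddGroup.mk' d.toAddMonoidHom.range))).ker := by
    ext y
    rw [AddMonoidHom.mem_ker, AddMonoidHom.comp_apply, QuotientAddGroup.mk'_apply,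
      mk_eq_zero_iff_mem_range]
    constructor
    · rintro ⟨v, rfl⟩
      refine ⟨⟨e v, he v⟩, ?_⟩
      rw [hg, QuotientAddGroup.mk'_apply, QuotientAddGroup.eq]
      exact ⟨v, by simp [h]⟩
    · rintro ⟨u, hu⟩
      rw [hg, QuotientAddGroup.mk'_apply, QuotientAddGroup.eq] at hu
      obtain ⟨v, hv⟩ := hu
      have hv' : d v = -ρ u + y := hv
      have hu' : d u = 0 := u.2
      refine ⟨v - e v + u, ?_⟩
      simp [h, he, he' _ hu', he' _ (he v), hv', hu']
  have hcard : Nat.card ((D ⧸ d.toAddMonoidHom.range) ⧸ g.range) =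
      Nat.card (D ⧸ LinearMap.range (h 0)) := by
    refine (Nat.card_congr ((QuotientAddGroup.quotientAddEquivOfEq hc).trans
      (QuotientAddGroup.quotientKerEquivOfSurjective _ ?_)).toEquiv).symm
    exact (QuotientAddGroup.mk'_surjective _).comp (QuotientAddGroup.mk'_surjective _)
  have hz : (zInv g : ℝ) = ‖LinearMap.det (h 0)‖ := by
    unfold zInv
    rw [hk, hcard]
    push_cast
    rw [h3]
    simp
  -- Since `d e = 0` and `e² = e`, one has `d - x ρ = h x ∘ (1 - e - x e)`, and the last factor is
  -- `-x` on `ker d` and 1 on its complement.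
  have hfac (x : ℤ_[l]) : LinearMap.det (d - x • ρ) =
      LinearMap.det (h x) * (-x) ^ Module.finrank ℤ_[l] (LinearMap.ker d) := by
    rw [← det_id_sub_add_smul d e he he', ← LinearMap.det_comp]
    congr 1
    ext y
    simp [h, he, he' _ (he y)]
    module
  refine ⟨⟨?_, ?_⟩, ?_⟩
  · rw [hk]
    infer_instance
  · exact Nat.finite_of_card_ne_zero (by rw [hcard]; exact Nat.card_pos.ne')
  · have hl : ∀ k : ℕ, ‖LinearMap.det (d - (l : ℤ_[l]) ^ k • ρ)‖ *
        ((l : ℝ) ^ k) ^ Module.finrank ℤ_[l] (LinearMap.ker d) =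
        ‖LinearMap.det (h ((l : ℤ_[l]) ^ k))‖ := fun k => by
      have hl0 : (l : ℝ) ≠ 0 := by exact_mod_cast (Fact.out : l.Prime).ne_zero
      rw [hfac, norm_mul, norm_pow, norm_neg, norm_pow, PadicInt.norm_p, mul_assoc, ← mul_pow,
        ← mul_pow, inv_mul_cancel₀ hl0, one_pow, one_pow, mul_one]
    simp only [hl]
    rw [hz]
    exact ((continuous_det_add_smul _ _).norm.tendsto 0).comp tendsto_pow_prime

end Lattice

/-! ### Cyclic determinants and block determinants -/

section Determinants

/-- The first row has only two nonzero entries, in the first and last columns; their minors are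
lower and upper triangular. -/
theorem Matrix.det_cyclic {S : Type*} [CommRing S] (x y : S) (n : ℕ) :
    (Matrix.of fun i j : Fin (n + 1) => (if i = j + 1 then x else 0) - if i = j then y else 0).det =
      (-1) ^ n * (x ^ (n + 1) - y ^ (n + 1)) := by
  rcases n with _ | n
  · simp
  have h0 : ∀ j : Fin (n + 1 + 1), (0 = j + 1) ↔ j = Fin.last _ := fun j => by
    rw [eq_comm, ← Fin.last_add_one, add_left_inj]
  have hd : ∀ j : Fin (n + 1 + 1), j ≠ j + 1 := fun j => by simp
  rw [Matrix.det_succ_row_zero, Fin.sum_univ_succ, Fin.sum_univ_castSucc]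
  rw [Finset.sum_eq_zero fun i _ => ?_]
  · have e1 : ((Matrix.of fun i j : Fin (n + 1 + 1) =>
        (if i = j + 1 then x else 0) - if i = j then y else 0).submatrix Fin.succ
          (Fin.succAbove 0)).det = (-y) ^ (n + 1) := by
      rw [Matrix.det_of_isLowerTriangular]
      · simp [hd]
      · intro i j hij
        have hij : i < j := hij
        have h1 : i.succ ≠ j.succ + 1 := by
          rcases eq_or_ne j (Fin.last _) with rfl | hj
          · rw [Fin.succ_last, Fin.last_add_one]
            exact Fin.succ_ne_zero _
          · obtain ⟨j, rfl⟩ := Fin.exists_castSucc_eq.2 hj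
            rw [Fin.succ_castSucc, Fin.coeSucc_eq_succ, Ne, Fin.succ_inj]
            exact (hij.trans (Fin.castSucc_lt_succ)).ne
        simp [h1, hij.ne]
    have e2 : ((Matrix.of fun i j : Fin (n + 1 + 1) =>
        (if i = j + 1 then x else 0) - if i = j then y else 0).submatrix Fin.succ
          (Fin.succAbove (Fin.last n).succ)).det = x ^ (n + 1) := by
      rw [Matrix.det_of_isUpperTriangular]
      · simp [Fin.ext_iff]
      · intro i j hij
        have hij : j < i := hij
        have h1 : i.succ ≠ j.castSucc := fun h => by
          have := congrArg Fin.val h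
          simp only [Fin.val_succ, Fin.val_castSucc] at this
          omega
        simp [h1, hij.ne']
    rw [e1, e2]
    simp [Fin.ext_iff]
    ring
  · have h1 : (i.castSucc.succ : Fin (n + 1 + 1)) ≠ Fin.last _ := by
      rw [← Fin.succ_last, Ne, Fin.succ_inj]
      exact Fin.castSucc_ne_last i
    simp [h0, h1, (Fin.succ_ne_zero _).symm]

variable {K V : Type*} [Field K] [AddCommGroup V] [Module K V] [FiniteDimensional K V]

/-- The blocks of `T` are polynomials in the single endomorphism `τ`, hence commute, and the
determinant may be taken first over `K[X]` and then on `V`. -/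
theorem LinearMap.det_aeval_matrix {ι : Type*} [Fintype ι] [DecidableEq ι] (τ : V →ₗ[K] V)
    (M : Matrix ι ι K[X]) (T : (ι → V) →ₗ[K] (ι → V))
    (hT : ∀ v i, T v i = ∑ j, aeval τ (M i j) (v j)) :
    LinearMap.det T = LinearMap.det (aeval τ M.det) := by
  classical
  let b := Module.finBasis K V
  let B := (Pi.basis (fun _ : ι => b)).reindex (Equiv.sigmaEquivProd _ _)
  let f : K[X] →+* Matrix _ _ K := ((LinearMap.toMatrixAlgEquiv b).toAlgHom.comp (aeval τ)).toRingHom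
  have h1 := Matrix.det_det M f
  rw [← LinearMap.det_toMatrix B, ← LinearMap.det_toMatrix b]
  refine Eq.trans ?_ h1.symm
  congr 1
  ext ⟨i, k⟩ ⟨j, k'⟩
  rw [LinearMap.toMatrix_apply]
  simp only [B, Module.Basis.reindex_apply, Module.Basis.repr_reindex, Finsupp.mapDomain_equiv_apply,
    Equiv.sigmaEquivProd_symm_apply, Pi.basis_repr, hT, Pi.basis_apply]
  rw [Finset.sum_eq_single j (fun j' _ hj => by rw [Pi.single_eq_of_ne hj, map_zero]) (by simp),
    Pi.single_eq_same]
  simp only [Matrix.comp_apply]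
  exact (LinearMap.toMatrixAlgEquiv_apply _ _ _ _).symm

end Determinants

/-! ### Determinants of Sylvester operators -/

section Sylvester

variable {E : Type*} [Field E] [IsAlgClosed E] {m n : Type*} [Fintype m] [DecidableEq m]
  [Fintype n] [DecidableEq n]

theorem Matrix.card_roots_charpoly (A : Matrix m m E) :
    Multiset.card A.charpoly.roots = Fintype.card m := by
  rw [← (IsAlgClosed.splits A.charpoly).natDegree_eq_card_roots, Matrix.charpoly_natDegree_eq_dim]

theorem Matrix.det_add_scalar (A : Matrix m m E) (c : E) :
    (A + Matrix.scalar m c).det = (A.charpoly.roots.map fun a => a + c).prod := by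
  have h1 : A.charpoly.eval (-c) = (A.charpoly.roots.map fun a => -c - a).prod := by
    conv_lhs => rw [(IsAlgClosed.splits A.charpoly).eq_prod_roots_of_monic A.charpoly_monic]
    rw [eval_multiset_prod, Multiset.map_map]
    simp
  rw [Matrix.eval_charpoly] at h1
  have h2 : A + Matrix.scalar m c = -(Matrix.scalar m (-c) - A) := by
    rw [map_neg]
    abel
  rw [h2, Matrix.det_neg, h1, ← Matrix.card_roots_charpoly A, ← Multiset.card_map (fun a => -c - a)
    A.charpoly.roots, ← Multiset.prod_map_neg, Multiset.map_map]
  congr 1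
  refine Multiset.map_congr rfl fun a _ => ?_
  simp

/-- Both sides are multiplicative in `Q`, which splits into constants and linear factors. -/
theorem Matrix.det_aeval (A : Matrix m m E) (Q : E[X]) :
    (aeval A Q).det = (A.charpoly.roots.map fun a => Q.eval a).prod := by
  have hQ := IsAlgClosed.splits Q
  induction hQ using Submonoid.closure_induction with
  | mem x hx =>
    rcases hx with ⟨c, rfl⟩ | ⟨c, rfl⟩
    · simp [Matrix.algebraMap_eq_diagonal, Matrix.card_roots_charpoly]
    · have h : aeval A (X + C c) = A + Matrix.scalar m c := by
        rw [map_add, aeval_X, aeval_C]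
        rfl
      simpa [h] using A.det_add_scalar c
  | one => simp
  | mul x y _ _ hx hy => simp [hx, hy, Multiset.prod_map_mul]

variable {K : Type*} [Field K] (j : K →+* E)

/-- On the rows of `S`, right multiplication by `A` is the single endomorphism given by the
transpose of `A`. So `T` is the polynomial matrix `B - y X` evaluated there, and its determinant, a
polynomial in `X`, is evaluated at the eigenvalues of `A`. -/
theorem Matrix.det_sylvester (A : Matrix m m K) (B : Matrix n n K) (y : K)
    (T : Matrix n m K →ₗ[K] Matrix n m K) (hT : ∀ S, T S = B * S - y • (S * A)) :
    j (LinearMap.det T) = ((A.map j).charpoly.roots.map fun a =>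
      ((B.map j).charpoly.roots.map fun b => b - j y * a).prod).prod := by
  let τ : (m → K) →ₗ[K] (m → K) := Matrix.toLin' A.transpose
  let M : Matrix n n K[X] := B.map C - Matrix.scalar n (C y * X)
  have h1 : LinearMap.det T = LinearMap.det (aeval τ M.det) := by
    refine LinearMap.det_aeval_matrix τ M T fun S i => ?_
    have h2 : ∀ k, aeval τ (M i k) (S k) = B i k • S k - if i = k then y • Matrix.vecMul (S k) A else 0 := by
      intro k
      simp only [M, Matrix.sub_apply, Matrix.map_apply, Matrix.scalar_apply, Matrix.diagonal_apply]
      split_ifs <;> simp [τ, Module.algebraMap_end_apply, Matrix.mulVec_transpose]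
    rw [Finset.sum_congr rfl fun k _ => h2 k, Finset.sum_sub_distrib, Finset.sum_ite_eq,
      if_pos (Finset.mem_univ i)]
    refine (congrFun (hT S) i).trans ?_
    ext x
    simp only [Matrix.sub_apply, Matrix.smul_apply, Pi.sub_apply, Finset.sum_apply, Pi.smul_apply]
    rfl
  have h3 : aeval τ M.det = Matrix.toLinAlgEquiv' (aeval A.transpose M.det) := by
    rw [← AlgEquiv.coe_toAlgHom, ← Polynomial.aeval_algHom_apply]
    rfl
  have h4 : j (aeval A.transpose M.det).det = (aeval (A.transpose.map j) (M.det.map j)).det := by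
    rw [RingHom.map_det]
    congr 1
    rw [aeval_def, aeval_def, Polynomial.eval₂_map, Polynomial.hom_eval₂]
    congr 1
    ext c : 1
    ext a b
    rw [RingHom.comp_apply, RingHom.comp_apply, RingHom.mapMatrix_apply, Matrix.map_apply,
      Matrix.algebraMap_matrix_apply, Matrix.algebraMap_matrix_apply]
    split_ifs <;> simp
  rw [h1, h3]
  have h5 : LinearMap.det (Matrix.toLinAlgEquiv' (aeval A.transpose M.det)) =
    (aeval A.transpose M.det).det := LinearMap.det_toLin' _
  rw [h5, h4, Matrix.det_aeval, Matrix.transpose_map, Matrix.charpoly_transpose]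
  congr 1
  refine Multiset.map_congr rfl fun a _ => ?_
  have h6 : eval a (M.det.map j) = (B.map j + Matrix.scalar n (-(j y * a))).det := by
    rw [← coe_mapRingHom, RingHom.map_det, ← coe_evalRingHom, RingHom.map_det]
    congr 1
    ext i k
    simp only [M, RingHom.mapMatrix_apply, Matrix.map_apply, Matrix.sub_apply, Matrix.add_apply,
      Matrix.scalar_apply, Matrix.diagonal_apply]
    split_ifs <;> simp [sub_eq_add_neg]
  rw [h6, Matrix.det_add_scalar]
  simp only [sub_eq_add_neg]

end Sylvester

/-! ### Determinants of semilinear maps -/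

section SemilinearDet

variable {K₀ K : Type*} [Field K₀] [Field K] [Algebra K₀ K] (σ : K →ₐ[K₀] K)

/-- A linear relation between the rows would be a linear relation between the distinct characters `σ
^ i`, contradicting Dedekind's independence theorem. -/
theorem isUnit_matrix_pow_basis {a : ℕ} (hσ : Function.Injective fun i : Fin a => σ ^ (i : ℕ))
    (ω : Module.Basis (Fin a) K₀ K) :
    IsUnit (Matrix.of fun i j : Fin a => (σ ^ (i : ℕ)) (ω j)) := by
  rw [← Matrix.linearIndependent_rows_iff_isUnit, Fintype.linearIndependent_iff]
  intro g hg
  have h0 : ∑ i : Fin a, LinearMap.mulLeft K₀ (g i) ∘ₗ (σ ^ (i : ℕ)).toLinearMap = 0 :=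
    ω.ext fun j => by simpa using congrFun hg j
  have h1 : ∀ x : K, ∑ i : Fin a, g i * (σ ^ (i : ℕ)) x = 0 := fun x => by
    simpa using LinearMap.congr_fun h0 x
  have h2 := (linearIndependent_monoidHom K K).comp
    (fun i : Fin a => ((σ ^ (i : ℕ) : K →ₐ[K₀] K) : K →* K)) fun i j hij => hσ (AlgHom.ext fun x =>
      DFunLike.congr_fun hij x)
  rw [Fintype.linearIndependent_iff] at h2
  refine h2 g (funext fun x => ?_)
  simpa using h1 x

variable {V : Type*} [AddCommGroup V] [Module K₀ V] [Module K V] [IsScalarTower K₀ K V]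
  [FiniteDimensional K₀ V]

/-- The determinant of `τ - y` for a `σ`-linear map `τ`, where `σ` generates a group of order equal
to the degree of the field. -/
theorem LinearMap.det_sub_pow {n : ℕ}
    (hσ : Function.Injective fun i : Fin (n + 1) => σ ^ (i : ℕ)) (hσ' : σ ^ (n + 1) = 1)
    (ω : Module.Basis (Fin (n + 1)) K₀ K) (τ : V →ₗ[K₀] V)
    (hτ : ∀ (c : K) (v : V), τ (c • v) = σ c • τ v) (y : K₀) :
    LinearMap.det (τ - y • 1) ^ (n + 1) =
      ((-1) ^ n) ^ Module.finrank K₀ V * LinearMap.det (τ ^ (n + 1) - y ^ (n + 1) • 1) := by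
  set Ω := Matrix.of fun i j : Fin (n + 1) => (σ ^ (i : ℕ)) (ω j) with hΩ
  have hu := isUnit_matrix_pow_basis σ hσ ω
  have hu1 : Ω * Ω⁻¹ = 1 := Matrix.mul_nonsing_inv _ ((Matrix.isUnit_iff_isUnit_det _).1 hu)
  have hu2 : Ω⁻¹ * Ω = 1 := Matrix.nonsing_inv_mul _ ((Matrix.isUnit_iff_isUnit_det _).1 hu)
  let act (P : Matrix (Fin (n + 1)) (Fin (n + 1)) K) : (Fin (n + 1) → V) →ₗ[K₀] (Fin (n + 1) → V) :=
    { toFun v i := ∑ j, P i j • v j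
      map_add' v w := by
        ext i
        simp [Finset.sum_add_distrib]
      map_smul' c v := by
        ext i
        simp only [Pi.smul_apply, RingHom.id_apply, Finset.smul_sum]
        exact Finset.sum_congr rfl fun j _ => smul_comm _ _ _ }
  have hact : ∀ P Q v, act P (act Q v) = act (P * Q) v := fun P Q v => by
    ext i
    simp only [act, LinearMap.coe_mk, AddHom.coe_mk, Finset.smul_sum, Matrix.mul_apply,
      Finset.sum_smul, mul_smul]
    exact Finset.sum_comm
  have hone : ∀ v, act 1 v = v := fun v => by
    ext i
    simp [act, Matrix.one_apply]
  let G : (Fin (n + 1) → V) ≃ₗ[K₀] (Fin (n + 1) → V) :=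
    LinearEquiv.ofLinearMap (act Ω) (act Ω⁻¹) (LinearMap.ext fun v => by simp [hact, hu1, hone])
      (LinearMap.ext fun v => by simp [hact, hu2, hone])
  let T₁ : (Fin (n + 1) → V) →ₗ[K₀] (Fin (n + 1) → V) :=
    LinearMap.pi fun i => (τ - y • 1).comp (LinearMap.proj i)
  -- The matrix `Ω` of the conjugates `σ ^ i (ω j)` conjugates the diagonal operator `T₁` to the
  -- cyclic operator `T₂`, because `τ (σ ^ (i - 1) (ω j) v) = σ ^ i (ω j) τ v`. Indices are cyclic,
  -- which uses `σ ^ (n + 1) = 1`. The cyclic determinant then brings in `τ ^ (n + 1)`.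
  let T₂ : (Fin (n + 1) → V) →ₗ[K₀] (Fin (n + 1) → V) :=
    LinearMap.pi fun i => τ.comp (LinearMap.proj (i - 1)) - y • LinearMap.proj i
  have hs : ∀ (i : Fin (n + 1)) (x : K), σ ((σ ^ ((i - 1 : Fin (n + 1)) : ℕ)) x) = (σ ^ (i : ℕ)) x := by
    intro i x
    have h1 : σ ((σ ^ ((i - 1 : Fin (n + 1)) : ℕ)) x) = (σ ^ (((i - 1 : Fin (n + 1)) : ℕ) + 1)) x := by
      rw [pow_succ']
      rfl
    rw [h1]
    congr 1
    obtain ⟨k, rfl⟩ : ∃ k, i = k + 1 := ⟨i - 1, (sub_add_cancel i 1).symm⟩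
    rw [add_sub_cancel_right, Fin.val_add_one]
    split_ifs with hk
    · rw [hk, Fin.val_last, hσ', pow_zero]
    · rfl
  have hG : G.toLinearMap ∘ₗ T₁ = T₂ ∘ₗ G.toLinearMap := by
    refine LinearMap.ext fun v => funext fun i => ?_
    change ∑ j, Ω i j • (τ (v j) - y • v j) =
      τ (∑ j, Ω (i - 1) j • v j) - y • ∑ j, Ω i j • v j
    rw [map_sum, Finset.smul_sum, ← Finset.sum_sub_distrib]
    refine Finset.sum_congr rfl fun j _ => ?_
    rw [hτ, hΩ, Matrix.of_apply, Matrix.of_apply, hs, smul_sub, smul_comm y]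
  have h1 : LinearMap.det T₁ = LinearMap.det (τ - y • 1) ^ (n + 1) := by
    rw [LinearMap.det_pi]
    simp
  have h2 : LinearMap.det T₂ = LinearMap.det T₁ := by
    rw [← LinearMap.det_conj T₁ G]
    congr 1
    rw [← LinearMap.comp_assoc, hG]
    refine LinearMap.ext fun v => ?_
    simp
  let M : Matrix (Fin (n + 1)) (Fin (n + 1)) K₀[X] :=
    Matrix.of fun i j => (if i = j + 1 then X else 0) - if i = j then C y else 0
  have h3 : LinearMap.det T₂ = LinearMap.det (aeval τ M.det) := by
    refine LinearMap.det_aeval_matrix τ M T₂ fun v i => ?_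
    have h4 : ∀ j, aeval τ (M i j) (v j) = (if j = i - 1 then τ (v j) else 0) -
        if j = i then y • v j else 0 := fun j => by
      simp only [M, Matrix.of_apply, eq_sub_iff_add_eq, @eq_comm _ i]
      split_ifs <;> simp [Module.algebraMap_end_apply]
    rw [Finset.sum_congr rfl fun j _ => h4 j, Finset.sum_sub_distrib]
    simp [T₂]
  rw [← h1, ← h2, h3, Matrix.det_cyclic, ← LinearMap.det_smul]
  congr 1
  have h5 : aeval τ (((-1) ^ n * (X ^ (n + 1) - (C y) ^ (n + 1)) : K₀[X])) =
      (-1) ^ n * (τ ^ (n + 1) - (algebraMap K₀ (Module.End K₀ V) y) ^ (n + 1)) := by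
    simp
  rw [h5, ← map_pow, Algebra.algebraMap_eq_smul_one]
  rcases Nat.even_or_odd n with h | h <;> simp [h.neg_one_pow]

end SemilinearDet

/-! ### Absolute values under embeddings into an algebraic closure of `ℚ_l` -/

section Norm

variable {l : ℕ} [Fact l.Prime] {K : Type*} [Field K] [Algebra ℚ_[l] K]

/-- The spectral norm depends only on the minimal polynomial, so every embedding induces the same
absolute value on `K`. -/
theorem norm_algHom_apply (j : K →ₐ[ℚ_[l]] PadicAlgCl l) (x : K) :
    ‖j x‖ = spectralNorm ℚ_[l] K x := by
  rw [← PadicAlgCl.spectralNorm_eq, spectralNorm, spectralNorm, minpoly.algHom_eq j j.injective]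

theorem norm_algHom_comp (j : K →ₐ[ℚ_[l]] PadicAlgCl l) (σ : K →ₐ[ℚ_[l]] K) (x : K) :
    ‖j (σ x)‖ = ‖j x‖ :=
  (norm_algHom_apply (j.comp σ) x).trans (norm_algHom_apply j x).symm

/-- The norm is the product over all embeddings, which give equal absolute values. -/
theorem norm_algebraNorm [FiniteDimensional ℚ_[l] K] (j : K →ₐ[ℚ_[l]] PadicAlgCl l) (x : K) :
    ‖Algebra.norm ℚ_[l] x‖ = ‖j x‖ ^ Module.finrank ℚ_[l] K := by
  rw [← PadicAlgCl.norm_extends, Algebra.norm_eq_prod_embeddings ℚ_[l] (PadicAlgCl l), norm_prod,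
    Finset.prod_congr rfl fun i _ => (norm_algHom_apply i x).trans (norm_algHom_apply j x).symm,
    Finset.prod_const, Finset.card_univ, AlgHom.card]

end Norm

/-! ### Matrices of powers of a semilinear map -/

section FrobMatrix

variable {K : Type*} [CommRing K] (σ : K →+* K) {m n : Type*} [Fintype m] [DecidableEq m]
  [Fintype n] [DecidableEq n]

/-- The matrix of the `k`-th power of the `σ`-linear map given by `Φ`. -/
def frobMatrix (Φ : Matrix m m K) : ℕ → Matrix m m K
  | 0 => 1
  | k + 1 => Φ * (frobMatrix Φ k).map σ

theorem frobMatrix_map {L : Type*} [CommRing L] (τ : L →+* L) (ι : K →+* L)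
    (h : ∀ x, ι (σ x) = τ (ι x)) (Φ : Matrix m m K) (k : ℕ) :
    (frobMatrix σ Φ k).map ι = frobMatrix τ (Φ.map ι) k := by
  induction k with
  | zero => exact Matrix.map_one _ (map_zero _) (map_one _)
  | succ k ih =>
    rw [frobMatrix, frobMatrix, ← ih, Matrix.map_mul, Matrix.map_map, Matrix.map_map]
    congr 2
    ext x
    exact h x

theorem det_frobMatrix_succ (Φ : Matrix m m K) (k : ℕ) :
    (frobMatrix σ Φ (k + 1)).det = Φ.det * σ (frobMatrix σ Φ k).det := by
  rw [frobMatrix, Matrix.det_mul, RingHom.map_det]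
  rfl

theorem isUnit_det_frobMatrix {Φ : Matrix m m K} (hΦ : IsUnit Φ.det) (k : ℕ) :
    IsUnit (frobMatrix σ Φ k).det := by
  induction k with
  | zero => simp [frobMatrix]
  | succ k ih => exact det_frobMatrix_succ σ Φ k ▸ hΦ.mul (ih.map σ)

/-- For `k` equal to the order of `σ` the iterate becomes linear in `S`, which brings Sylvester
operators into play. -/
theorem semilinear_iterate {Φ : Matrix m m K} {Ψ : Matrix n n K} (hΦ : IsUnit Φ.det)
    (k : ℕ) (S : Matrix n m K) :
    (fun S : Matrix n m K => Ψ * S.map σ * Φ⁻¹)^[k] S =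
      frobMatrix σ Ψ k * S.map (σ^[k]) * (frobMatrix σ Φ k)⁻¹ := by
  induction k with
  | zero => simp [frobMatrix]
  | succ k ih =>
    have h1 : ((frobMatrix σ Φ k)⁻¹).map σ = ((frobMatrix σ Φ k).map σ)⁻¹ := by
      refine (Matrix.inv_eq_right_inv ?_).symm
      rw [← Matrix.map_mul, Matrix.mul_nonsing_inv _ (isUnit_det_frobMatrix σ hΦ k)]
      exact Matrix.map_one _ (map_zero _) (map_one _)
    rw [Function.iterate_succ_apply', ih, Matrix.map_mul, Matrix.map_mul, h1, frobMatrix, frobMatrix,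
      Matrix.mul_inv_rev, Matrix.map_map, Function.iterate_succ']
    simp only [Matrix.mul_assoc]

end FrobMatrix

/-! ### Absolute value of the determinant of `S ↦ Ψ σ(S) - y S Φ` -/

section NormDet

theorem norm_prod_map {ι E : Type*} [NormedField E] (s : Multiset ι) (f : ι → E) :
    ‖(s.map f).prod‖ = (s.map fun i => ‖f i‖).prod := by
  have := map_multiset_prod (normHom (α := E)) (s.map f)
  rwa [Multiset.map_map] at this

variable {l : ℕ} [Fact l.Prime] {K : Type*} [Field K] [Algebra ℚ_[l] K]
  {m n : Type*} [Fintype m] [DecidableEq m] [Fintype n] [DecidableEq n]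

/-- This is the Sylvester operator with `B = 0` and `y = -1`. -/
theorem Matrix.det_mulRight {K : Type*} [Field K] (A : Matrix m m K)
    (T : Matrix n m K →ₗ[K] Matrix n m K) (hT : ∀ S, T S = S * A) :
    LinearMap.det T = A.det ^ Fintype.card n := by
  apply (algebraMap K (AlgebraicClosure K)).injective
  rw [Matrix.det_sylvester (algebraMap K (AlgebraicClosure K)) A 0 (-1) T fun S => by simp [hT],
    Matrix.map_zero _ (map_zero _), Matrix.charpoly_zero, roots_X_pow, map_pow, RingHom.map_det]
  simp only [Multiset.map_nsmul, Multiset.map_singleton, Multiset.prod_nsmul,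
    Multiset.prod_singleton, Multiset.prod_map_pow]
  congr 1
  rw [RingHom.mapMatrix_apply, Matrix.det_eq_prod_roots_charpoly]
  simp

variable [FiniteDimensional ℚ_[l] K] (σ : K →ₐ[ℚ_[l]] K) {N : ℕ}
  (hσ : Function.Injective fun i : Fin (N + 1) => σ ^ (i : ℕ)) (hσ' : σ ^ (N + 1) = 1)
  (ω : Module.Basis (Fin (N + 1)) ℚ_[l] K) (j : K →ₐ[ℚ_[l]] PadicAlgCl l)

include ω

theorem norm_det_of_restrictScalars (T : Matrix n m K →ₗ[K] Matrix n m K)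
    (T' : Matrix n m K →ₗ[ℚ_[l]] Matrix n m K) (h : ∀ S, T' S = T S) :
    ‖LinearMap.det T'‖ = ‖j (LinearMap.det T)‖ ^ (N + 1) := by
  rw [show T' = T.restrictScalars ℚ_[l] from LinearMap.ext h, LinearMap.det_restrictScalars,
    norm_algebraNorm j, Module.finrank_eq_card_basis ω, Fintype.card_fin]

theorem norm_det_frobMatrix (Φ : Matrix m m K) (k : ℕ) :
    ‖j (frobMatrix (σ : K →+* K) Φ k).det‖ = ‖j Φ.det‖ ^ k := by
  induction k with
  | zero => simp [frobMatrix]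
  | succ k ih =>
    rw [det_frobMatrix_succ, map_mul, norm_mul, RingHom.coe_coe, norm_algHom_comp, ih, pow_succ']

include hσ hσ'

/-- Factor `T` as right multiplication by `Φ` after `τ - y`, with `τ S = Ψ σ(S) Φ⁻¹`. Up to sign the
power `det(τ - y) ^ (N + 1)` is the `ℚ_l`-determinant of the `K`-linear map `S ↦ B S A⁻¹ - y ^ (N +
1) S`. The latter is a norm from `K`, so its absolute value is itself an `(N + 1)`-th power. -/
theorem norm_det_semilinear {Φ : Matrix m m K} {Ψ : Matrix n n K} (hΦ : IsUnit Φ.det) (y : ℚ_[l])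
    (T : Matrix n m K →ₗ[ℚ_[l]] Matrix n m K)
    (hT : ∀ S, T S = Ψ * S.map σ - y • (S * Φ)) :
    ‖LinearMap.det T‖ = ‖j (frobMatrix (σ : K →+* K) Φ (N + 1)).det‖ ^ Fintype.card n *
      ((((frobMatrix (σ : K →+* K) Φ (N + 1)).map j).charpoly.roots ×ˢ
        ((frobMatrix (σ : K →+* K) Ψ (N + 1)).map j).charpoly.roots).map fun x =>
          ‖x.2 / x.1 - algebraMap ℚ_[l] (PadicAlgCl l) y ^ (N + 1)‖).prod := by
  set A := frobMatrix (σ : K →+* K) Φ (N + 1) with hA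
  set B := frobMatrix (σ : K →+* K) Ψ (N + 1) with hB
  have hAu : IsUnit A.det := isUnit_det_frobMatrix _ hΦ _
  let τ : Matrix n m K →ₗ[ℚ_[l]] Matrix n m K :=
    { toFun S := Ψ * S.map σ * Φ⁻¹
      map_add' S S' := by rw [Matrix.map_add _ (map_add σ), Matrix.mul_add, Matrix.add_mul]
      map_smul' c S := by
        rw [Matrix.map_smul _ _ (map_smul σ c), Matrix.mul_smul, Matrix.smul_mul]
        rfl }
  have hτ : ∀ (c : K) S, τ (c • S) = σ c • τ S := fun c S => by
    have : (c • S).map σ = σ c • S.map σ := by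
      ext
      simp
    simp only [τ, LinearMap.coe_mk, AddHom.coe_mk, this, Matrix.mul_smul, Matrix.smul_mul]
  let ρK : Matrix n m K →ₗ[K] Matrix n m K := mulRightLinearMap n K Φ
  have hρ := norm_det_of_restrictScalars ω j ρK (ρK.restrictScalars ℚ_[l]) fun _ => rfl
  rw [Matrix.det_mulRight Φ ρK fun _ => rfl, map_pow, norm_pow, ← pow_mul, mul_comm, pow_mul,
    ← norm_det_frobMatrix σ ω j, ← hA] at hρ
  have h1 : T = ρK.restrictScalars ℚ_[l] ∘ₗ (τ - y • 1) := by
    ext1 S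
    change _ = (Ψ * S.map σ * Φ⁻¹ - y • S) * Φ
    rw [hT, Matrix.sub_mul, Matrix.mul_assoc (Ψ * S.map σ), Matrix.nonsing_inv_mul _ hΦ,
      Matrix.mul_one, Matrix.smul_mul]
  have hpow : ∀ S, (τ ^ (N + 1)) S = B * S * A⁻¹ := fun S => by
    rw [Module.End.pow_apply]
    refine (semilinear_iterate (σ : K →+* K) hΦ (N + 1) S).trans ?_
    congr 2
    ext i k
    have := DFunLike.congr_fun hσ' (S i k)
    rw [AlgHom.coe_pow] at this
    exact this
  let T₁ : Matrix n m K →ₗ[K] Matrix n m K :=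
    mulLeftLinearMap m K B - algebraMap ℚ_[l] K y ^ (N + 1) • mulRightLinearMap n K A
  let T₂ : Matrix n m K →ₗ[K] Matrix n m K := mulRightLinearMap n K A⁻¹
  have h2 := norm_det_of_restrictScalars ω j (T₂ ∘ₗ T₁) (τ ^ (N + 1) - y ^ (N + 1) • 1) fun S => by
    change (τ ^ (N + 1)) S - y ^ (N + 1) • S =
      (B * S - algebraMap ℚ_[l] K y ^ (N + 1) • (S * A)) * A⁻¹
    rw [hpow, Matrix.sub_mul, Matrix.smul_mul, Matrix.mul_assoc S, Matrix.mul_nonsing_inv _ hAu,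
      Matrix.mul_one, ← map_pow, algebraMap_smul]
  have h3 : j (LinearMap.det (T₂ ∘ₗ T₁)) =
      ((A.map j).charpoly.roots.map fun a => ((B.map j).charpoly.roots.map fun b =>
        b / a - algebraMap ℚ_[l] (PadicAlgCl l) y ^ (N + 1)).prod).prod := by
    have h4 : j A.det = (A.map j).charpoly.roots.prod := by
      rw [← Matrix.det_eq_prod_roots_charpoly, AlgHom.map_det]
      rfl
    have hne : ∀ a ∈ (A.map j).charpoly.roots, a ≠ 0 := fun a ha h0 => by
      rw [h0] at ha
      rw [Multiset.prod_eq_zero ha, map_eq_zero] at h4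
      exact hAu.ne_zero h4
    rw [LinearMap.det_comp, map_mul, Matrix.det_mulRight A⁻¹ T₂ fun _ => rfl]
    have h5 := Matrix.det_sylvester (j : K →+* PadicAlgCl l) A B (algebraMap ℚ_[l] K y ^ (N + 1)) T₁
      fun _ => rfl
    rw [RingHom.coe_coe] at h5
    rw [h5, Matrix.det_nonsing_inv, Ring.inverse_eq_inv', map_pow, map_inv₀, h4,
      ← Multiset.prod_map_inv', ← Multiset.prod_map_pow,
      ← Multiset.prod_map_mul]
    congr 1
    refine Multiset.map_congr rfl fun a ha => ?_
    rw [← Matrix.card_roots_charpoly (B.map j), ← Multiset.prod_replicate, ← Multiset.map_const',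
      ← Multiset.prod_map_mul]
    congr 1
    refine Multiset.map_congr rfl fun b _ => ?_
    have := hne a ha
    rw [map_pow, AlgHom.commutes]
    field_simp
  -- Both sides are now `(N + 1)`-th powers of nonnegative reals, and extracting the root gives the
  -- product over pairs.
  have h6 := LinearMap.det_sub_pow σ hσ hσ' ω τ hτ y
  replace h6 := congrArg norm h6
  rw [norm_mul, norm_pow, norm_pow, norm_pow, norm_neg, norm_one, one_pow, one_pow, one_mul, h2,
    h3] at h6
  rw [h1, LinearMap.det_comp, norm_mul, hρ, (pow_left_inj₀ (norm_nonneg _) (norm_nonneg _) (Nat.succ_ne_zero N)).1 h6]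
  congr 1
  simp only [Multiset.prod_map_product_eq_prod_prod, norm_prod_map]

end NormDet

/-! ### The condition on common multiple roots -/

section Semisimple

variable {K : Type*} [Field K] {m n : Type*} [Fintype m] [DecidableEq m] [Fintype n] [DecidableEq n]

/-- As `w` intertwines `A` and `B`, `v ↦ B v - v A` behaves like a derivation under passage to
polynomials, which is where the derivative of `f` enters. -/
theorem mul_aeval_of_commute {A : Matrix m m K} {B : Matrix n n K} {v w : Matrix n m K}
    (h1 : B * v - v * A = w) (h2 : B * w = w * A) (f : K[X]) :
    aeval B f * w = w * aeval A f ∧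
      aeval B f * v = v * aeval A f + w * aeval A (derivative f) := by
  have h3 : B * v = v * A + w := by rw [← h1]; abel
  induction f using Polynomial.induction_on' with
  | add p q hp hq =>
    simp only [map_add, Matrix.add_mul, Matrix.mul_add, hp.1, hq.1, hp.2, hq.2, true_and]
    abel
  | monomial k c =>
    induction k with
    | zero => simp [Algebra.algebraMap_eq_smul_one]
    | succ k ih =>
      have e : monomial (k + 1) c = X * monomial k c := (X_mul_monomial k c).symm
      rw [e]
      simp only [map_mul, aeval_X, derivative_mul, derivative_X, one_mul, map_add, Matrix.mul_assoc,
        ih.1, ih.2]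
      constructor
      · rw [← Matrix.mul_assoc, h2, Matrix.mul_assoc]
      · rw [Matrix.mul_add, ← Matrix.mul_assoc, ← Matrix.mul_assoc, h2, h3, Matrix.add_mul,
          Matrix.mul_add]
        simp only [Matrix.mul_assoc]
        abel

/-- The ideal of all `f` with `w f(A) = 0` contains both minimal polynomials and the derivative of
their least common multiple. A common zero of the ideal would be a simple root of both, hence a
simple root of the least common multiple, where the derivative does not vanish. So the ideal
contains 1. -/
theorem NoCommonMultipleRoot.eq_zero {A : Matrix m m K} {B : Matrix n n K}
    (hAB : NoCommonMultipleRoot (minpoly K A) (minpoly K B)) {v w : Matrix n m K}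
    (h1 : B * v - v * A = w) (h2 : B * w = w * A) : w = 0 := by
  classical
  have hcomm := mul_aeval_of_commute h1 h2
  have hA := minpoly.aeval K A
  have hB := minpoly.aeval K B
  have hA0 := minpoly.ne_zero (Matrix.isIntegral A)
  have hB0 := minpoly.ne_zero (Matrix.isIntegral B)
  set a := minpoly K A
  set b := minpoly K B
  let J : Ideal K[X] :=
    { carrier := {f | w * aeval A f = 0}
      add_mem' := fun {f g} hf hg => by
        simp only [Set.mem_ofPred_eq] at hf hg ⊢
        rw [map_add, Matrix.mul_add, hf, hg, add_zero]
      zero_mem' := by simp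
      smul_mem' := fun g f hf => by
        simp only [Set.mem_ofPred_eq] at hf ⊢
        rw [smul_eq_mul, mul_comm, map_mul, ← Matrix.mul_assoc, hf, Matrix.zero_mul] }
  have hJ : ∀ f, f ∈ J ↔ w * aeval A f = 0 := fun f => Iff.rfl
  have ha : a ∈ J := by rw [hJ, hA, Matrix.mul_zero]
  have hb : b ∈ J := by rw [hJ, ← (hcomm b).1, hB, Matrix.zero_mul]
  obtain ⟨q, hq⟩ := EuclideanDomain.gcd_dvd_right a b
  -- The least common multiple `a q` kills both `A` and `B`, so only the derivative term survives.
  have hl : derivative (a * q) ∈ J := by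
    have h3 := (hcomm (a * q)).2
    obtain ⟨q', hq'⟩ := EuclideanDomain.gcd_dvd_left a b
    have h4 : a * q = q' * b := by
      conv_lhs => rw [hq']
      conv_rhs => rw [hq]
      ring
    have h5 : aeval B (a * q) = 0 := by rw [h4, map_mul, hB, mul_zero]
    have h6 : aeval A (a * q) = 0 := by rw [map_mul, hA, zero_mul]
    rw [h5, h6, Matrix.zero_mul, Matrix.mul_zero, zero_add] at h3
    exact h3.symm
  have htop : J = ⊤ := by
    by_contra hne
    obtain ⟨g, hg⟩ := IsPrincipalIdealRing.principal J
    have hmem : ∀ f ∈ J, g ∣ f := fun f hf => Ideal.mem_span_singleton.1 (hg.le hf)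
    have hdeg : g.degree ≠ 0 := fun h => hne (by
      rw [hg]
      exact Ideal.span_singleton_eq_top.2 (isUnit_iff_degree_eq_zero.2 h))
    obtain ⟨x, hx⟩ := IsAlgClosed.exists_root (g.map (algebraMap K (AlgebraicClosure K)))
      (by rwa [degree_map])
    have hroot : ∀ f ∈ J, (f.map (algebraMap K (AlgebraicClosure K))).IsRoot x := fun f hf =>
      hx.dvd (Polynomial.map_dvd _ (hmem f hf))
    obtain ⟨m1, m2⟩ := hAB x (hroot a ha) (hroot b hb)
    have ha0 : a.map (algebraMap K (AlgebraicClosure K)) ≠ 0 := map_ne_zero hA0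
    have hb0 : b.map (algebraMap K (AlgebraicClosure K)) ≠ 0 := map_ne_zero hB0
    have hq0 : ¬ (q.map (algebraMap K (AlgebraicClosure K))).IsRoot x := fun hqx => by
      have hgx : ((EuclideanDomain.gcd a b).map (algebraMap K (AlgebraicClosure K))).IsRoot x := by
        refine hx.dvd (Polynomial.map_dvd _ ?_)
        exact EuclideanDomain.dvd_gcd (hmem a ha) (hmem b hb)
      have h7 : b.map (algebraMap K (AlgebraicClosure K)) =
        (EuclideanDomain.gcd a b).map (algebraMap K (AlgebraicClosure K)) *
          q.map (algebraMap K (AlgebraicClosure K)) := by rw [← Polynomial.map_mul, ← hq]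
      rw [h7] at hb0 m2
      rw [rootMultiplicity_mul hb0] at m2
      have h8 := (rootMultiplicity_pos (left_ne_zero_of_mul hb0)).2 hgx
      have h9 := (rootMultiplicity_pos (right_ne_zero_of_mul hb0)).2 hqx
      omega
    have hd := hroot _ hl
    rw [derivative_mul, Polynomial.map_add, Polynomial.map_mul, Polynomial.map_mul, IsRoot.def,
      eval_add, eval_mul, eval_mul, (hroot a ha).eq_zero, zero_mul, add_zero, mul_eq_zero] at hd
    rcases hd with hd | hd
    · have := (one_lt_rootMultiplicity_iff_isRoot ha0).2 ⟨hroot a ha, by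
        rw [derivative_map]; exact hd⟩
      omega
    · exact hq0 hd
  have := (Ideal.eq_top_iff_one J).1 htop
  rw [hJ, map_one, Matrix.mul_one] at this
  exact this

end Semisimple

/-! ### Asymptotics as `l ^ k` tends to zero -/

section Limit

open Filter

/-- As `q ^ k` is unbounded, two nonzero limits force the same rate of growth. -/
theorem tendsto_pow_mul_unique {q : ℝ} (hq : 1 < q) {f : ℕ → ℝ} {r s : ℕ} {x y : ℝ} (hx : x ≠ 0)
    (hy : y ≠ 0) (h1 : Tendsto (fun k => f k * (q ^ k) ^ r) atTop (nhds x))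
    (h2 : Tendsto (fun k => f k * (q ^ k) ^ s) atTop (nhds y)) : r = s ∧ x = y := by
  have key : ∀ {r s : ℕ} {x y : ℝ}, x ≠ 0 → Tendsto (fun k => f k * (q ^ k) ^ r) atTop (nhds x) →
      Tendsto (fun k => f k * (q ^ k) ^ s) atTop (nhds y) → s ≤ r := by
    intro r s x y hx h1 h2
    by_contra! h
    obtain ⟨d, rfl⟩ := Nat.exists_eq_add_of_lt h
    have h3 : Tendsto (fun k => (f k * (q ^ k) ^ (r + d + 1)) * ((q ^ k) ^ (d + 1))⁻¹) atTop
        (nhds (y * 0)) := by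
      refine h2.mul (tendsto_inv_atTop_zero.comp ?_)
      exact (tendsto_pow_atTop (Nat.succ_ne_zero d)).comp (tendsto_pow_atTop_atTop_of_one_lt hq)
    have h4 : ∀ k, (f k * (q ^ k) ^ (r + d + 1)) * ((q ^ k) ^ (d + 1))⁻¹ = f k * (q ^ k) ^ r :=
      fun k => by
        have : q ≠ 0 := by positivity
        field_simp
        ring
    simp only [h4, mul_zero] at h3
    exact hx (tendsto_nhds_unique h1 h3)
  have hrs := le_antisymm (key hy h2 h1) (key hx h1 h2)
  subst hrs
  exact ⟨rfl, tendsto_nhds_unique h1 h2⟩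

variable {l : ℕ} [Fact l.Prime]

theorem tendsto_one_add_pow (N : ℕ) :
    Tendsto (fun k : ℕ => (1 + (l : PadicAlgCl l) ^ k) ^ N) atTop (nhds 1) := by
  have h : Tendsto (fun k : ℕ => (l : PadicAlgCl l) ^ k) atTop (nhds 0) :=
    tendsto_pow_atTop_nhds_zero_of_norm_lt_one (by
      rw [← map_natCast (algebraMap ℚ_[l] (PadicAlgCl l)), PadicAlgCl.norm_extends, Padic.norm_p]
      exact inv_lt_one_of_one_lt₀ (by exact_mod_cast (Fact.out : l.Prime).one_lt))
  have := ((h.const_add 1).pow N)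
  simpa using this

/-- By the geometric sum, `1 - (1 + x) ^ N` is `-x` times a sum of `N` terms that tend to 1. -/
theorem tendsto_norm_one_sub (N : ℕ) :
    Tendsto (fun k : ℕ => ‖1 - (1 + (l : PadicAlgCl l) ^ k) ^ N‖ * (l : ℝ) ^ k) atTop
      (nhds ‖(N : PadicAlgCl l)‖) := by
  have h1 : ∀ k : ℕ, ‖1 - (1 + (l : PadicAlgCl l) ^ k) ^ N‖ * (l : ℝ) ^ k =
      ‖∑ i ∈ Finset.range N, (1 + (l : PadicAlgCl l) ^ k) ^ i‖ := fun k => by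
    have h2 := mul_geom_sum (1 + (l : PadicAlgCl l) ^ k) N
    rw [add_sub_cancel_left] at h2
    have h3 : ‖(l : PadicAlgCl l)‖ = (l : ℝ)⁻¹ := by
      rw [← map_natCast (algebraMap ℚ_[l] (PadicAlgCl l)), PadicAlgCl.norm_extends, Padic.norm_p]
    have hl0 : (l : ℝ) ≠ 0 := by exact_mod_cast (Fact.out : l.Prime).ne_zero
    rw [norm_sub_rev, ← h2, norm_mul, norm_pow, h3, mul_right_comm, ← mul_pow, inv_mul_cancel₀ hl0,
      one_pow, one_mul]
  simp only [h1]
  have h4 : Tendsto (fun k : ℕ => ∑ i ∈ Finset.range N, (1 + (l : PadicAlgCl l) ^ k) ^ i) atTop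
      (nhds (∑ i ∈ Finset.range N, 1)) := tendsto_finsetSum _ fun i _ => tendsto_one_add_pow i
  simpa using h4.norm

-- Each pair with equal entries contributes a factor asymptotic to `|N| l ^ (-k)`; the remaining
-- factors converge to nonzero limits.
open Classical in
theorem tendsto_prod_norm_div_sub (N : ℕ) (P : Multiset (PadicAlgCl l × PadicAlgCl l))
    (hP : ∀ x ∈ P, x.1 ≠ 0) :
    Tendsto (fun k : ℕ => (P.map fun x => ‖x.2 / x.1 - (1 + (l : PadicAlgCl l) ^ k) ^ N‖).prod *
      ((l : ℝ) ^ k) ^ (P.filter fun x => ¬ x.1 ≠ x.2).card) atTop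
      (nhds (‖((P.filter fun x => x.1 ≠ x.2).map fun x => 1 - x.2 / x.1).prod‖ *
        ‖(N : PadicAlgCl l)‖ ^ (P.filter fun x => ¬ x.1 ≠ x.2).card)) := by
  induction P using Multiset.induction_on with
  | empty => simp
  | cons x P ih =>
    have ih := ih fun y hy => hP y (Multiset.mem_cons_of_mem hy)
    have hx := hP x (Multiset.mem_cons_self _ _)
    by_cases h : x.1 = x.2
    · rw [Multiset.filter_cons_of_neg (p := fun x : PadicAlgCl l × PadicAlgCl l => x.1 ≠ x.2) P
          (not_not.2 h),
        Multiset.filter_cons_of_pos (p := fun x : PadicAlgCl l × PadicAlgCl l => ¬ x.1 ≠ x.2) P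
          (not_not.2 h), Multiset.card_cons]
      refine (((tendsto_norm_one_sub (l := l) N).mul ih).congr fun k => ?_).mono_right
        (le_of_eq (congrArg nhds ?_))
      · rw [Multiset.map_cons, Multiset.prod_cons, ← h, div_self hx]
        ring
      · ring
    · rw [Multiset.filter_cons_of_pos (p := fun x : PadicAlgCl l × PadicAlgCl l => x.1 ≠ x.2) P h,
        Multiset.filter_cons_of_neg (p := fun x : PadicAlgCl l × PadicAlgCl l => ¬ x.1 ≠ x.2) P
          (not_not.2 h)]
      have h2 : Tendsto (fun k : ℕ => ‖x.2 / x.1 - (1 + (l : PadicAlgCl l) ^ k) ^ N‖) atTop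
          (nhds ‖x.2 / x.1 - 1‖) := ((tendsto_one_add_pow N).const_sub _).norm
      refine ((h2.mul ih).congr fun k => ?_).mono_right (le_of_eq (congrArg nhds ?_))
      · rw [Multiset.map_cons, Multiset.prod_cons]
        ring
      · rw [Multiset.map_cons, Multiset.prod_cons, norm_mul, norm_sub_rev]
        ring

end Limit

/-! ### The edge map for matrices -/

section FrobeniusExt

variable {l : ℕ} [Fact l.Prime] {R K : Type*} [CommRing R] [IsDomain R] [Algebra ℤ_[l] R] [Field K]
  [Algebra R K] [Algebra ℚ_[l] K]

/-- `R` and its fraction field `K` are cyclic extensions of degree `N + 1` of `ℤ_l` and `ℚ_l`, with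
an automorphism `σ` of order `N + 1`. -/
structure IsFrobeniusExt (σ : R →+* R) (σK : K →ₐ[ℚ_[l]] K) (N : ℕ) : Prop where
  coe : ∀ x : ℤ_[l], algebraMap R K (algebraMap ℤ_[l] R x) = algebraMap ℚ_[l] K x
  comm : ∀ x, σK (algebraMap R K x) = algebraMap R K (σ x)
  injective : Function.Injective fun i : Fin (N + 1) => σK ^ (i : ℕ)
  pow : σK ^ (N + 1) = 1
  basis : ∃ (ω : Module.Basis (Fin (N + 1)) ℤ_[l] R) (ω' : Module.Basis (Fin (N + 1)) ℚ_[l] K),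
    ∀ i, ω' i = algebraMap R K (ω i)

/-- The two maps have the same matrix in corresponding bases. -/
theorem det_eq_coe_det {κ D V : Type*} [Finite κ] [AddCommGroup D] [Module ℤ_[l] D]
    [AddCommGroup V] [Module ℚ_[l] V] (b : Module.Basis κ ℤ_[l] D) (b' : Module.Basis κ ℚ_[l] V)
    (ι : D →+ V) (hι : ∀ (x : ℤ_[l]) d, ι (x • d) = (x : ℚ_[l]) • ι d) (hb : ∀ i, ι (b i) = b' i)
    (f : D →ₗ[ℤ_[l]] D) (g : V →ₗ[ℚ_[l]] V) (hfg : ∀ d, g (ι d) = ι (f d)) :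
    LinearMap.det g = (LinearMap.det f : ℤ_[l]) := by
  classical
  cases nonempty_fintype κ
  rw [← LinearMap.det_toMatrix b, ← LinearMap.det_toMatrix b']
  have h := RingHom.map_det PadicInt.Coe.ringHom (LinearMap.toMatrix b b f)
  refine Eq.trans ?_ h.symm
  congr 1
  ext i k
  rw [LinearMap.toMatrix_apply, ← hb, hfg, ← b.sum_repr (f (b k)), map_sum]
  simp only [hι, hb]
  rw [b'.repr_sum_self, RingHom.mapMatrix_apply, Matrix.map_apply, LinearMap.toMatrix_apply]
  rfl

variable [IsFractionRing R K] {σ : R →+* R} {σK : K →ₐ[ℚ_[l]] K} {N : ℕ}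

-- The determinant of `S ↦ Ψ σ(S) - (1 + l ^ k) S Φ` is evaluated in two ways as `k` grows: by the
-- lattice computation, which gives `z` of the map induced by `ρ S = S Φ`, and by the product over
-- pairs of eigenvalues. Both also contain the same power of `|N + 1|`, which is cancelled at the
-- end.
open Classical in
theorem IsFrobeniusExt.zInv_matrix (h : IsFrobeniusExt σ σK N) {m n : Type*} [Fintype m]
    [DecidableEq m] [Fintype n] [DecidableEq n] {Φ : Matrix m m R} (hΦ : Φ.det ≠ 0)
    (Ψ : Matrix n n R) {c : R} (hc : ∑ i ∈ Finset.range (N + 1), σ^[i] c = 1)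
    (j : K →ₐ[ℚ_[l]] PadicAlgCl l) {A : Matrix m m K} {B : Matrix n n K}
    (hA : A = (frobMatrix σ Φ (N + 1)).map (algebraMap R K))
    (hB : B = (frobMatrix σ Ψ (N + 1)).map (algebraMap R K))
    (hAB : NoCommonMultipleRoot (minpoly K A) (minpoly K B))
    (d : Matrix n m R →+ Matrix n m R) (hd : ∀ S, d S = Ψ * S.map σ - S * Φ)
    (f : d.ker →+ Matrix n m R ⧸ d.range) (hf : ∀ u, f u = QuotientAddGroup.mk (c • (u.1 * Φ))) :
    ZDefined f ∧ (zInv f : ℝ) = ‖j A.det‖ ^ Fintype.card n *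
      ‖((((A.map j).charpoly.roots ×ˢ (B.map j).charpoly.roots).filter fun x => x.1 ≠ x.2).map
        fun x => 1 - x.2 / x.1).prod‖ := by
  have hinj := IsFractionRing.injective R K
  obtain ⟨ω, ω', hω⟩ := h.basis
  have := Module.Finite.of_basis ω'
  have hσz : ∀ z : ℤ_[l], σ (algebraMap ℤ_[l] R z) = algebraMap ℤ_[l] R z := fun z => hinj (by
    rw [← h.comm, h.coe, AlgHom.commutes])
  have hA' : A = frobMatrix (σK : K →+* K) (Φ.map (algebraMap R K)) (N + 1) := by
    rw [hA]
    exact frobMatrix_map σ (σK : K →+* K) (algebraMap R K) (fun x => (h.comm x).symm) Φ _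
  have hB' : B = frobMatrix (σK : K →+* K) (Ψ.map (algebraMap R K)) (N + 1) := by
    rw [hB]
    exact frobMatrix_map σ (σK : K →+* K) (algebraMap R K) (fun x => (h.comm x).symm) Ψ _
  have hΦK : IsUnit (Φ.map (algebraMap R K)).det := by
    have : (Φ.map (algebraMap R K)).det = algebraMap R K Φ.det := (RingHom.map_det _ _).symm
    rw [this, isUnit_iff_ne_zero, Ne, map_eq_zero_iff _ hinj]
    exact hΦ
  have hAu : IsUnit A.det := hA' ▸ isUnit_det_frobMatrix _ hΦK _
  let ρ : Matrix n m R →ₗ[ℤ_[l]] Matrix n m R := mulRightLinearMap n ℤ_[l] Φ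
  let dL : Matrix n m R →ₗ[ℤ_[l]] Matrix n m R :=
    { d with
      map_smul' := fun z S => by
        have h1 : (z • S).map σ = z • S.map σ := by
          ext
          simp [Algebra.smul_def, hσz]
        simp only [ZeroHom.toFun_eq_coe, AddMonoidHom.toZeroHom_coe, RingHom.id_apply, hd, h1,
          Matrix.mul_smul, Matrix.smul_mul, smul_sub] }
  have hdL : dL.toAddMonoidHom = d := rfl
  let b := ω.smulTower (Matrix.stdBasis R n m)
  let b' := ω'.smulTower (Matrix.stdBasis K n m)
  let ι : Matrix n m R →+ Matrix n m K := (algebraMap R K).toAddMonoidHom.mapMatrix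
  have hι : ∀ S, ι S = S.map (algebraMap R K) := fun _ => rfl
  have hι' : Function.Injective ι := fun S T hST => by
    ext i k
    exact hinj (congrFun (congrFun hST i) k)
  have hιs : ∀ (x : ℤ_[l]) S, ι (x • S) = (x : ℚ_[l]) • ι S := fun x S => by
    ext i k
    simp only [hι, Matrix.map_apply, Matrix.smul_apply, Algebra.smul_def, map_mul, h.coe]
  have hb : ∀ i, ι (b i) = b' i := by
    rintro ⟨i, k, k'⟩
    rw [Module.Basis.smulTower_apply, Module.Basis.smulTower_apply, Matrix.stdBasis_eq_single,
      Matrix.stdBasis_eq_single, hω, hι]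
    ext x y
    simp only [Matrix.map_apply, Matrix.smul_apply, Matrix.single_apply]
    split_ifs <;> simp
  have hισ : ∀ S : Matrix n m R, (ι S).map σK = ι (S.map σ) := fun S => by
    ext x y
    exact h.comm _
  have : Module.Finite ℤ_[l] (Matrix n m R) := Module.Finite.of_basis b
  have : Module.Free ℤ_[l] (Matrix n m R) := Module.Free.of_basis b
  -- With `T S = Ψ σ(S) Φ⁻¹` over `K`, the hypotheses say `T u = u` and `T v = v + u`. As `T ^ (N +
  -- 1)` is `S ↦ B S A⁻¹`, this gives `B v - v A = (N + 1) u A`. The right side intertwines `A` and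
  -- `B`, so it vanishes by the condition on common roots.
  have H : ∀ u v, dL u = 0 → ρ u = dL v → u = 0 := by
    intro u v hu hv
    have hu : Ψ * u.map σ - u * Φ = 0 := (hd u).symm.trans hu
    have hv : u * Φ = Ψ * v.map σ - v * Φ := Eq.trans hv (hd v)
    replace hu : Ψ.map (algebraMap R K) * (ι u).map σK = ι u * Φ.map (algebraMap R K) := by
      rw [hισ, hι, hι, ← Matrix.map_mul, ← Matrix.map_mul, sub_eq_zero.1 hu]
    replace hv : ι u * Φ.map (algebraMap R K) =
        Ψ.map (algebraMap R K) * (ι v).map σK - ι v * Φ.map (algebraMap R K) := by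
      rw [hισ, hι, hι, hι, ← Matrix.map_mul, ← Matrix.map_mul, ← Matrix.map_mul, hv,
        Matrix.map_sub _ (map_sub _)]
    set T : Matrix n m K → Matrix n m K := fun S =>
      Ψ.map (algebraMap R K) * S.map (σK : K →+* K) * (Φ.map (algebraMap R K))⁻¹ with hT
    have hTadd : ∀ S S', T (S + S') = T S + T S' := fun S S' => by
      simp only [hT]
      rw [Matrix.map_add _ (map_add (σK : K →+* K)), Matrix.mul_add, Matrix.add_mul]
    have hTu : T (ι u) = ι u := by
      change _ * (ι u).map σK * _ = _
      rw [hu, Matrix.mul_assoc, Matrix.mul_nonsing_inv _ hΦK, Matrix.mul_one]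
    have hTv : T (ι v) = ι v + ι u := by
      change _ * (ι v).map σK * _ = _
      rw [← sub_add_cancel (Ψ.map (algebraMap R K) * (ι v).map σK) (ι v * Φ.map (algebraMap R K)),
        ← hv, ← Matrix.add_mul, Matrix.mul_assoc, Matrix.mul_nonsing_inv _ hΦK, Matrix.mul_one,
        add_comm]
    have hTu' : ∀ k, T^[k] (ι u) = ι u := fun k => Function.iterate_fixed hTu k
    have hTv' : ∀ k : ℕ, T^[k] (ι v) = ι v + k • ι u := fun k => by
      induction k with
      | zero => simp
      | succ k ih =>
        have h1 : ∀ k : ℕ, T (k • ι u) = k • ι u := fun k => by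
          induction k with
          | zero => simp [hT]
          | succ k ih => rw [succ_nsmul, hTadd, ih, hTu]
        rw [Function.iterate_succ_apply', ih, hTadd, h1, hTv, succ_nsmul]
        abel
    have hTN : ∀ S, T^[N + 1] S = B * S * A⁻¹ := fun S => by
      rw [hT, semilinear_iterate (σK : K →+* K) hΦK (N + 1) S, ← hA', ← hB']
      congr 2
      ext x y
      have := DFunLike.congr_fun h.pow (S x y)
      rw [AlgHom.coe_pow] at this
      exact this
    have e1 : B * ι u = ι u * A := by
      have := (hTN (ι u)).symm.trans (hTu' _)
      rw [← this, Matrix.mul_assoc _ A⁻¹, Matrix.nonsing_inv_mul _ hAu, Matrix.mul_one, this]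
    have e2 : B * ι v - ι v * A = (N + 1) • (ι u * A) := by
      have := congrArg (· * A) ((hTN (ι v)).symm.trans (hTv' _))
      simp only [Matrix.mul_assoc _ A⁻¹, Matrix.nonsing_inv_mul _ hAu, Matrix.mul_one] at this
      rw [this, Matrix.add_mul, add_sub_cancel_left, Matrix.smul_mul]
    have e3 : (N + 1) • (ι u * A) = 0 := hAB.eq_zero e2 (by
      rw [Matrix.mul_smul, Matrix.smul_mul, ← Matrix.mul_assoc, e1])
    have e4 : ι u * A = 0 := by
      have : CharZero K := charZero_of_injective_algebraMap (algebraMap ℚ_[l] K).injective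
      rw [← Nat.cast_smul_eq_nsmul K] at e3
      exact (smul_eq_zero.1 e3).resolve_left (Nat.cast_ne_zero.2 (Nat.succ_ne_zero N))
    have e5 : ι u = 0 := by
      rw [← Matrix.mul_one (ι u), ← Matrix.mul_nonsing_inv _ hAu, ← Matrix.mul_assoc, e4,
        Matrix.zero_mul]
    exact hι' (e5.trans (map_zero ι).symm)
  -- Multiplication by `N + 1` on `ker d` accounts for the difference between `f`, defined with `c`,
  -- and the map induced by `ρ`.
  let μ : d.ker →+ d.ker :=
    ((((N + 1 : ℕ) : ℤ_[l]) • LinearMap.id : LinearMap.ker dL →ₗ[ℤ_[l]] LinearMap.ker dL)).toAddMonoidHom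
  have hμ : ZDefined μ ∧ (zInv μ : ℝ) = ‖((N + 1 : ℕ) : PadicAlgCl l)‖ ^
      Module.finrank ℤ_[l] (LinearMap.ker dL) := by
    have h0 : ((N + 1 : ℕ) : ℤ_[l]) ≠ 0 := Nat.cast_ne_zero.2 (Nat.succ_ne_zero N)
    have h1 := zDefined_of_injective (h := (((N + 1 : ℕ) : ℤ_[l]) • LinearMap.id :
      LinearMap.ker dL →ₗ[ℤ_[l]] LinearMap.ker dL)) (smul_right_injective _ h0)
    refine ⟨h1.1, h1.2.trans ?_⟩
    rw [LinearMap.det_smul, LinearMap.det_id, mul_one, norm_pow, PadicInt.norm_def,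
      ← map_natCast (algebraMap ℚ_[l] (PadicAlgCl l)), PadicAlgCl.norm_extends]
    simp
  have hg : ∀ u : d.ker, (f.comp μ) u = QuotientAddGroup.mk (ρ u.1) := fun u => by
    have h1 : μ u = (N + 1) • u := Subtype.ext (Nat.cast_smul_eq_nsmul ℤ_[l] _ _)
    have hu : Ψ * u.1.map σ = u.1 * Φ := by
      have := u.2
      rw [AddMonoidHom.mem_ker, hd, sub_eq_zero] at this
      exact this
    -- Modulo the image of `d` the coefficient `b` may be replaced by `σ b`, since the difference is
    -- `d (b u)`. Hence `(N + 1) c u Φ` has the class of `tr(c) u Φ = u Φ`.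
    have h2 : ∀ b : R, (QuotientAddGroup.mk (σ b • (u.1 * Φ)) : _ ⧸ d.range) =
        QuotientAddGroup.mk (b • (u.1 * Φ)) := fun b => by
      rw [QuotientAddGroup.eq, neg_add_eq_sub]
      refine ⟨-(b • u.1), ?_⟩
      have h3 : (b • u.1).map σ = σ b • u.1.map σ := by
        ext
        simp
      rw [map_neg, hd, h3, Matrix.mul_smul, hu, Matrix.smul_mul, neg_sub]
    have h3 : ∀ i, (QuotientAddGroup.mk (σ^[i] c • (u.1 * Φ)) : _ ⧸ d.range) =
        QuotientAddGroup.mk (c • (u.1 * Φ)) := fun i => by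
      induction i with
      | zero => rfl
      | succ i ih => rw [Function.iterate_succ_apply', h2, ih]
    have h4 : (ρ u.1 : Matrix n m R) = ∑ i ∈ Finset.range (N + 1), σ^[i] c • (u.1 * Φ) := by
      rw [← Finset.sum_smul, hc, one_smul]
      rfl
    rw [AddMonoidHom.comp_apply, h1, map_nsmul, hf, h4]
    refine Eq.symm ((map_sum (QuotientAddGroup.mk' d.range) _ _).trans ?_)
    exact (Finset.sum_congr rfl fun i _ => h3 i).trans (by simp)
  obtain ⟨z1, t1⟩ := tendsto_det_sub_smul dL ρ H (f.comp μ) hg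
  have zf : ZDefined f := hμ.1.of_comp_left z1
  refine ⟨zf, ?_⟩
  have hN0 : ‖((N + 1 : ℕ) : PadicAlgCl l)‖ ≠ 0 := norm_ne_zero_iff.2 (Nat.cast_ne_zero.2 (Nat.succ_ne_zero N))
  have hne : ∀ x ∈ (A.map j).charpoly.roots ×ˢ (B.map j).charpoly.roots, x.1 ≠ 0 := by
    intro x hx h0
    have h1 := (Multiset.mem_product.1 hx).1
    rw [h0] at h1
    have h2 : j A.det = (A.map j).charpoly.roots.prod := by
      rw [← Matrix.det_eq_prod_roots_charpoly, AlgHom.map_det]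
      rfl
    rw [Multiset.prod_eq_zero h1, map_eq_zero] at h2
    exact hAu.ne_zero h2
  have t2 := (tendsto_prod_norm_div_sub (N + 1) _ hne).const_mul (‖j A.det‖ ^ Fintype.card n)
  have hdet : ∀ k : ℕ, ‖LinearMap.det (dL - (l : ℤ_[l]) ^ k • ρ)‖ = ‖j A.det‖ ^ Fintype.card n *
      (((A.map j).charpoly.roots ×ˢ (B.map j).charpoly.roots).map fun x =>
        ‖x.2 / x.1 - (1 + (l : PadicAlgCl l) ^ k) ^ (N + 1)‖).prod := fun k => by
    let T : Matrix n m K →ₗ[ℚ_[l]] Matrix n m K :=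
      mulLeftLinearMap m ℚ_[l] (Ψ.map (algebraMap R K)) ∘ₗ σK.toLinearMap.mapMatrix -
        (1 + (l : ℚ_[l]) ^ k) • mulRightLinearMap n ℚ_[l] (Φ.map (algebraMap R K))
    have h1 := det_eq_coe_det b b' ι hιs hb (dL - (l : ℤ_[l]) ^ k • ρ) T fun S => by
      change Ψ.map (algebraMap R K) * (ι S).map σK - (1 + (l : ℚ_[l]) ^ k) •
        (ι S * Φ.map (algebraMap R K)) = ι (d S - (l : ℤ_[l]) ^ k • (S * Φ))
      rw [map_sub, hιs, hd, map_sub, hισ, hι, hι, hι, hι, Matrix.map_mul, Matrix.map_mul]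
      push_cast
      module
    have h2 := norm_det_semilinear σK h.injective h.pow ω' j hΦK (1 + (l : ℚ_[l]) ^ k) T fun _ => rfl
    rw [h1, ← hA', ← hB'] at h2
    rw [PadicInt.norm_def, h2]
    simp
  simp only [hdet] at t1
  simp only [← mul_assoc] at t2
  have hC : ‖j A.det‖ ≠ 0 := norm_ne_zero_iff.2 ((map_ne_zero j).2 hAu.ne_zero)
  have hl1 : (1 : ℝ) < l := by exact_mod_cast (Fact.out : l.Prime).one_lt
  have hP : ‖((((A.map j).charpoly.roots ×ˢ (B.map j).charpoly.roots).filter fun x => x.1 ≠ x.2).map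
        fun x => 1 - x.2 / x.1).prod‖ ≠ 0 := by
    rw [norm_ne_zero_iff]
    intro h0
    obtain ⟨x, hx, hx0⟩ := Multiset.mem_map.1 (Multiset.prod_eq_zero_iff.1 h0)
    rw [Multiset.mem_filter] at hx
    have := hne x hx.1
    rw [sub_eq_zero, eq_div_iff this, one_mul] at hx0
    exact hx.2 hx0
  -- Comparing growth also shows that the rank of `ker d` is the number of pairs of equal
  -- eigenvalues, so the two powers of `|N + 1|` agree.
  obtain ⟨hr, hz⟩ := tendsto_pow_mul_unique hl1 (by exact_mod_cast z1.ne_zero)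
    (mul_ne_zero (mul_ne_zero (pow_ne_zero _ hC) hP) (pow_ne_zero _ hN0)) t1 t2
  have hz' := congrArg (Rat.cast (K := ℝ)) (zInv_comp zf hμ.1)
  rw [Rat.cast_mul, hμ.2] at hz'
  rw [← hr] at hz
  replace hz := hz'.symm.trans hz
  exact mul_right_cancel₀ (pow_ne_zero _ hN0) hz

end FrobeniusExt

/-! ### From matrices to free modules -/

section ModuleLevel

theorem exists_ker_coker_equiv {A B A' B' : Type*} [AddCommGroup A] [AddCommGroup B]
    [AddCommGroup A'] [AddCommGroup B'] {d : A →+ B} {d' : A' →+ B'} (e₀ : A ≃+ A') (e₁ : B ≃+ B')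
    (h : ∀ x, d' (e₀ x) = e₁ (d x)) :
    ∃ (k : d.ker ≃+ d'.ker) (q : B ⧸ d.range ≃+ B' ⧸ d'.range),
      (∀ x, (k x : A') = e₀ x) ∧ ∀ y, q (QuotientAddGroup.mk y) = QuotientAddGroup.mk (e₁ y) := by
  have h1 : d'.comp (e₀ : A →+ A') = (e₁ : B →+ B').comp d := AddMonoidHom.ext h
  refine ⟨AddEquiv.ofBijective (kerMap h1) ⟨fun x y hxy => ?_, fun y => ?_⟩,
    QuotientAddGroup.congr _ _ e₁ ?_, fun x => rfl, fun y => rfl⟩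
  · exact Subtype.ext (e₀.injective (congrArg Subtype.val hxy))
  · obtain ⟨x, hx⟩ := e₀.surjective y
    refine ⟨⟨x, ?_⟩, Subtype.ext hx⟩
    rw [AddMonoidHom.mem_ker, ← map_eq_zero_iff _ e₁.injective, ← h, hx]
    exact y.2
  · ext y
    constructor
    · rintro ⟨_, ⟨x, rfl⟩, rfl⟩
      exact ⟨e₀ x, h x⟩
    · rintro ⟨x, rfl⟩
      obtain ⟨x, rfl⟩ := e₀.surjective x
      exact ⟨_, ⟨x, rfl⟩, (h x).symm⟩

variable {R : Type*} [CommRing R] {σ : R →+* R} {m n : Type*} [Fintype m] [DecidableEq m]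
  [Fintype n] [DecidableEq n] {M N : Type*} [AddCommGroup M] [AddCommGroup N] [Module R M]
  [Module R N] (b : Module.Basis m R M) (b' : Module.Basis n R N)

/-- The matrix of a semilinear map. -/
def semilinearMatrix (φ : M →ₛₗ[σ] N) : Matrix n m R := Matrix.of fun i j => b'.repr (φ (b j)) i

theorem semilinear_apply_basis (φ : M →ₛₗ[σ] N) (j : m) :
    φ (b j) = ∑ i, semilinearMatrix b b' φ i j • b' i := (b'.sum_repr _).symm

theorem semilinear_apply (φ : M →ₛₗ[σ] N) (v : m → R) :
    φ (∑ j, v j • b j) = ∑ i, (semilinearMatrix b b' φ).mulVec (fun j => σ (v j)) i • b' i := by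
  simp only [map_sum, LinearMap.map_smulₛₗ, semilinear_apply_basis b b' φ, Finset.smul_sum,
    Matrix.mulVec, dotProduct, Finset.sum_smul, smul_smul, mul_comm]
  exact Finset.sum_comm

theorem exists_semilinear_matrix_equiv : ∃ e : (M →ₛₗ[σ] N) ≃+ Matrix n m R,
    ∀ φ, e φ = semilinearMatrix b b' φ := by
  refine ⟨AddEquiv.ofBijective (AddMonoidHom.mk' (semilinearMatrix b b') fun φ ψ => ?_) ⟨?_, ?_⟩,
    fun φ => rfl⟩
  · ext i j
    simp [semilinearMatrix]
  · intro φ ψ h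
    refine b.ext fun j => ?_
    rw [semilinear_apply_basis b b', semilinear_apply_basis b b']
    simp only [AddMonoidHom.mk'_apply] at h
    rw [h]
  · intro S
    let τ : M →ₛₗ[σ] m → R :=
      { toFun x j := σ (b.repr x j)
        map_add' x y := by
          ext
          simp
        map_smul' c x := by
          ext
          simp }
    refine ⟨(b'.equivFun.symm.toLinearMap ∘ₗ S.mulVecLin).comp τ, ?_⟩
    ext i j
    have : τ (b j) = Pi.single j 1 := by
      ext i
      simp [τ, Finsupp.single_apply, Pi.single_apply, apply_ite σ, eq_comm]
    simp [semilinearMatrix, this, Finsupp.single_apply]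

theorem iterate_apply_basis (F : M →ₛₗ[σ] M) (k : ℕ) (j : m) :
    F^[k] (b j) = ∑ i, frobMatrix σ (semilinearMatrix b b F) k i j • b i := by
  induction k with
  | zero => simp [frobMatrix, Matrix.one_apply]
  | succ k ih =>
    rw [Function.iterate_succ_apply', ih, semilinear_apply b b F]
    rfl

theorem toMatrix_eq_frobMatrix (F : M →ₛₗ[σ] M) (k : ℕ) (π : M →ₗ[R] M) (hπ : ∀ x, π x = F^[k] x) :
    LinearMap.toMatrix b b π = frobMatrix σ (semilinearMatrix b b F) k := by
  ext i j
  rw [LinearMap.toMatrix_apply, hπ, iterate_apply_basis b, b.repr_sum_self]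

/-- A vector killed by the matrix is `σ` of some coordinates, as `σ` is onto, and these are the
coordinates of an element of the kernel of `F`. -/
theorem det_semilinearMatrix_ne_zero [IsDomain R] (hσ : Function.Bijective σ) (F : M →ₛₗ[σ] M)
    (hF : ∀ x, F x = 0 → x = 0) : (semilinearMatrix b b F).det ≠ 0 := by
  rw [Ne, ← Matrix.exists_mulVec_eq_zero_iff]
  rintro ⟨v, hv0, hv⟩
  choose w hw using fun i => hσ.2 (v i)
  have h1 := semilinear_apply b b F w
  simp only [hw, hv, Pi.zero_apply, zero_smul, Finset.sum_const_zero] at h1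
  have h2 := Fintype.linearIndependent_iff.1 b.linearIndependent w (hF _ h1)
  exact hv0 (funext fun i => by rw [← hw, h2, map_zero, Pi.zero_apply])

variable {l : ℕ} [Fact l.Prime] [IsDomain R] [Algebra ℤ_[l] R] {K : Type*} [Field K] [Algebra R K]
  [Algebra ℚ_[l] K] [IsFractionRing R K] {σK : K →ₐ[ℚ_[l]] K} {r : ℕ}

theorem IsFrobeniusExt.bijective (h : IsFrobeniusExt σ σK r) : Function.Bijective σ := by
  have h1 : ∀ (k : ℕ) x, (σK ^ k) (algebraMap R K x) = algebraMap R K (σ^[k] x) := fun k x => by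
    induction k with
    | zero => rfl
    | succ k ih => rw [pow_succ', AlgHom.mul_apply, ih, h.comm, Function.iterate_succ_apply']
  have h2 : ∀ x, σ^[r + 1] x = x := fun x => IsFractionRing.injective R K (by
    rw [← h1, h.pow, AlgHom.one_apply])
  exact ⟨fun x y hxy => by rw [← h2 x, ← h2 y, Function.iterate_succ_apply,
    Function.iterate_succ_apply, hxy],
    fun x => ⟨σ^[r] x, (Function.iterate_succ_apply' σ r x).symm.trans (h2 x)⟩⟩

/-- Multiplication by `a` is an injective endomorphism of the `ℤ_l`-lattice `R`, so it has finite
index. -/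
theorem IsFrobeniusExt.finite_quotient (h : IsFrobeniusExt σ σK r) {a : R} (ha : a ≠ 0) :
    Finite (R ⧸ Ideal.span {a}) := by
  obtain ⟨ω, -, -⟩ := h.basis
  have := Module.Finite.of_basis ω
  have := Module.Free.of_basis ω
  obtain ⟨h1, -⟩ := card_quotient_range (h := LinearMap.mulLeft ℤ_[l] a) (mul_right_injective₀ ha)
  refine Finite.of_surjective (α := R ⧸ LinearMap.range (LinearMap.mulLeft ℤ_[l] a))
    (QuotientAddGroup.map (LinearMap.range (LinearMap.mulLeft ℤ_[l] a)).toAddSubgroup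
      (Submodule.toAddSubgroup (Ideal.span {a})) (AddMonoidHom.id R) ?_) fun x => ?_
  · rintro _ ⟨y, rfl⟩
    exact Ideal.mul_mem_right _ _ (Ideal.mem_span_singleton_self a)
  · obtain ⟨x, rfl⟩ := Ideal.Quotient.mk_surjective x
    exact ⟨QuotientAddGroup.mk x, rfl⟩

theorem exists_matrix_baseChange [Module.Finite R M] [Module.Free R M] (π : M →ₗ[R] M) :
    ∃ A : Matrix m m K, A = (LinearMap.toMatrix b b π).map (algebraMap R K) ∧
      minpoly K A = minpoly K (π.baseChange K) ∧ A.charpoly = (π.baseChange K).charpoly ∧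
      A.det = LinearMap.det (π.baseChange K) := by
  refine ⟨LinearMap.toMatrix (Algebra.TensorProduct.basis K b) (Algebra.TensorProduct.basis K b)
    (π.baseChange K), LinearMap.toMatrix_baseChange K π b b, ?_, LinearMap.charpoly_toMatrix _ _,
    LinearMap.det_toMatrix _ _⟩
  rw [← minpoly.algEquiv_eq (LinearMap.toMatrixAlgEquiv (Algebra.TensorProduct.basis K b))
    (π.baseChange K)]
  rfl

/-- The product of the `1 - b / a` over the pairs of different roots `a` of `P` and `b` of `Q`. -/
def pairProduct (P Q : (PadicAlgCl l)[X]) : PadicAlgCl l :=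
  haveI := Classical.decEq (PadicAlgCl l)
  (((P.roots ×ˢ Q.roots).filter fun x => x.1 ≠ x.2).map fun x => 1 - x.2 / x.1).prod

theorem IsFrobeniusExt.zInv_semilinear [Module.Finite R M] [Module.Free R M] [Module.Finite R N]
    [Module.Free R N] (h : IsFrobeniusExt σ σK r) {FM : M →ₛₗ[σ] M} {FN : N →ₛₗ[σ] N}
    (hF : ∀ x, FM x = 0 → x = 0) {πM : M →ₗ[R] M} {πN : N →ₗ[R] N} (hM : ∀ x, πM x = FM^[r + 1] x)
    (hN : ∀ x, πN x = FN^[r + 1] x) {c : R} (hc : ∑ i ∈ Finset.range (r + 1), σ^[i] c = 1)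
    (j : K →ₐ[ℚ_[l]] PadicAlgCl l)
    (hMN : NoCommonMultipleRoot (minpoly K (πM.baseChange K)) (minpoly K (πN.baseChange K)))
    (f : (semilinearComm FM FN).ker →+ (M →ₛₗ[σ] N) ⧸ (semilinearComm FM FN).range)
    (hf : ∀ u, f u = QuotientAddGroup.mk (c • (u : M →ₗ[R] N).comp FM)) :
    ZDefined f ∧ (zInv f : ℝ) =
      ‖j (LinearMap.det (πM.baseChange K))‖ ^ Module.finrank R N *
        ‖pairProduct ((πM.baseChange K).charpoly.map (j : K →+* PadicAlgCl l))
          ((πN.baseChange K).charpoly.map (j : K →+* PadicAlgCl l))‖ := by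
  classical
  let b := Module.finBasis R M
  let b' := Module.finBasis R N
  have hΦ := det_semilinearMatrix_ne_zero b h.bijective FM hF
  set Φ := semilinearMatrix b b FM with hΦ'
  set Ψ := semilinearMatrix b' b' FN with hΨ'
  obtain ⟨A, hA, mA, cA, dA⟩ := exists_matrix_baseChange (K := K) b (πM)
  obtain ⟨B, hB, mB, cB, -⟩ := exists_matrix_baseChange (K := K) b' (πN)
  rw [toMatrix_eq_frobMatrix b FM _ πM hM] at hA
  rw [toMatrix_eq_frobMatrix b' FN _ πN hN] at hB
  have cA' : (A.map j).charpoly = (πM.baseChange K).charpoly.map (j : K →+* PadicAlgCl l) := by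
    rw [← cA, ← Matrix.charpoly_map]
    rfl
  have cB' : (B.map j).charpoly = (πN.baseChange K).charpoly.map (j : K →+* PadicAlgCl l) := by
    rw [← cB, ← Matrix.charpoly_map]
    rfl
  obtain ⟨e₁, he₁⟩ := exists_semilinear_matrix_equiv (σ := σ) b b'
  let e₀ : (M →ₗ[R] N) ≃+ Matrix _ _ R := (LinearMap.toMatrix b b').toAddEquiv
  have he₀ : ∀ s i j, e₀ s i j = b'.repr (s (b j)) i := fun s i j => LinearMap.toMatrix_apply _ _ _ _ _
  have hcomp : ∀ s : M →ₗ[R] N, semilinearMatrix b b' (s.comp FM) = e₀ s * Φ := fun s => by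
    ext i j
    rw [semilinearMatrix, Matrix.of_apply, LinearMap.comp_apply, semilinear_apply_basis b b, map_sum,
      map_sum, Finsupp.finsetSum_apply, Matrix.mul_apply]
    refine Finset.sum_congr rfl fun k _ => ?_
    rw [map_smul, map_smul, Finsupp.smul_apply, smul_eq_mul, mul_comm, he₀]
  have hcomp' : ∀ s : M →ₗ[R] N, semilinearMatrix b b' (FN.comp s) = Ψ * (e₀ s).map σ := fun s => by
    ext i j
    have h1 : s (b j) = ∑ k, e₀ s k j • b' k := by
      simp only [he₀, b'.sum_repr]
    rw [semilinearMatrix, Matrix.of_apply, LinearMap.comp_apply, h1, semilinear_apply b' b',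
      b'.repr_sum_self]
    rfl
  let d : Matrix (Fin (Module.finrank R N)) (Fin (Module.finrank R M)) R →+
      Matrix (Fin (Module.finrank R N)) (Fin (Module.finrank R M)) R :=
    ((e₁ : _ →+ _).comp (semilinearComm FM FN)).comp (e₀.symm : _ →+ _)
  have hd0 : ∀ s, d (e₀ s) = e₁ (semilinearComm FM FN s) := fun s => by
    change e₁ (semilinearComm FM FN (e₀.symm (e₀ s))) = _
    rw [e₀.symm_apply_apply]
  have hd : ∀ S, d S = Ψ * S.map σ - S * Φ := fun S => by
    obtain ⟨s, rfl⟩ := e₀.surjective S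
    rw [hd0, ← hcomp, ← hcomp', ← he₁, ← he₁, ← map_sub]
    rfl
  obtain ⟨k, q, hk, hq⟩ := exists_ker_coker_equiv e₀ e₁ hd0
  let f' : d.ker →+ Matrix (Fin (Module.finrank R N)) (Fin (Module.finrank R M)) R ⧸ d.range := ((q : _ →+ _).comp f).comp (k.symm : _ →+ _)
  have hf0 : ∀ u, f' (k u) = q (f u) := fun u => by
    change q (f (k.symm (k u))) = _
    rw [k.symm_apply_apply]
  have hf' : ∀ u, f' u = QuotientAddGroup.mk (c • (u.1 * Φ)) := fun u => by
    obtain ⟨u, rfl⟩ := k.surjective u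
    rw [hf0, hf, hq, hk, ← hcomp, he₁]
    congr 1
    ext i j
    simp [semilinearMatrix]
  have key := h.zInv_matrix hΦ Ψ hc j hA hB (by rwa [mA, mB]) d hd f' hf'
  rw [zDefined_congr k q hf0, zInv_congr k q hf0]
  refine ⟨key.1, key.2.trans ?_⟩
  rw [dA, Fintype.card_fin]
  congr 2
  simp only [pairProduct, ← cA', ← cB']

end ModuleLevel

/-! ### Invariants of the quotient by torsion -/

section BaseChange

variable {R : Type*} [CommRing R] [IsDomain R] {K : Type*} [Field K] [Algebra R K]
  [IsFractionRing R K] {M N : Type*} [AddCommGroup M] [AddCommGroup N] [Module R M] [Module R N]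

/-- A torsion element dies over the fraction field: if `a m = 0`, then `c ⊗ m = (c / a) ⊗ a m = 0`.
-/
theorem exists_baseChange_equiv {q : M →ₗ[R] N} (hq : Function.Surjective q)
    (hker : ∀ x, q x = 0 → ∃ a : R, a ≠ 0 ∧ a • x = 0) :
    ∃ e : K ⊗[R] M ≃ₗ[K] K ⊗[R] N, ∀ x, e x = q.baseChange K x := by
  refine ⟨LinearEquiv.ofBijective (q.baseChange K) ⟨?_, LinearMap.lTensor_surjective K hq⟩,
    fun x => rfl⟩
  rw [injective_iff_map_eq_zero]
  intro x hx
  obtain ⟨z, rfl⟩ := (lTensor_exact K (LinearMap.exact_subtype_ker_map q) hq x).1 hx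
  have : z = 0 := by
    clear hx
    induction z with
    | zero => rfl
    | add x y hx hy => rw [hx, hy, add_zero]
    | tmul c m =>
      obtain ⟨a, ha, h⟩ := hker m m.2
      have ha' : algebraMap R K a ≠ 0 := fun h => ha (IsFractionRing.injective R K (by rw [h, map_zero]))
      have h1 : c = a • (c / algebraMap R K a) := by
        rw [Algebra.smul_def, mul_div_cancel₀ _ ha']
      rw [h1, smul_tmul, show a • m = 0 from Subtype.ext h, tmul_zero]
  rw [this, map_zero]

theorem baseChange_invariants {q : M →ₗ[R] N} (hq : Function.Surjective q)
    (hker : ∀ x, q x = 0 → ∃ a : R, a ≠ 0 ∧ a • x = 0) {f : M →ₗ[R] M} {g : N →ₗ[R] N}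
    (h : ∀ x, q (f x) = g (q x)) [Module.Finite R M] [Module.Finite R N] :
    minpoly K (g.baseChange K) = minpoly K (f.baseChange K) ∧
    (g.baseChange K).charpoly = (f.baseChange K).charpoly ∧
    LinearMap.det (g.baseChange K) = LinearMap.det (f.baseChange K) ∧
    Module.finrank R N = Module.finrank R M := by
  obtain ⟨e, he⟩ := exists_baseChange_equiv (K := K) hq hker
  have h1 : g.baseChange K = e.conj (f.baseChange K) := by
    rw [LinearEquiv.conj_apply, LinearEquiv.eq_comp_toLinearMap_symm]
    refine TensorProduct.AlgebraTensorModule.ext fun x y => ?_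
    simp [he, h]
  refine ⟨?_, ?_, ?_, ?_⟩
  · rw [h1]
    exact minpoly.algEquiv_eq (A := K) (B := Module.End K (K ⊗[R] M))
      (B' := Module.End K (K ⊗[R] N)) (e.conjAlgEquiv K) (f.baseChange K)
  · rw [h1, LinearEquiv.charpoly_conj]
  · rw [h1, LinearEquiv.conj_apply, LinearMap.comp_assoc, LinearMap.det_conj]
  · rw [← IsLocalizedModule.finrank_eq (nonZeroDivisors R) (TensorProduct.mk R K N 1) le_rfl,
      ← (e.restrictScalars R).finrank_eq,
      IsLocalizedModule.finrank_eq (nonZeroDivisors R) (TensorProduct.mk R K M 1) le_rfl]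

end BaseChange

/-! ### The Euler characteristic in a semilinear category -/

section Category

universe v₁ u₁ w₁ u₂

variable {R : Type u₂} [CommRing R] {σ : R →+* R}
variable {C : Type u₁} [Category.{v₁} C] [Abelian C] [HasExt.{w₁} C]
variable {U : C ⥤ ModuleCat.{u} R} [U.Additive] [PreservesFiniteLimits U]
  [PreservesFiniteColimits U] [U.Faithful] {F : ∀ M, U.obj M →ₛₗ[σ] U.obj M}
variable {l : ℕ} [Fact l.Prime] [IsDomain R] [IsPrincipalIdealRing R] [Algebra ℤ_[l] R] {K : Type*}
  [Field K] [Algebra R K] [Algebra ℚ_[l] K] [IsFractionRing R K] {σK : K →ₐ[ℚ_[l]] K} {r : ℕ}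

/-- Passing to the free quotients changes neither `π ⊗ K` up to isomorphism nor `z(f) [Ext²]`. There
the descriptions of Hom and Ext¹ as kernel and cokernel turn the edge map into the map `u ↦ c u F`
of lattices. -/
theorem IsSemilinearCat.zInv_edgeHom (hU : IsSemilinearCat U F) (h : IsFrobeniusExt σ σK r)
    (hσ : ∀ x, Associated (σ x) x) (hF : ∀ M x, F M x = 0 → ∃ a : R, a ≠ 0 ∧ a • x = 0)
    (π : ∀ M, U.obj M →ₗ[R] U.obj M) (hπ : ∀ M x, π M x = (F M)^[r + 1] x) {c : R}
    (hc : ∑ i ∈ Finset.range (r + 1), σ^[i] c = 1) (j : K →ₐ[ℚ_[l]] PadicAlgCl l) (M N : C) :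
    haveI := hU.finite M
    haveI := hU.finite N
    Finite (Abelian.Ext M N 2) ∧
    (NoCommonMultipleRoot (minpoly K ((π M).baseChange K)) (minpoly K ((π N).baseChange K)) →
      ZDefined (hU.edgeHom c M N) ∧
      (zInv (hU.edgeHom c M N) : ℝ) * Nat.card (Abelian.Ext M N 2) =
        ‖j (LinearMap.det ((π M).baseChange K))‖ ^ Module.finrank R (U.obj N) *
        ‖pairProduct (((π M).baseChange K).charpoly.map (j : K →+* PadicAlgCl l))
          (((π N).baseChange K).charpoly.map (j : K →+* PadicAlgCl l))‖) := by
  have := hU.finite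
  obtain ⟨M', N', q, q', ⟨h1, h2, h3⟩, ⟨h1', h2', h3'⟩, h4, h5⟩ := hU.edgeHom_of_free h.bijective hσ
    (fun a ha => h.finite_quotient ha) c M N
  have nat : ∀ {M M' : C} (q : M ⟶ M') x, (U.map q).hom (π M x) = π M' ((U.map q).hom x) := by
    intro M M' q x
    rw [hπ, hπ]
    exact (Function.Semiconj.iterate_right (f := (U.map q).hom) (hU.nat q) (r + 1)) x
  obtain ⟨m1, c1, d1, -⟩ := baseChange_invariants (K := K) h2 h3 (nat q)
  obtain ⟨m2, c2, -, r2⟩ := baseChange_invariants (K := K) h2' h3' (nat q')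
  refine ⟨h4, fun hMN => ?_⟩
  have hF' : ∀ x, F M' x = 0 → x = 0 := fun x hx => by
    obtain ⟨a, ha, hx⟩ := hF M' x hx
    exact (smul_eq_zero.1 hx).resolve_left ha
  let f : (semilinearComm (F M') (F N')).ker →+
      (U.obj M' →ₛₗ[σ] U.obj N') ⧸ (semilinearComm (F M') (F N')).range :=
    (QuotientAddGroup.mk' _).comp (AddMonoidHom.mk' (fun u => c • (u : U.obj M' →ₗ[R] U.obj N').comp (F M'))
      fun u v => by
        ext x
        simp)
  obtain ⟨z, e⟩ := h.zInv_semilinear hF' (hπ M') (hπ N') hc j (by rwa [m1, m2]) f fun u => rfl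
  have hsq : ∀ u, hU.extOneEquiv M' N' (f (hU.homEquiv M' N' u)) = hU.edgeHom c M' N' u := fun u =>
    (hU.extOneEquiv_mk _).trans rfl
  have hsq' : ∀ u, f (hU.homEquiv M' N' u) = (hU.extOneEquiv M' N').symm (hU.edgeHom c M' N' u) :=
    fun u => by rw [← hsq, AddEquiv.symm_apply_apply]
  obtain ⟨z', e'⟩ := h5 ((zDefined_congr _ _ hsq').2 z)
  refine ⟨z', ?_⟩
  rw [zInv_congr _ _ hsq'] at e'
  rw [← r2, ← c1, ← c2, ← d1, ← e, ← e']
  push_cast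
  rfl

end Category

/-! ### Semilinear isogenies -/

section Construction

universe u₂

variable {R : Type u₂} [CommRing R] {σ : R →+* R} {A B : Type*} [AddCommGroup A] [Module R A]
  [AddCommGroup B] [Module R B]

/-- The cokernel of the semilinear endomorphism `F` is killed by an element of `S`. -/
def IsIsogeny (S : Submonoid R) (F : A →ₛₗ[σ] A) : Prop := ∃ a ∈ S, ∀ x, ∃ y, F y = a • x

/-- The endomorphism of `B × A` given by `FB`, `FA` and `φ : A → B`. -/
def semilinearTwist (FA : A →ₛₗ[σ] A) (FB : B →ₛₗ[σ] B) (φ : A →ₛₗ[σ] B) : B × A →ₛₗ[σ] B × A where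
  toFun x := (FB x.1 + φ x.2, FA x.2)
  map_add' x y := by
    simp only [Prod.fst_add, Prod.snd_add, map_add, Prod.mk_add_mk]
    rw [add_add_add_comm]
  map_smul' c x := by
    simp only [Prod.smul_fst, Prod.smul_snd, LinearMap.map_smulₛₗ, Prod.smul_mk, smul_add]

variable {S : Submonoid R} (hσ : Function.Surjective σ)

include hσ

/-- First solve in the quotient `A`, then correct the component in `B` by the value of `φ`;
surjectivity of `σ` allows scalars to be moved through the semilinear maps. -/
theorem IsIsogeny.twist {FA : A →ₛₗ[σ] A} {FB : B →ₛₗ[σ] B} (hA : IsIsogeny S FA)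
    (hB : IsIsogeny S FB) (φ : A →ₛₗ[σ] B) : IsIsogeny S (semilinearTwist FA FB φ) := by
  obtain ⟨s, hs, hA⟩ := hA
  obtain ⟨t, ht, hB⟩ := hB
  refine ⟨t * s, S.mul_mem ht hs, fun ⟨y, x⟩ => ?_⟩
  obtain ⟨t', rfl⟩ := hσ t
  obtain ⟨x', hx⟩ := hA x
  obtain ⟨y', hy⟩ := hB (s • y - φ x')
  refine ⟨(y', t' • x'), Prod.ext ?_ ?_⟩
  · change FB y' + φ (t' • x') = _
    rw [LinearMap.map_smulₛₗ, hy, smul_sub, sub_add_cancel, smul_smul]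
    rfl
  · change FA (t' • x') = _
    rw [LinearMap.map_smulₛₗ, hx, smul_smul]
    rfl

omit hσ in
theorem IsIsogeny.of_surjective {FA : A →ₛₗ[σ] A} {FB : B →ₛₗ[σ] B} (hA : IsIsogeny S FA)
    {q : A →ₗ[R] B} (hq : Function.Surjective q) (h : ∀ x, q (FA x) = FB (q x)) :
    IsIsogeny S FB := by
  obtain ⟨s, hs, hA⟩ := hA
  refine ⟨s, hs, fun x => ?_⟩
  obtain ⟨x, rfl⟩ := hq x
  obtain ⟨y, hy⟩ := hA x
  exact ⟨q y, by rw [← h, hy, map_smul]⟩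

/-- A module with an isogeny is a quotient of a free module with an isogeny. -/
theorem IsIsogeny.exists_cover {FA : A →ₛₗ[σ] A} (hA : IsIsogeny S FA) {n : ℕ}
    {p : (Fin n → R) →ₗ[R] A} (hp : Function.Surjective p) :
    ∃ (Θ : (Fin n → R) × (Fin n → R) →ₛₗ[σ] (Fin n → R) × (Fin n → R)),
      IsIsogeny S Θ ∧ ∀ x, p (Θ x).1 = FA (p x.1) := by
  obtain ⟨a, ha, hA⟩ := hA
  let τ : (Fin n → R) →ₛₗ[σ] (Fin n → R) :=
    { toFun x i := σ (x i)
      map_add' x y := by ext; simp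
      map_smul' c x := by ext; simp }
  have hτ : Function.Surjective τ := fun x => by
    choose y hy using fun i => hσ (x i)
    exact ⟨y, funext hy⟩
  have hsum : ∀ v : Fin n → R, v = ∑ i, v i • Pi.single i (1 : R) := fun v => by
    ext j
    simp [Finset.sum_apply, Pi.single_apply]
  choose g hg using fun i => hp (FA (p (Pi.single i 1)))
  choose h hh using fun i => hA (p (Pi.single i 1))
  choose h' hh' using fun i => hp (h i)
  let φ : (Fin n → R) →ₛₗ[σ] (Fin n → R) := (Fintype.linearCombination R g).comp τ
  let ψ : (Fin n → R) →ₗ[R] (Fin n → R) := Fintype.linearCombination R h'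
  have hφ : ∀ x, p (φ x) = FA (p x) := fun x => by
    conv_rhs => rw [hsum x]
    simp [φ, τ, Fintype.linearCombination_apply, hg]
  have hψ : ∀ x, FA (p (ψ x)) = a • p (τ x) := fun x => by
    conv_rhs => rw [hsum (τ x)]
    simp [ψ, τ, Fintype.linearCombination_apply, hh', hh, Finset.smul_sum, smul_comm a]
  let d : (Fin n → R) × (Fin n → R) →ₗ[R] (Fin n → R) :=
    LinearMap.fst R _ _ + ψ.comp (LinearMap.snd R _ _)
  -- A lift `φ` of `F` to `R ^ n` need not be an isogeny, so a second copy of `R ^ n` is added: `Θ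
  -- (x, y) = (φ (x + ψ y) - a τ y, τ (x + ψ y))`. Since `ψ` lifts the division of `a` by `F`, the
  -- terms in `y` cancel after `p`, and `a (u, v)` has an explicit preimage.
  refine ⟨(LinearMap.inl R _ _).comp (φ.comp d - a • τ.comp (LinearMap.snd R _ _)) +
    (LinearMap.inr R _ _).comp (τ.comp d), ⟨a, ha, fun ⟨u, v⟩ => ?_⟩, fun ⟨x, y⟩ => ?_⟩
  · obtain ⟨a', rfl⟩ := hσ a
    obtain ⟨z, hz⟩ := hτ v
    obtain ⟨y, hy⟩ := hτ (φ z - u)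
    refine ⟨(a' • z - ψ y, y), ?_⟩
    have : d (a' • z - ψ y, y) = a' • z := sub_add_cancel _ _
    refine Prod.ext ?_ ?_
    · simp [this, hy, hz, smul_sub]
    · simp [this, hz]
  · simp [d, hφ, hψ]

end Construction

/-! ### Kernels of isogenies -/

section DetIsogeny

variable {R : Type*} [CommRing R] [IsDomain R] [IsPrincipalIdealRing R] {σ : R →+* R} {S : Submonoid R}
  {A : Type*} [AddCommGroup A] [Module R A] [Module.Finite R A]

theorem semilinearMatrix_comp {m : Type*} [Fintype m] [DecidableEq m] (b : Module.Basis m R A)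
    (F : A →ₛₗ[σ] A) (s : A →ₗ[R] A) :
    semilinearMatrix b b (F.comp s) = semilinearMatrix b b F * (LinearMap.toMatrix b b s).map σ := by
  ext i j
  have h1 : s (b j) = ∑ k, LinearMap.toMatrix b b s k j • b k := by
    simp only [LinearMap.toMatrix_apply, b.sum_repr]
  rw [semilinearMatrix, Matrix.of_apply, LinearMap.comp_apply, h1, semilinear_apply b b,
    b.repr_sum_self]
  rfl

/-- A linear map `n` with `F ∘ n` sending each basis vector to its multiple by `a` exists, so the
determinant of `F` divides a power of `a` and is not zero. -/
theorem IsIsogeny.eq_zero_of_free [Module.Free R A] (hσ : Function.Bijective σ) (hS : 0 ∉ S)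
    {F : A →ₛₗ[σ] A} (hF : IsIsogeny S F) {x : A} (hx : F x = 0) : x = 0 := by
  obtain ⟨a, ha, hF⟩ := hF
  let b := Module.finBasis R A
  choose n hn using fun i => hF (b i)
  have h1 := semilinearMatrix_comp b F (b.constr R n)
  have h2 : semilinearMatrix b b (F.comp (b.constr R n)) = a • 1 := by
    ext i j
    simp [semilinearMatrix, hn, Finsupp.single_apply, Matrix.one_apply, eq_comm]
  have hdet : (semilinearMatrix b b F).det ≠ 0 := fun h => by
    have h3 := congrArg Matrix.det (h2.symm.trans h1)
    rw [Matrix.det_mul, h, zero_mul, Matrix.det_smul, Matrix.det_one, mul_one] at h3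
    exact hS (eq_zero_of_pow_eq_zero h3 ▸ ha)
  have h3 := semilinear_apply b b F (b.repr x)
  rw [b.sum_repr, hx] at h3
  have h4 := Fintype.linearIndependent_iff.1 b.linearIndependent _ h3.symm
  have h5 := Matrix.eq_zero_of_mulVec_eq_zero hdet (funext h4)
  refine b.ext_elem fun i => hσ.1 ?_
  simpa using congrFun h5 i

/-- The endomorphism induced on the quotient by the torsion. -/
def torsionQuotientMap (hσ : Function.Injective σ) (F : A →ₛₗ[σ] A) :
    A ⧸ Submodule.torsion R A →ₛₗ[σ] A ⧸ Submodule.torsion R A :=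
  Submodule.mapQ _ _ F fun x hx => by
    obtain ⟨a, ha⟩ := (Submodule.mem_torsion_iff x).1 hx
    refine (Submodule.mem_torsion_iff _).2
      ⟨⟨σ a, mem_nonZeroDivisors_of_ne_zero ((map_ne_zero_iff σ hσ).2 (nonZeroDivisors.coe_ne_zero a))⟩, ?_⟩
    have := congrArg F ha
    rw [map_zero] at this
    exact (F.map_smulₛₗ (a : R) x).symm.trans this

theorem IsIsogeny.mem_torsion (hσ : Function.Bijective σ) (hS : 0 ∉ S)
    {F : A →ₛₗ[σ] A} (hF : IsIsogeny S F) {x : A} (hx : F x = 0) : x ∈ Submodule.torsion R A := by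
  have h1 : IsIsogeny S (torsionQuotientMap hσ.1 F) :=
    hF.of_surjective (Submodule.mkQ_surjective _) fun x => rfl
  have h2 := h1.eq_zero_of_free hσ hS (x := Submodule.Quotient.mk x) (by
    change Submodule.Quotient.mk (F x) = _
    rw [hx, Submodule.Quotient.mk_zero])
  exact (Submodule.Quotient.mk_eq_zero _).1 h2

end DetIsogeny

/-! ### A criterion for semilinear categories -/

section Category

universe v₁ u₁ w₁ u₂

variable {R : Type u₂} [CommRing R] [IsDomain R] [IsPrincipalIdealRing R] {σ : R →+* R}
variable {C : Type u₁} [Category.{v₁} C] [Abelian C] [HasExt.{w₁} C]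
variable {U : C ⥤ ModuleCat.{max u u₂} R} [U.Additive] [PreservesFiniteLimits U]
  [PreservesFiniteColimits U] [U.Faithful] {F : ∀ M, U.obj M →ₛₗ[σ] U.obj M}

/-- Once every finitely generated module with an isogeny is realized by an object, twisted
extensions live on `N × M`, covers come from the doubled free module, and free quotients from
division by torsion. -/
theorem isSemilinearCat_of_isIsogeny (hσ : Function.Bijective σ) (S : Submonoid R)
    (nat : ∀ {M N : C} (f : M ⟶ N) (x : U.obj M), (U.map f).hom (F M x) = F N ((U.map f).hom x))
    (full : ∀ {M N : C} (g : U.obj M →ₗ[R] U.obj N), (∀ x, g (F M x) = F N (g x)) →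
      ∃ f : M ⟶ N, (U.map f).hom = g)
    (finite : ∀ M, Module.Finite R (U.obj M)) (isogeny : ∀ M, IsIsogeny S (F M))
    (realize : ∀ (V : Type (max u u₂)) [AddCommGroup V] [Module R V] [Module.Finite R V] (FV : V →ₛₗ[σ] V),
      IsIsogeny S FV → ∃ (M : C) (e : U.obj M ≃ₗ[R] V), ∀ x, e (F M x) = FV (e x)) :
    IsSemilinearCat U F where
  nat := nat
  full := full
  finite := finite
  exists_isTwist {M N} φ := by
    have := finite M
    have := finite N
    obtain ⟨E, e, he⟩ := realize (U.obj N × U.obj M) (semilinearTwist (F M) (F N) φ)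
      ((isogeny M).twist hσ.2 (isogeny N) φ)
    have he' : ∀ x, F E (e.symm x) = e.symm (semilinearTwist (F M) (F N) φ x) := fun x => by
      rw [LinearEquiv.eq_symm_apply, he, e.apply_symm_apply]
    obtain ⟨i, hi⟩ := full (M := N) (N := E) (e.symm.toLinearMap ∘ₗ LinearMap.inl R _ _) fun x => by
      simp [he', semilinearTwist]
    obtain ⟨q, hq⟩ := full (M := E) (N := M) (LinearMap.snd R _ _ ∘ₗ e.toLinearMap) fun x => by
      simp [he, semilinearTwist]
    have w : i ≫ q = 0 := by
      apply U.map_injective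
      ext x
      simp [hi, hq]
    have hS : (ShortComplex.mk i q w).ShortExact := by
      have h1 : Mono (U.map i) := (ModuleCat.mono_iff_injective _).2 (by
        change Function.Injective (U.map i).hom
        rw [hi]
        exact e.symm.injective.comp fun x y h => congrArg Prod.fst h)
      have h2 : Epi (U.map q) := (ModuleCat.epi_iff_surjective _).2 (by
        change Function.Surjective (U.map q).hom
        rw [hq]
        exact Prod.snd_surjective.comp e.surjective)
      have h3 : Mono i := U.mono_of_mono_map h1
      have h4 : Epi q := U.epi_of_epi_map h2
      refine { exact := ?_ }
      rw [← ShortComplex.exact_map_iff_of_faithful _ U, ShortComplex.moduleCat_exact_iff]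
      have key : ∀ x : U.obj E, (U.map q).hom x = 0 → ∃ y, (U.map i).hom y = x := fun x hx => by
        have hx' : (e x).2 = 0 := (LinearMap.congr_fun hq x).symm.trans hx
        refine ⟨(e x).1, (LinearMap.congr_fun hi _).trans ?_⟩
        change e.symm ((e x).1, 0) = x
        rw [← hx', Prod.mk.eta, LinearEquiv.symm_apply_apply]
      exact key
    refine ⟨_, E, i, q, w, hS, e.symm.toLinearMap ∘ₗ LinearMap.inr R _ _, fun x => ?_, fun x => ?_, rfl⟩
    · rw [hq]
      simp
    · rw [hi]
      simp [he', semilinearTwist, ← map_add]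
  exists_cover M := by
    have := finite M
    obtain ⟨n, p, hp⟩ := Module.Finite.exists_fin' R (U.obj M)
    obtain ⟨Θ, hΘ, h⟩ := (isogeny M).exists_cover hσ.2 hp
    let e' : ULift.{max u u₂} ((Fin n → R) × (Fin n → R)) ≃ₗ[R] (Fin n → R) × (Fin n → R) := ULift.moduleEquiv
    obtain ⟨P, e, he⟩ := realize (ULift.{max u u₂} ((Fin n → R) × (Fin n → R)))
      (e'.symm.toLinearMap.comp (Θ.comp e'.toLinearMap))
      (hΘ.of_surjective (q := e'.symm.toLinearMap) e'.symm.surjective fun x => by simp)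
    obtain ⟨q, hq⟩ := full (M := P) (N := M)
      (p ∘ₗ LinearMap.fst R _ _ ∘ₗ e'.toLinearMap ∘ₗ e.toLinearMap) fun x => by
      simp [he, h]
    refine ⟨P, q, U.epi_of_epi_map ((ModuleCat.epi_iff_surjective _).2 ?_),
      Module.Free.of_equiv (e.trans e').symm⟩
    change Function.Surjective (U.map q).hom
    rw [hq]
    exact hp.comp (Prod.fst_surjective.comp (e'.surjective.comp e.surjective))
  exists_quotient M := by
    have := finite M
    obtain ⟨N, e, he⟩ := realize (U.obj M ⧸ Submodule.torsion R (U.obj M))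
      (torsionQuotientMap hσ.1 (F M))
      ((isogeny M).of_surjective (Submodule.mkQ_surjective _) fun x => rfl)
    obtain ⟨q, hq⟩ := full (M := M) (N := N) (e.symm.toLinearMap ∘ₗ Submodule.mkQ _) fun x => by
      rw [LinearMap.comp_apply, LinearEquiv.coe_coe, LinearEquiv.symm_apply_eq, he]
      simp [torsionQuotientMap]
    refine ⟨N, q, U.epi_of_epi_map ((ModuleCat.epi_iff_surjective _).2 ?_), Module.Free.of_equiv e.symm,
      fun x hx => ?_⟩
    · change Function.Surjective (U.map q).hom
      rw [hq]
      exact e.symm.surjective.comp (Submodule.mkQ_surjective _)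
    · rw [hq] at hx
      have h1 : Submodule.mkQ (Submodule.torsion R (U.obj M)) x = 0 := e.symm.map_eq_zero_iff.1 hx
      rw [Submodule.mkQ_apply, Submodule.Quotient.mk_eq_zero, Submodule.mem_torsion_iff] at h1
      obtain ⟨a, ha⟩ := h1
      exact ⟨a, nonZeroDivisors.coe_ne_zero a, ha⟩

end Category

/-! ### Approximating Galois automorphisms by powers of the Frobenius -/

namespace LRep

section Galois

variable {k : Type u} [Field k] [Fintype k]

theorem frobGen_pow_apply (j : ℕ) (x : AlgebraicClosure k) :
    (frobGen k ^ j) x = x ^ Fintype.card k ^ j := by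
  rw [AlgEquiv.coe_pow, FiniteField.coe_frobeniusAlgEquivOfAlgebraic_iterate]

theorem exists_frobGen_pow_eq (L : IntermediateField k (AlgebraicClosure k)) [FiniteDimensional k L]
    (g : Gal(AlgebraicClosure k/k)) : ∃ j : ℕ, ∀ x ∈ L, g x = (frobGen k ^ j) x := by
  have : Finite L := Module.finite_of_finite k
  obtain ⟨j, hj⟩ := (FiniteField.bijective_frobeniusAlgEquivOfAlgebraic_pow k L).2 (g.restrictNormal L)
  refine ⟨j, fun x hx => ?_⟩
  have h1 := AlgEquiv.restrictNormal_commutes g L ⟨x, hx⟩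
  rw [← hj] at h1
  refine h1.symm.trans ?_
  rw [frobGen_pow_apply]
  simp only [AlgEquiv.coe_pow, FiniteField.coe_frobeniusAlgEquivOfAlgebraic_iterate, map_pow]
  rfl

theorem exists_frobGen_pow_inv_mul_mem (g : Gal(AlgebraicClosure k/k))
    {W : Set Gal(AlgebraicClosure k/k)} (hW : W ∈ nhds 1) : ∃ j : ℕ, (frobGen k ^ j)⁻¹ * g ∈ W := by
  obtain ⟨L, _, hL⟩ := (krullTopology_mem_nhds_one_iff _ _ _).1 hW
  obtain ⟨j, hj⟩ := exists_frobGen_pow_eq L g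
  refine ⟨j, hL ?_⟩
  rw [SetLike.mem_coe, IntermediateField.mem_fixingSubgroup_iff]
  intro x hx
  rw [AlgEquiv.mul_apply, hj x hx, ← AlgEquiv.mul_apply, inv_mul_cancel, AlgEquiv.one_apply]

/-- `g` acts as the `j`th power of the Frobenius on the extension of `k` of degree `m`. -/
def AgreesWith (g : Gal(AlgebraicClosure k/k)) (j m : ℕ) : Prop :=
  ∀ x : AlgebraicClosure k, x ^ Fintype.card k ^ m = x → g x = (frobGen k ^ j) x

theorem card_frob_fixed {m : ℕ} (hm : 0 < m) :
    {x : AlgebraicClosure k | x ^ Fintype.card k ^ m = x}.Finite ∧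
    {x : AlgebraicClosure k | x ^ Fintype.card k ^ m = x}.ncard = Fintype.card k ^ m := by
  classical
  obtain ⟨p, hp⟩ := CharP.exists k
  obtain ⟨n, hp', hn⟩ := FiniteField.card k p
  have := Fact.mk hp'
  have : CharP (AlgebraicClosure k) p := charP_of_injective_algebraMap (algebraMap k _).injective p
  have h1 : 1 < Fintype.card k ^ m := Nat.one_lt_pow hm.ne' Fintype.one_lt_card
  have hne := FiniteField.X_pow_card_sub_X_ne_zero (AlgebraicClosure k) h1
  have hset : {x : AlgebraicClosure k | x ^ Fintype.card k ^ m = x} =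
      (X ^ (Fintype.card k ^ m) - X : (AlgebraicClosure k)[X]).rootSet (AlgebraicClosure k) := by
    ext x
    rw [mem_rootSet]
    simp [hne, sub_eq_zero]
  rw [hset]
  refine ⟨rootSet_finite _ _, ?_⟩
  rw [Set.ncard_eq_toFinset_card', Set.toFinset_card,
    card_rootSet_eq_natDegree (galois_poly_separable p _ ?_) (IsAlgClosed.splits _),
    FiniteField.X_pow_card_sub_X_natDegree_eq _ h1]
  rw [hn, ← pow_mul]
  exact dvd_pow_self p (Nat.mul_pos n.pos hm).ne'

theorem finiteDimensional_adjoin_frob_fixed {m : ℕ} (hm : 0 < m) : FiniteDimensional k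
    (IntermediateField.adjoin k {x : AlgebraicClosure k | x ^ Fintype.card k ^ m = x}) := by
  have : Finite {x : AlgebraicClosure k | x ^ Fintype.card k ^ m = x} := (card_frob_fixed hm).1
  exact IntermediateField.finiteDimensional_adjoin fun x _ => Algebra.IsIntegral.isIntegral x

theorem AgreesWith.exists (g : Gal(AlgebraicClosure k/k)) {m : ℕ} (hm : 0 < m) :
    ∃ j, AgreesWith g j m := by
  have := finiteDimensional_adjoin_frob_fixed (k := k) hm
  obtain ⟨j, hj⟩ := exists_frobGen_pow_eq
    (IntermediateField.adjoin k {x : AlgebraicClosure k | x ^ Fintype.card k ^ m = x}) g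
  exact ⟨j, fun x hx => hj x (IntermediateField.subset_adjoin _ _ hx)⟩

theorem AgreesWith.eventually {m : ℕ} (hm : 0 < m) :
    ∀ᶠ g in nhds (1 : Gal(AlgebraicClosure k/k)), AgreesWith g 0 m := by
  have := finiteDimensional_adjoin_frob_fixed (k := k) hm
  refine (krullTopology_mem_nhds_one_iff _ _ _).2 ⟨_, this, fun g hg x hx => ?_⟩
  exact (IntermediateField.mem_fixingSubgroup_iff _ _).1 hg x (IntermediateField.subset_adjoin _ _ hx)

/-- Let `e` be the remainder of `j - i` modulo `m`. The `q ^ m` elements fixed by `γ ^ m` are fixed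
by `γ ^ e`, which for `0 < e < m` has only `q ^ e` fixed elements. -/
theorem AgreesWith.modEq_of_le {g : Gal(AlgebraicClosure k/k)} {i j m : ℕ} (hm : 0 < m) (hij : i ≤ j)
    (hi : AgreesWith g i m) (hj : AgreesWith g j m) : m ∣ j - i := by
  have h1 : ∀ x : AlgebraicClosure k, x ^ Fintype.card k ^ m = x →
      (frobGen k ^ (j - i)) x = x := fun x hx => by
    refine (frobGen k ^ i).injective ?_
    rw [← AlgEquiv.mul_apply, ← pow_add, Nat.add_sub_cancel' hij, ← hi x hx, ← hj x hx]
  have h2 : ∀ x : AlgebraicClosure k, x ^ Fintype.card k ^ m = x →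
      (frobGen k ^ ((j - i) % m)) x = x := fun x hx => by
    have h3 : ∀ c : ℕ, (frobGen k ^ (m * c)) x = x := fun c => by
      rw [pow_mul, AlgEquiv.coe_pow]
      exact Function.iterate_fixed (by rw [frobGen_pow_apply, hx]) c
    conv_lhs => rw [← h3 ((j - i) / m)]
    rw [← AlgEquiv.mul_apply, ← pow_add, Nat.mod_add_div, h1 x hx]
  rw [Nat.dvd_iff_mod_eq_zero]
  by_contra h
  obtain ⟨f, hf⟩ := card_frob_fixed (k := k) (Nat.pos_of_ne_zero h)
  obtain ⟨-, hf'⟩ := card_frob_fixed (k := k) hm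
  have h3 := Set.ncard_le_ncard (s := {x : AlgebraicClosure k | x ^ Fintype.card k ^ m = x})
    (fun x hx => by
      have := h2 x hx
      rwa [frobGen_pow_apply] at this) f
  rw [hf, hf', Nat.pow_le_pow_iff_right Fintype.one_lt_card] at h3
  exact absurd (Nat.mod_lt (j - i) hm) (not_lt.2 h3)

theorem AgreesWith.of_dvd {g : Gal(AlgebraicClosure k/k)} {j m m' : ℕ} (h : AgreesWith g j m')
    (hm : m ∣ m') : AgreesWith g j m := fun x hx => h x (by
  obtain ⟨c, rfl⟩ := hm
  rw [← frobGen_pow_apply, pow_mul, AlgEquiv.coe_pow]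
  exact Function.iterate_fixed (by rw [frobGen_pow_apply, hx]) c)

theorem AgreesWith.mul {g h : Gal(AlgebraicClosure k/k)} {i j m : ℕ} (hg : AgreesWith g i m)
    (hh : AgreesWith h j m) : AgreesWith (g * h) (i + j) m := fun x hx => by
  rw [AlgEquiv.mul_apply, hh x hx, hg, pow_add, AlgEquiv.mul_apply]
  rw [← frobGen_pow_apply m, ← AlgEquiv.mul_apply, ← pow_add, add_comm, pow_add, AlgEquiv.mul_apply,
    frobGen_pow_apply m, hx]

end Galois

/-! ### `l`-adic limits in finitely generated modules -/

section Approximation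

variable {l : ℕ} [Fact l.Prime] {V W : Type*} [AddCommGroup V] [Module ℤ_[l] V] [AddCommGroup W]
  [Module ℤ_[l] W]

variable (l V) in
/-- The submodule `l ^ n V`. -/
def lPow (n : ℕ) : Submodule ℤ_[l] V := LinearMap.range (LinearMap.lsmul ℤ_[l] V ((l : ℤ_[l]) ^ n))

theorem mem_lPow {n : ℕ} {x : V} : x ∈ lPow l V n ↔ ∃ w, x = (l : ℤ_[l]) ^ n • w := by
  simp [lPow, eq_comm]

theorem map_mem_lPow (f : V →ₗ[ℤ_[l]] W) {n : ℕ} {x : V} (hx : x ∈ lPow l V n) :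
    f x ∈ lPow l W n := by
  obtain ⟨w, rfl⟩ := mem_lPow.1 hx
  exact mem_lPow.2 ⟨f w, map_smul _ _ _⟩

theorem lPow_le {m n : ℕ} (h : m ≤ n) : lPow l V n ≤ lPow l V m := fun x hx => by
  obtain ⟨w, rfl⟩ := mem_lPow.1 hx
  exact mem_lPow.2 ⟨(l : ℤ_[l]) ^ (n - m) • w, by rw [smul_smul, ← pow_add, Nat.add_sub_cancel' h]⟩

variable [Module.Finite ℤ_[l] V]

theorem eq_of_forall_sub_mem_lPow {x y : V} (h : ∀ n, x - y ∈ lPow l V n) : x = y := by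
  have : IsHausdorff (IsLocalRing.maximalIdeal ℤ_[l]) V :=
    IsHausdorff.of_le_jacobson _ _ (IsLocalRing.maximalIdeal_le_jacobson _)
  rw [← sub_eq_zero]
  refine IsHausdorff.haus this _ fun n => ?_
  rw [SModEq.zero, PadicInt.maximalIdeal_eq_span_p, Ideal.span_singleton_pow]
  obtain ⟨w, hw⟩ := mem_lPow.1 (h n)
  rw [hw]
  exact Submodule.smul_mem_smul (Ideal.mem_span_singleton_self _) trivial

/-- The increments are lifted to a free module, where the series converges coordinatewise by
completeness of `ℤ_l`. -/
theorem exists_limit {x : ℕ → V} (hx : ∀ n, x (n + 1) - x n ∈ lPow l V n) :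
    ∃ y, ∀ n, y - x n ∈ lPow l V n := by
  choose w hw using fun n => mem_lPow.1 (hx n)
  obtain ⟨m, p, hp⟩ := Module.Finite.exists_fin' ℤ_[l] V
  choose u hu using fun n => hp (w n)
  let s : Fin m → ℕ → ℤ_[l] := fun i n => ∑ t ∈ Finset.range n, (l : ℤ_[l]) ^ t * u t i
  have h1 : ∀ i {a b : ℕ}, a ≤ b → s i a ≡ s i b
      [SMOD (IsLocalRing.maximalIdeal ℤ_[l] ^ a • ⊤ : Submodule ℤ_[l] ℤ_[l])] := by
    intro i a b hab
    rw [SModEq.sub_mem, ← neg_mem_iff, neg_sub, PadicInt.maximalIdeal_eq_span_p,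
      Ideal.span_singleton_pow, smul_eq_mul, Ideal.mul_top, Ideal.mem_span_singleton,
      Finset.sum_range_sub_sum_range hab]
    exact Finset.dvd_sum fun t ht => ((pow_dvd_pow _ (by simp at ht; exact ht.2)).mul_right _)
  choose y hy using fun i => IsPrecomplete.prec (I := IsLocalRing.maximalIdeal ℤ_[l]) inferInstance (h1 i)
  have h2 : ∀ n, p (fun i => s i n) = x n - x 0 := fun n => by
    induction n with
    | zero =>
      rw [sub_self, ← map_zero p]
      congr 1
    | succ n ih =>
      have : (fun i => s i (n + 1)) = (fun i => s i n) + (l : ℤ_[l]) ^ n • u n := by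
        ext i
        simp [s, Finset.sum_range_succ]
      rw [this, map_add, ih, map_smul, hu, ← hw]
      abel
  refine ⟨p y + x 0, fun n => ?_⟩
  have h3 : ∀ i, (l : ℤ_[l]) ^ n ∣ y i - s i n := fun i => by
    have := hy i n
    rwa [SModEq.sub_mem, ← neg_mem_iff, neg_sub, PadicInt.maximalIdeal_eq_span_p,
      Ideal.span_singleton_pow, smul_eq_mul, Ideal.mul_top, Ideal.mem_span_singleton] at this
  choose z hz using h3
  refine mem_lPow.2 ⟨p z, ?_⟩
  rw [← map_smul, show (l : ℤ_[l]) ^ n • z = y - fun i => s i n from funext fun i => (hz i).symm,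
    map_sub, h2]
  abel

theorem finite_quotient_lPow (n : ℕ) : Finite (V ⧸ lPow l V n) := by
  have : Finite (ℤ_[l] ⧸ Ideal.span {(l : ℤ_[l]) ^ n}) :=
    Finite.of_equiv _ (Ideal.quotEquivOfEq (PadicInt.ker_toZModPow n).symm |>.trans
      (RingHom.quotientKerEquivOfSurjective (ZMod.ringHom_surjective (PadicInt.toZModPow n)))).symm.toEquiv
  refine finite_of_smul_eq_zero (a := (l : ℤ_[l]) ^ n) fun x => ?_
  obtain ⟨x, rfl⟩ := Submodule.Quotient.mk_surjective _ x
  rw [← Submodule.Quotient.mk_smul, Submodule.Quotient.mk_eq_zero]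
  exact mem_lPow.2 ⟨x, rfl⟩

/-- A surjective `F` permutes the finite set `V / l ^ n V`, and a permutation of a finite set has
finite order. -/
theorem exists_pow_sub_mem_lPow {F : V →ₗ[ℤ_[l]] V} (hF : Function.Surjective F) (n : ℕ) :
    ∃ m, 0 < m ∧ ∀ v, (F ^ m) v - v ∈ lPow l V n := by
  have := finite_quotient_lPow (l := l) (V := V) n
  let F' := (lPow l V n).mapQ (lPow l V n) F fun x => map_mem_lPow F
  have hF' : Function.Bijective F' := Finite.injective_iff_bijective.1
    (Finite.injective_iff_surjective.2 fun x => by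
      obtain ⟨x, rfl⟩ := Submodule.Quotient.mk_surjective _ x
      obtain ⟨x, rfl⟩ := hF x
      exact ⟨Submodule.Quotient.mk x, rfl⟩)
  let e : Equiv.Perm (V ⧸ lPow l V n) := Equiv.ofBijective F' hF'
  refine ⟨orderOf e, orderOf_pos e, fun v => ?_⟩
  have h1 : ∀ m : ℕ, (e ^ m) (Submodule.Quotient.mk v) = Submodule.Quotient.mk ((F ^ m) v) := fun m => by
    induction m with
    | zero => rfl
    | succ m ih =>
      rw [pow_succ', Equiv.Perm.mul_apply, ih, pow_succ']
      rfl
  rw [← Submodule.Quotient.eq, ← h1, pow_orderOf_eq_one, Equiv.Perm.one_apply]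

end Approximation

end LRep

/-! ### Extending the action of the Frobenius to the Galois group -/

namespace LRep

section Extension

variable {l : ℕ} [Fact l.Prime] {k : Type u} [Field k] [Fintype k] {V : Type*} [AddCommGroup V]
  [Module ℤ_[l] V]

theorem pow_sub_mem_lPow {F : V →ₗ[ℤ_[l]] V} {m n : ℕ} (h : ∀ v, (F ^ m) v - v ∈ lPow l V n) (c : ℕ)
    (v : V) : (F ^ (m * c)) v - v ∈ lPow l V n := by
  induction c with
  | zero => simp
  | succ c ih =>
    rw [Nat.mul_succ, pow_add, Module.End.mul_apply]
    have := add_mem (map_mem_lPow (F ^ (m * c)) (h v)) ih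
    rwa [map_sub, sub_add_sub_cancel] at this

theorem AgreesWith.pow_sub_mem {F : V →ₗ[ℤ_[l]] V} {g : Gal(AlgebraicClosure k/k)} {i j m n : ℕ}
    (h : ∀ v, (F ^ m) v - v ∈ lPow l V n) (hm : 0 < m) (hi : AgreesWith g i m)
    (hj : AgreesWith g j m) (v : V) : (F ^ i) v - (F ^ j) v ∈ lPow l V n := by
  wlog hij : i ≤ j generalizing i j
  · rw [← neg_mem_iff, neg_sub]
    exact this hj hi (le_of_not_ge hij)
  obtain ⟨c, hc⟩ := AgreesWith.modEq_of_le hm hij hi hj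
  rw [← Nat.add_sub_cancel' hij, hc, pow_add, Module.End.mul_apply, ← map_sub, ← neg_sub, map_neg,
    neg_mem_iff]
  exact map_mem_lPow _ (pow_sub_mem_lPow h c v)

/-- Both exponents are compared with one that agrees with `g` at the common level `m m'`. -/
theorem AgreesWith.pow_sub_mem' {F : V →ₗ[ℤ_[l]] V} {g : Gal(AlgebraicClosure k/k)} {i j m m' n n' : ℕ}
    (h : ∀ v, (F ^ m) v - v ∈ lPow l V n) (hm : 0 < m) (hi : AgreesWith g i m)
    (h' : ∀ v, (F ^ m') v - v ∈ lPow l V n') (hm' : 0 < m') (hj : AgreesWith g j m') (hn : n ≤ n')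
    (v : V) : (F ^ i) v - (F ^ j) v ∈ lPow l V n := by
  obtain ⟨t, ht⟩ := AgreesWith.exists g (Nat.mul_pos hm hm')
  have h1 := AgreesWith.pow_sub_mem h hm hi (ht.of_dvd (Nat.dvd_mul_right m m')) v
  have h2 := AgreesWith.pow_sub_mem h' hm' (ht.of_dvd (Nat.dvd_mul_left m' m)) hj v
  have := add_mem h1 (lPow_le hn h2)
  rwa [sub_add_sub_cancel] at this

variable [Module.Finite ℤ_[l] V]

/-- `w` is the limit of the `F ^ j v` where `j` runs through integers such that the powers `γ ^ j`
converge to `g`. -/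
def IsLim (F : V →ₗ[ℤ_[l]] V) (g : Gal(AlgebraicClosure k/k)) (v w : V) : Prop :=
  ∀ n m j, 0 < m → (∀ v, (F ^ m) v - v ∈ lPow l V n) → AgreesWith g j m →
    w - (F ^ j) v ∈ lPow l V n

variable {F : V →ₗ[ℤ_[l]] V} (hF : Function.Surjective F)

include hF

theorem IsLim.exists (g : Gal(AlgebraicClosure k/k)) (v : V) : ∃ w, IsLim F g v w := by
  choose m hm h using exists_pow_sub_mem_lPow hF
  choose j hj using fun n => AgreesWith.exists g (hm n)
  obtain ⟨w, hw⟩ := exists_limit (x := fun n => (F ^ (j n)) v) fun n => by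
    rw [← neg_mem_iff, neg_sub]
    exact (hj n).pow_sub_mem' (h n) (hm n) (h (n + 1)) (hm _) (hj _) n.le_succ v
  refine ⟨w, fun n m' j' hm' h' hj' => ?_⟩
  have h1 := (hj n).pow_sub_mem' (h n) (hm n) h' hm' hj' le_rfl v
  have := add_mem (hw n) h1
  rwa [sub_add_sub_cancel] at this

theorem IsLim.unique {g : Gal(AlgebraicClosure k/k)} {v w w' : V} (hw : IsLim F g v w)
    (hw' : ∀ n, ∃ m j, 0 < m ∧ (∀ v, (F ^ m) v - v ∈ lPow l V n) ∧ AgreesWith g j m ∧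
      w' - (F ^ j) v ∈ lPow l V n) : w = w' := by
  refine eq_of_forall_sub_mem_lPow (l := l) fun n => ?_
  obtain ⟨m, j, hm, h, hj, h'⟩ := hw' n
  have := sub_mem (hw n m j hm h hj) h'
  rwa [sub_sub_sub_cancel_right] at this

/-- Define `ρ g v` as the limit of `F ^ j v` along powers `γ ^ j` approximating `g`. Uniqueness of
the limit gives linearity and multiplicativity; continuity holds because elements near 1 are
approximated by `j = 0`. -/
theorem exists_representation : ∃ ρ : Representation ℤ_[l] Gal(AlgebraicClosure k/k) V,
    ρ (frobGen k) = F ∧ ∀ n, ∀ᶠ g in nhds 1, ∀ v, ∃ w, ρ g v - v = (l : ℤ_[l]) ^ n • w := by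
  choose r hr using fun g v => IsLim.exists (k := k) hF g v
  choose m hm h using exists_pow_sub_mem_lPow hF
  have huniq : ∀ (g : Gal(AlgebraicClosure k/k)) v w', (∀ n j, AgreesWith g j (m n) →
      w' - (F ^ j) v ∈ lPow l V n) → r g v = w' := fun g v w' hw' =>
    (hr g v).unique hF fun n => by
      obtain ⟨j, hj⟩ := AgreesWith.exists g (hm n)
      exact ⟨m n, j, hm n, h n, hj, hw' n j hj⟩
  have hr' : ∀ g v n j, AgreesWith g j (m n) → r g v - (F ^ j) v ∈ lPow l V n :=
    fun g v n j hj => hr g v n (m n) j (hm n) (h n) hj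
  let ρ₀ : Gal(AlgebraicClosure k/k) → V →ₗ[ℤ_[l]] V := fun g =>
    { toFun := r g
      map_add' x y := huniq _ _ _ fun n j hj => by
        rw [map_add, add_sub_add_comm]
        exact add_mem (hr' g x n j hj) (hr' g y n j hj)
      map_smul' c x := huniq _ _ _ fun n j hj => by
        rw [map_smul, RingHom.id_apply, ← smul_sub]
        exact Submodule.smul_mem _ _ (hr' g x n j hj) }
  refine ⟨{ toFun := ρ₀, map_one' := LinearMap.ext fun v => ?_, map_mul' a b := LinearMap.ext fun v => ?_ },
    LinearMap.ext fun v => ?_, fun n => ?_⟩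
  · refine huniq _ _ _ fun n j hj => ?_
    have h0 : AgreesWith (1 : Gal(AlgebraicClosure k/k)) 0 (m n) := fun x _ => rfl
    exact h0.pow_sub_mem (h n) (hm n) hj v
  · refine huniq _ _ _ fun n j hj => ?_
    obtain ⟨i, hi⟩ := AgreesWith.exists a (hm n)
    obtain ⟨i', hi'⟩ := AgreesWith.exists b (hm n)
    have h1 := hr' a (r b v) n i hi
    have h2 := map_mem_lPow (F ^ i) (hr' b v n i' hi')
    have h3 := (hi.mul hi').pow_sub_mem (h n) (hm n) hj v
    rw [map_sub, ← Module.End.mul_apply, ← pow_add] at h2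
    have := add_mem (add_mem h1 h2) h3
    rwa [sub_add_sub_cancel, sub_add_sub_cancel] at this
  · refine huniq _ _ _ fun n j hj => ?_
    have h0 : AgreesWith (frobGen k) 1 (m n) := fun x _ => by rw [pow_one]
    have := h0.pow_sub_mem (h n) (hm n) hj v
    rwa [pow_one] at this
  · filter_upwards [AgreesWith.eventually (hm n)] with g hg v
    exact mem_lPow.1 (hr' g v n 0 hg)

end Extension

/-! ### Representations form a semilinear category -/

section Functor

variable (l : ℕ) [Fact l.Prime] (k : Type u) [Field k] [Fintype k]

/-- The underlying module of a representation. -/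
def toModule : FF l k ⥤ ModuleCat.{u} ℤ_[l] := (IsCont l Gal(AlgebraicClosure k/k)).ι ⋙ forget₂ _ _

instance : (toModule l k).Additive := by
  unfold toModule
  infer_instance

instance : (toModule l k).Faithful := by
  unfold toModule
  infer_instance

theorem preservesFiniteLimits_ι {A : Type*} [Category* A] [Abelian A] (P : ObjectProperty A)
    [P.ContainsZero] [P.IsClosedUnderKernels] [P.IsClosedUnderCokernels]
    [P.IsClosedUnderFiniteProducts] : PreservesFiniteLimits P.ι ∧ PreservesFiniteColimits P.ι := by
  have h1 := P.preservesKernels_ι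
  have h2 := P.preservesCokernels_ι
  exact ⟨Functor.preservesFiniteLimits_of_preservesKernels _,
    Functor.preservesFiniteColimits_of_preservesCokernels _⟩

instance : PreservesFiniteLimits (toModule l k) := by
  have := (preservesFiniteLimits_ι (IsCont l Gal(AlgebraicClosure k/k))).1
  have : PreservesFiniteLimits (forget₂ (Rep.{u} ℤ_[l] Gal(AlgebraicClosure k/k)) (ModuleCat.{u} ℤ_[l])) :=
    PreservesLimitsOfSize.preservesFiniteLimits.{u, u} _
  exact comp_preservesFiniteLimits _ _

instance : PreservesFiniteColimits (toModule l k) := by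
  have := (preservesFiniteLimits_ι (IsCont l Gal(AlgebraicClosure k/k))).2
  have : PreservesFiniteColimits (forget₂ (Rep.{u} ℤ_[l] Gal(AlgebraicClosure k/k)) (ModuleCat.{u} ℤ_[l])) :=
    PreservesColimitsOfSize.preservesFiniteColimits.{u, u} _
  exact comp_preservesFiniteColimits _ _

variable {l k}

/-- The action of the Frobenius. -/
def frobAct (M : FF l k) : (toModule l k).obj M →ₛₗ[RingHom.id ℤ_[l]] (toModule l k).obj M :=
  M.obj.ρ (frobGen k)

/-- The powers of `γ` are dense, both actions are continuous, and the target is `l`-adically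
separated. -/
theorem equivariant_of_frobGen {M N : FF l k} (g : M.obj →ₗ[ℤ_[l]] N.obj)
    (hg : ∀ x, g (M.obj.ρ (frobGen k) x) = N.obj.ρ (frobGen k) (g x)) (t : Gal(AlgebraicClosure k/k))
    (x : M.obj) : g (M.obj.ρ t x) = N.obj.ρ t (g x) := by
  obtain ⟨hM, cM⟩ := (isCont_iff _).1 M.property
  obtain ⟨hN, cN⟩ := (isCont_iff _).1 N.property
  have hj : ∀ (j : ℕ) x, g (M.obj.ρ (frobGen k ^ j) x) = N.obj.ρ (frobGen k ^ j) (g x) := fun j x => by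
    induction j with
    | zero => simp
    | succ j ih => rw [pow_succ', map_mul, map_mul, Module.End.mul_apply, hg, ih]; rfl
  refine eq_of_forall_sub_mem_lPow (l := l) fun n => ?_
  obtain ⟨j, h1, h2⟩ := exists_frobGen_pow_inv_mul_mem t ((cM n).and (cN n))
  obtain ⟨w, hw⟩ := h1 x
  obtain ⟨w', hw'⟩ := h2 (g x)
  have e : t = frobGen k ^ j * ((frobGen k ^ j)⁻¹ * t) := by group
  rw [e, map_mul M.obj.ρ, map_mul N.obj.ρ, Module.End.mul_apply, Module.End.mul_apply, hj, ← map_sub]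
  refine map_mem_lPow _ (mem_lPow.2 ⟨g w - w', ?_⟩)
  rw [smul_sub, ← map_smul, ← hw, ← hw', map_sub]
  abel

theorem isSemilinearCat : IsSemilinearCat (toModule l k) frobAct := by
  -- For `S = ⊥` an isogeny is a surjective endomorphism, the condition under which `F` extends to a
  -- representation.
  refine isSemilinearCat_of_isIsogeny (R := ℤ_[l]) (U := toModule l k)
    Function.bijective_id ⊥ ?_ ?_ ?_ ?_ ?_
  · intro M N f x
    exact Rep.hom_comm_apply f.hom _ x
  · intro M N g hg
    exact ⟨⟨Rep.ofHom ⟨g, fun t => LinearMap.ext fun x => equivariant_of_frobGen g hg t x⟩⟩, rfl⟩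
  · exact fun M => M.property.1
  · intro M
    have h : ∀ x : M.obj, M.obj.ρ (frobGen k) (M.obj.ρ (frobGen k)⁻¹ x) = x := fun x => by
      rw [← Module.End.mul_apply, ← map_mul, mul_inv_cancel, map_one, Module.End.one_apply]
    exact ⟨1, Submonoid.mem_bot.2 rfl, fun x =>
      ⟨M.obj.ρ (frobGen k)⁻¹ x, (h x).trans (one_smul ℤ_[l] (x : M.obj)).symm⟩⟩
  · intro V _ _ _ FV hFV
    have hs : Function.Surjective FV := fun x => by
      obtain ⟨a, ha, h⟩ := hFV
      obtain ⟨y, hy⟩ := h x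
      exact ⟨y, by rw [hy, Submonoid.mem_bot.1 ha, one_smul]⟩
    obtain ⟨ρ, h1, h2⟩ := exists_representation (k := k) hs
    refine ⟨⟨Rep.of ρ, (isCont_iff _).2 ⟨inferInstanceAs (Module.Finite ℤ_[l] V), h2⟩⟩,
      LinearEquiv.refl _ _, fun x => LinearMap.congr_fun h1 x⟩

/-- With `σ = id` the definition of the edge relation is literally a twist by `u F`, so `c = 1`. -/
theorem isEdge_iff {M N : FF l k} (u : M ⟶ N) (e : Ext M N 1) :
    IsEdge u e ↔ isSemilinearCat.edgeHom 1 M N u = e := by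
  rw [IsSemilinearCat.edgeHom_apply, one_smul, ← IsSemilinearCat.isTwist_iff]
  rfl

end Functor

end LRep

/-! ### The formula for representations -/

namespace LRep

variable {l : ℕ} [Fact l.Prime] {k : Type u} [Field k] [Fintype k]

variable (l) in
theorem isFrobeniusExt : IsFrobeniusExt (RingHom.id ℤ_[l]) (AlgHom.id ℚ_[l] ℚ_[l]) 0 where
  coe _ := rfl
  comm _ := rfl
  injective := fun i j _ => Fin.ext (by omega)
  pow := rfl
  basis := ⟨Module.Basis.singleton (Fin 1) ℤ_[l], Module.Basis.singleton (Fin 1) ℚ_[l], fun i => by simp⟩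

/-- The determinants of `γ` and `γ⁻¹` are both integral, as seen on the quotient by torsion, and
their product is 1. -/
theorem norm_det_frobQ (M : FF l k) : ‖LinearMap.det (frobQ M)‖ = 1 := by
  have := M.property.1
  have h : ∀ g : Gal(AlgebraicClosure k/k), LinearMap.det ((M.obj.ρ g).baseChange ℚ_[l]) *
      LinearMap.det ((M.obj.ρ g⁻¹).baseChange ℚ_[l]) = 1 := fun g => by
    rw [← map_mul, ← LinearMap.baseChange_mul, ← map_mul, mul_inv_cancel, map_one,
      LinearMap.baseChange_one, map_one]
  have h1 : ∀ f : M.obj →ₗ[ℤ_[l]] M.obj, ‖LinearMap.det (f.baseChange ℚ_[l])‖ ≤ 1 := fun f => by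
    let T := Submodule.torsion ℤ_[l] M.obj
    let f' : M.obj ⧸ T →ₗ[ℤ_[l]] M.obj ⧸ T := torsionQuotientMap (σ := RingHom.id ℤ_[l]) Function.injective_id f
    obtain ⟨-, -, h3, -⟩ := baseChange_invariants (K := ℚ_[l]) (q := T.mkQ) (f := f) (g := f')
      (Submodule.mkQ_surjective T) (fun x hx => by
        rw [Submodule.mkQ_apply, Submodule.Quotient.mk_eq_zero, Submodule.mem_torsion_iff] at hx
        obtain ⟨a, ha⟩ := hx
        exact ⟨a, nonZeroDivisors.coe_ne_zero a, ha⟩) fun x => rfl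
    rw [← h3, LinearMap.det_baseChange]
    exact PadicInt.norm_le_one _
  have h2 := congrArg norm (h (frobGen k))
  rw [norm_mul, norm_one] at h2
  refine le_antisymm (h1 _) ?_
  rw [← h2]
  exact mul_le_of_le_one_right (norm_nonneg _) (h1 _)

theorem rootProduct_eq_pairProduct (P Q : ℚ_[l][X]) : rootProduct P Q =
    pairProduct (P.map (algebraMap ℚ_[l] (PadicAlgCl l))) (Q.map (algebraMap ℚ_[l] (PadicAlgCl l))) := by
  rfl

theorem euler_characteristic_formula (M N : FF l k) :
    (∀ i > 2, Subsingleton (Ext M N i)) ∧ Finite (Ext M N 2) ∧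
      ∃ f : (M ⟶ N) →+ Ext M N 1, (∀ u e, IsEdge u e ↔ f u = e) ∧
        (NoCommonMultipleRoot (minPoly M) (minPoly N) →
          ZDefined f ∧ (zInv f : ℝ) * Nat.card (Ext M N 2) = ‖rootProduct (charPoly M) (charPoly N)‖) := by
  have h := isSemilinearCat.zInv_edgeHom (isFrobeniusExt l) (fun x => Associated.refl x)
    (fun M x hx => ⟨1, one_ne_zero, by
      have h : ∀ x : M.obj, M.obj.ρ (frobGen k) x = 0 → x = 0 := fun x hx => by
        have := congrArg (M.obj.ρ (frobGen k)⁻¹) hx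
        rwa [map_zero, ← Module.End.mul_apply, ← map_mul, inv_mul_cancel, map_one,
          Module.End.one_apply] at this
      exact (one_smul ℤ_[l] (x : M.obj)).trans (h x hx)⟩)
    (fun M => M.obj.ρ (frobGen k)) (fun M x => rfl) (c := 1) (by simp) (Algebra.ofId ℚ_[l] (PadicAlgCl l))
    M N
  refine ⟨fun i hi => isSemilinearCat.subsingleton_ext M N hi, h.1, _, isEdge_iff, fun hMN => ?_⟩
  obtain ⟨h1, h2⟩ := h.2 hMN
  refine ⟨h1, h2.trans ?_⟩
  have h3 : ‖Algebra.ofId ℚ_[l] (PadicAlgCl l) (LinearMap.det (frobQ M))‖ = 1 := by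
    rw [← norm_det_frobQ M]
    exact norm_algebraMap' _ _
  refine (congrArg₂ (· * ·) (congrArg (· ^ _) h3) rfl).trans ?_
  rw [one_pow, one_mul]
  rfl

end LRep

/-! ### `F`-crystals form a semilinear category -/

namespace FCrystal

section Functor

variable (p : ℕ) [Fact p.Prime] (k : Type u) [Field k] [CharP k p] [PerfectRing k p]

/-- The underlying module of an `F`-crystal. -/
def toModule : Cat p k ⥤ ModuleCat.{u} (WittVector p k) :=
  (IsFCrystal p k).ι ⋙ ModuleCat.restrictScalars (SkewPolynomial.CRingHom : WittVector p k →+* DRing p k)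

instance : (toModule p k).Additive := by
  unfold toModule
  infer_instance

instance : (toModule p k).Faithful := by
  unfold toModule
  infer_instance

instance : PreservesFiniteLimits (toModule p k) := by
  have := (LRep.preservesFiniteLimits_ι (IsFCrystal p k)).1
  have : PreservesFiniteLimits (ModuleCat.restrictScalars.{u} (SkewPolynomial.CRingHom : WittVector p k →+* DRing p k)) :=
    ⟨fun J _ _ => ⟨fun {K} => inferInstance⟩⟩
  exact comp_preservesFiniteLimits _ _

instance : PreservesFiniteColimits (toModule p k) := by
  have := (LRep.preservesFiniteLimits_ι (IsFCrystal p k)).2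
  have : PreservesFiniteColimits (ModuleCat.restrictScalars.{u} (SkewPolynomial.CRingHom : WittVector p k →+* DRing p k)) :=
    ⟨fun J _ _ => ⟨fun {K} => inferInstance⟩⟩
  exact comp_preservesFiniteColimits _ _

variable {p k}

/-- The Frobenius endomorphism of the underlying module. -/
def frobAct (M : Cat p k) : (toModule p k).obj M
    →ₛₗ[(WittVector.frobenius : WittVector p k →+* WittVector p k)] (toModule p k).obj M :=
  frob M.obj

theorem exists_hom {M N : ModuleCat.{u} (DRing p k)} (g : M →ₗ[WittVector p k] N)
    (hg : ∀ x, g (frob M x) = frob N (g x)) : ∃ f : M ⟶ N, linMap f = g := by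
  have h (n : ℕ) (x : M) : g ((SkewPolynomial.X : DRing p k) ^ n • x) =
      (SkewPolynomial.X : DRing p k) ^ n • g x := by
    induction n with
    | zero => simp
    | succ n ih =>
      rw [pow_succ', mul_smul, mul_smul, ← ih]
      exact hg _
  refine ⟨ModuleCat.ofHom { toFun := g, map_add' := map_add g, map_smul' := fun d x => ?_ }, rfl⟩
  rw [RingHom.id_apply]
  induction d using SkewPolynomial.induction with
  | h0 => simp
  | ha n a f _ _ hf =>
    rw [add_smul, add_smul, map_add, hf, ← SkewPolynomial.C_mul_X_pow_eq_monomial, mul_smul, mul_smul,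
      ← h, ← smul_def, ← smul_def, map_smul]

variable {V : Type u} [AddCommGroup V] [Module (WittVector p k) V]

/-- The additive endomorphism underlying a semilinear endomorphism. -/
def toAddEnd (F : V →ₛₗ[(WittVector.frobenius : WittVector p k →+* WittVector p k)] V) :
    AddMonoid.End V := F.toAddMonoidHom

/-- The action of `W(k)[F, σ]` given by a `σ`-linear endomorphism. -/
def actionHom (F : V →ₛₗ[(WittVector.frobenius : WittVector p k →+* WittVector p k)] V) :
    DRing p k →+* AddMonoid.End V :=
  SkewMonoidAlgebra.liftNCRingHom (Module.toAddMonoidEnd (WittVector p k) V)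
    (powersHom (AddMonoid.End V) (toAddEnd F)) fun {a n} => by
    have h (n : ℕ) (x : V) : (WittVector.frobenius : WittVector p k →+* WittVector p k)^[n] a •
        (toAddEnd F ^ n) x = (toAddEnd F ^ n) (a • x) := by
      induction n with
      | zero => rfl
      | succ n ih =>
        have h1 (y : V) : (toAddEnd F ^ (n + 1)) y = F ((toAddEnd F ^ n) y) := by
          rw [pow_succ']
          rfl
        rw [h1, h1, ← ih, Function.iterate_succ_apply']
        exact (F.map_smulₛₗ _ _).symm
    exact AddMonoidHom.ext fun x => h n.toAdd x

/-- The module over `W(k)[F, σ]` given by a `σ`-linear endomorphism. -/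
def ofSemilinear (F : V →ₛₗ[(WittVector.frobenius : WittVector p k →+* WittVector p k)] V) :
    ModuleCat.{u} (DRing p k) :=
  letI : Module (DRing p k) V := Module.compHom V (actionHom F)
  ModuleCat.of (DRing p k) V

theorem actionHom_C (F : V →ₛₗ[(WittVector.frobenius : WittVector p k →+* WittVector p k)] V)
    (a : WittVector p k) (x : V) : actionHom F (SkewPolynomial.C a) x = a • x := by
  have : actionHom F (SkewPolynomial.C a) = Module.toAddMonoidEnd (WittVector p k) V a *
      powersHom (AddMonoid.End V) (toAddEnd F) 1 := SkewMonoidAlgebra.liftNC_single _ _ _ _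
  rw [this, map_one, mul_one]
  rfl

theorem actionHom_X (F : V →ₛₗ[(WittVector.frobenius : WittVector p k →+* WittVector p k)] V)
    (x : V) : actionHom F SkewPolynomial.X x = F x := by
  have : actionHom F SkewPolynomial.X = Module.toAddMonoidEnd (WittVector p k) V 1 *
      powersHom (AddMonoid.End V) (toAddEnd F) (Multiplicative.ofAdd 1) :=
    SkewMonoidAlgebra.liftNC_single _ _ _ _
  rw [this, map_one, one_mul, powersHom_apply, toAdd_ofAdd, pow_one]
  rfl

/-- The underlying module of `ofSemilinear F`. -/
def ofSemilinearEquiv (F : V →ₛₗ[(WittVector.frobenius : WittVector p k →+* WittVector p k)] V) :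
    ofSemilinear F ≃ₗ[WittVector p k] V where
  toFun x := x
  invFun x := x
  left_inv _ := rfl
  right_inv _ := rfl
  map_add' _ _ := rfl
  map_smul' := actionHom_C F

theorem ofSemilinearEquiv_frob
    (F : V →ₛₗ[(WittVector.frobenius : WittVector p k →+* WittVector p k)] V) (x : ofSemilinear F) :
    ofSemilinearEquiv F (frob _ x) = F (ofSemilinearEquiv F x) := actionHom_X F x

theorem isFCrystal_ofSemilinear [Module.Finite (WittVector p k) V]
    (F : V →ₛₗ[(WittVector.frobenius : WittVector p k →+* WittVector p k)] V)
    (hF : IsIsogeny (nonZeroDivisors (WittVector p k)) F) : IsFCrystal p k (ofSemilinear F) := by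
  refine ⟨Module.Finite.equiv (ofSemilinearEquiv F).symm, fun x hx => ?_⟩
  obtain ⟨a, ha⟩ := (Submodule.mem_torsion_iff _).1 (hF.mem_torsion (WittVector.frobenius_bijective p k)
    (by simp) (x := ofSemilinearEquiv F x) (by rw [← ofSemilinearEquiv_frob, hx, map_zero]))
  exact (mem_torsion x).2 ⟨a, nonZeroDivisors.coe_ne_zero a, (ofSemilinearEquiv F).injective (by
    rw [map_smul, map_zero]
    exact ha)⟩

/-- Each generator has a nonzero multiple in the image of `F`; the product of these multipliers
works for all elements, after taking preimages of coefficients under `σ`. -/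
theorem isIsogeny_frob {M : ModuleCat.{u} (DRing p k)} (hM : IsFCrystal p k M) :
    IsIsogeny (nonZeroDivisors (WittVector p k)) (frob M) := by
  have := hM.1
  obtain ⟨n, q, hq⟩ := Module.Finite.exists_fin' (WittVector p k) M
  choose a ha y hy using fun i => exists_frob_eq hM (q (Pi.single i 1))
  have hs := (WittVector.frobenius_bijective p k).2
  refine ⟨∏ i, a i, mem_nonZeroDivisors_of_ne_zero (Finset.prod_ne_zero_iff.2 fun i _ => ha i), fun x => ?_⟩
  obtain ⟨v, rfl⟩ := hq x
  choose b hb using fun i => hs (v i * ∏ j ∈ Finset.univ.erase i, a j)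
  refine ⟨∑ i, b i • y i, ?_⟩
  have hv : v = ∑ i, v i • Pi.single i (1 : WittVector p k) := by
    ext1 j
    simp [Finset.sum_apply, Pi.single_apply]
  conv_rhs => rw [hv]
  rw [map_sum, map_sum, Finset.smul_sum]
  refine Finset.sum_congr rfl fun i _ => ?_
  rw [LinearMap.map_smulₛₗ, hb, hy, map_smul, smul_smul, smul_smul,
    ← Finset.mul_prod_erase Finset.univ a (Finset.mem_univ i)]
  congr 1
  ring

theorem isSemilinearCat : IsSemilinearCat (toModule p k) frobAct := by
  refine isSemilinearCat_of_isIsogeny (R := WittVector p k) (U := toModule p k)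
    (WittVector.frobenius_bijective p k) (nonZeroDivisors _) ?_ ?_ ?_ ?_ ?_
  · intro M N f x
    exact linMap_frob f.hom x
  · intro M N g hg
    obtain ⟨f, hf⟩ := exists_hom (M := M.obj) (N := N.obj) g hg
    exact ⟨⟨f⟩, by rw [← hf]; rfl⟩
  · exact fun M => M.property.1
  · exact fun M => isIsogeny_frob M.property
  · intro V _ _ _ FV hFV
    exact ⟨⟨ofSemilinear FV, isFCrystal_ofSemilinear FV hFV⟩, ofSemilinearEquiv FV,
      ofSemilinearEquiv_frob FV⟩

end Functor

end FCrystal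

/-! ### Witt vectors as a cyclic extension of `ℤ_p` -/

namespace FCrystal

section WittVectors

variable {p : ℕ} [Fact p.Prime] {k : Type u} [Field k] [Fintype k] [CharP k p]

theorem deg_pos : 0 < deg p k := by
  by_contra h
  have := card_eq (p := p) (k := k)
  rw [Nat.eq_zero_of_not_pos h, pow_zero] at this
  exact absurd Fintype.one_lt_card this.not_gt

/-- Every nonzero element is a power of `p` times a unit, and `σ` fixes `p`. -/
theorem associated_frobenius (x : WittVector p k) : Associated (WittVector.frobenius x) x := by
  rcases eq_or_ne x 0 with rfl | hx
  · rw [map_zero]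
  obtain ⟨n, c, hc, rfl⟩ := WittVector.exists_eq_pow_p_mul x hx
  obtain ⟨c, rfl⟩ := WittVector.isUnit_of_coeff_zero_ne_zero c hc
  rw [map_mul, map_pow, map_natCast]
  exact (Associated.refl _).mul_mul ((associated_one_iff_isUnit.2 (c.isUnit.map _)).trans
    (associated_one_iff_isUnit.2 c.isUnit).symm)

/-- `W(k)` as an algebra over `ℤ_p`. -/
abbrev algebraZp : Algebra ℤ_[p] (WittVector p k) := (ofZp p k).toAlgebra

/-- `Frac(W(k))` as an algebra over `ℚ_p`. -/
abbrev algebraQp : Algebra ℚ_[p] (FractionRing (WittVector p k)) := (ofQp p k).toAlgebra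

attribute [local instance] algebraZp algebraQp

theorem coeff_zero_ofZp (a : ℤ_[p]) :
    (ofZp p k a).coeff 0 = ZMod.castHom dvd_rfl k (PadicInt.toZMod a) := by
  have h : PadicInt.toZMod (a - ((PadicInt.toZMod a).val : ℤ_[p])) = 0 := by
    rw [map_sub, map_natCast, ZMod.natCast_zmod_val, sub_self]
  rw [← RingHom.mem_ker, PadicInt.ker_toZMod, PadicInt.maximalIdeal_eq_span_p,
    Ideal.mem_span_singleton] at h
  obtain ⟨b, hb⟩ := h
  have h1 : WittVector.constantCoeff (ofZp p k a) = ((PadicInt.toZMod a).val : k) := by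
    have h2 := congrArg (fun y => WittVector.constantCoeff (ofZp p k y)) (sub_eq_iff_eq_add.1 hb)
    refine h2.trans ?_
    simp only [map_add, map_mul, map_natCast, CharP.cast_eq_zero, zero_mul, zero_add]
  refine h1.trans ?_
  conv_rhs => rw [← ZMod.natCast_zmod_val (PadicInt.toZMod a), map_natCast]

theorem eq_zero_of_forall_dvd {K : Type*} [Field K] [CharP K p] [PerfectRing K p] {x : WittVector p K}
    (h : ∀ n : ℕ, (p : WittVector p K) ^ n ∣ x) : x = 0 := by
  ext n
  have h1 := (WittVector.mem_span_p_pow_iff_le_coeff_eq_zero x (n + 1)).1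
    (by
      rw [Ideal.mem_span_singleton]
      exact h (n + 1))
  rw [h1 n n.lt_succ_self, WittVector.zero_coeff]

theorem p_dvd_iff {K : Type*} [Field K] [CharP K p] [PerfectRing K p] {x : WittVector p K} :
    (p : WittVector p K) ∣ x ↔ x.coeff 0 = 0 := by
  rw [← WittVector.mem_span_p_iff_coeff_zero_eq_zero, Ideal.mem_span_singleton]

/-- Teichmüller lifts of a basis of `k` over `𝔽_p` form a basis. A relation is divisible by every
power of `p`, hence trivial, and successive approximation modulo powers of `p` gives generation. -/
theorem exists_basis_zp : Nonempty (Module.Basis (Fin (deg p k)) ℤ_[p] (WittVector p k)) := by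
  classical
  have hp : (p : WittVector p k) ≠ 0 := WittVector.p_nonzero p k
  let _ : Algebra (ZMod p) k := ZMod.algebra k p
  have hrank : Module.finrank (ZMod p) k = deg p k := by
    have h1 := Module.card_eq_pow_finrank (K := ZMod p) (V := k)
    rw [ZMod.card, card_eq (p := p)] at h1
    exact (Nat.pow_right_injective (Fact.out : p.Prime).two_le h1).symm
  let e : Module.Basis (Fin (deg p k)) (ZMod p) k := Module.finBasisOfFinrankEq _ _ hrank
  let x : Fin (deg p k) → WittVector p k := fun i => WittVector.teichmuller p (e i)
  let f := Fintype.linearCombination ℤ_[p] x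
  have hf : ∀ c, (f c).coeff 0 = ∑ i, PadicInt.toZMod (c i) • e i := fun c => by
    change WittVector.constantCoeff (f c) = _
    simp only [f, Fintype.linearCombination_apply, map_sum, Algebra.smul_def, map_mul]
    refine Finset.sum_congr rfl fun i _ => ?_
    exact congrArg₂ (· * ·) (coeff_zero_ofZp (k := k) (c i)) (WittVector.teichmuller_coeff_zero p (e i))
  have hp' : ∀ y : WittVector p k, (p : ℤ_[p]) • y = p * y := fun y => by
    rw [Algebra.smul_def, map_natCast]
  have hdvd : ∀ (a : ℤ_[p]), PadicInt.toZMod a = 0 → ∃ b, a = p * b := fun a ha => by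
    rw [← RingHom.mem_ker, PadicInt.ker_toZMod, PadicInt.maximalIdeal_eq_span_p, Ideal.mem_span_singleton] at ha
    exact ha
  have hinj : Function.Injective f := by
    rw [injective_iff_map_eq_zero]
    have hdiv : ∀ c, f c = 0 → ∃ c', c = (p : ℤ_[p]) • c' ∧ f c' = 0 := fun c hc => by
      have h1 := hf c
      rw [hc, WittVector.zero_coeff] at h1
      have h2 := Fintype.linearIndependent_iff.1 e.linearIndependent _ h1.symm
      choose c' hc' using fun i => hdvd _ (h2 i)
      have h3 : c = (p : ℤ_[p]) • c' := funext hc'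
      refine ⟨c', h3, ?_⟩
      rw [h3, map_smul, hp'] at hc
      exact (mul_eq_zero.1 hc).resolve_left hp
    have hdiv' : ∀ (n : ℕ) c, f c = 0 → ∃ c', c = (p : ℤ_[p]) ^ n • c' ∧ f c' = 0 := fun n => by
      induction n with
      | zero => exact fun c hc => ⟨c, by simp, hc⟩
      | succ n ih =>
        intro c hc
        obtain ⟨c', rfl, h1⟩ := ih c hc
        obtain ⟨c', rfl, h2⟩ := hdiv c' h1
        exact ⟨c', by rw [pow_succ, mul_smul], h2⟩
    refine fun c hc => LRep.eq_of_forall_sub_mem_lPow (l := p) fun n => ?_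
    obtain ⟨c', h, -⟩ := hdiv' n c hc
    exact LRep.mem_lPow.2 ⟨c', by rw [sub_zero, h]⟩
  have hsurj : Function.Surjective f := by
    have h1 : ∀ y : WittVector p k, ∃ c y', y = f c + p * y' := fun y => by
      choose a ha using fun i => ZMod.ringHom_surjective (PadicInt.toZMod (p := p)) (e.repr (y.coeff 0) i)
      have h2 : (p : WittVector p k) ∣ y - f a := by
        rw [p_dvd_iff]
        change WittVector.constantCoeff (y - f a) = 0
        rw [map_sub]
        change y.coeff 0 - (f a).coeff 0 = 0
        rw [hf]
        simp only [ha, e.sum_repr, sub_self]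
      obtain ⟨y', hy'⟩ := h2
      exact ⟨a, y', by rw [← hy']; ring⟩
    choose c g hg using h1
    intro y
    let C : ℕ → Fin (deg p k) → ℤ_[p] := fun n => ∑ t ∈ Finset.range n, (p : ℤ_[p]) ^ t • c (g^[t] y)
    have hC : ∀ n, y - f (C n) = p ^ n * g^[n] y := fun n => by
      induction n with
      | zero => simp [C]
      | succ n ih =>
        have : C (n + 1) = C n + (p : ℤ_[p]) ^ n • c (g^[n] y) := Finset.sum_range_succ _ _
        rw [this, map_add, ← sub_sub, ih, map_smul, Algebra.smul_def, map_pow, map_natCast,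
          Function.iterate_succ_apply']
        have := hg (g^[n] y)
        linear_combination (p : WittVector p k) ^ n * this
    obtain ⟨z, hz⟩ := LRep.exists_limit (l := p) (x := C) fun n =>
      LRep.mem_lPow.2 ⟨c (g^[n] y), by simp [C, Finset.sum_range_succ]⟩
    refine ⟨z, ?_⟩
    rw [← sub_eq_zero]
    refine eq_zero_of_forall_dvd fun n => ?_
    obtain ⟨w, hw⟩ := LRep.mem_lPow.1 (hz n)
    have h2 : f z - y = p ^ n * (f w - g^[n] y) := by
      have h3 : f (z - C n) = p ^ n * f w := by
        rw [hw, map_smul, Algebra.smul_def, map_pow, map_natCast]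
      rw [mul_sub, ← hC, ← h3, map_sub]
      ring
    exact ⟨_, h2⟩
  exact ⟨Module.Basis.ofEquivFun (LinearEquiv.ofBijective f ⟨hinj, hsurj⟩).symm⟩

theorem frobenius_ofZp (x : ℤ_[p]) : WittVector.frobenius (ofZp p k x) = ofZp p k x := by
  ext n
  rw [WittVector.coeff_frobenius_charP]
  change (ZMod.castHom dvd_rfl k _) ^ p = ZMod.castHom dvd_rfl k _
  rw [← map_pow, ZMod.pow_card]

/-- The Frobenius of `Frac(W(k))` as an automorphism over `ℚ_p`. -/
def fracFrob : FractionRing (WittVector p k) →ₐ[ℚ_[p]] FractionRing (WittVector p k) :=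
  { WittVector.FractionRing.frobeniusRingHom p k with
    commutes' := fun x => by
      have h (y : ℤ_[p]) : WittVector.FractionRing.frobeniusRingHom p k (ofQp p k y) = ofQp p k y := by
        rw [ofQp_coe]
        refine Eq.trans ?_ (congrArg (algebraMap (WittVector p k) (FractionRing (WittVector p k)))
          (frobenius_ofZp (k := k) y))
        exact IsFractionRing.ringEquivOfRingEquiv_algebraMap (K := FractionRing (WittVector p k))
          (L := FractionRing (WittVector p k)) (WittVector.frobeniusEquiv p k) _
      obtain ⟨a, b, -, rfl⟩ := IsFractionRing.div_surjective (A := ℤ_[p]) x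
      change WittVector.FractionRing.frobeniusRingHom p k (ofQp p k _) = ofQp p k _
      rw [map_div₀, map_div₀]
      exact congrArg₂ (· / ·) (h a) (h b) }

theorem fracFrob_coe (x : WittVector p k) : fracFrob (p := p) (k := k) (algebraMap _ _ x) =
    algebraMap _ _ (WittVector.frobenius x) :=
  IsFractionRing.ringEquivOfRingEquiv_algebraMap (WittVector.frobeniusEquiv p k) x

theorem fracFrob_pow_coe (n : ℕ) (x : WittVector p k) :
    (fracFrob (p := p) (k := k) ^ n) (algebraMap _ _ x) =
      algebraMap _ _ ((WittVector.frobenius : WittVector p k →+* WittVector p k)^[n] x) := by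
  induction n with
  | zero => rfl
  | succ n ih => rw [pow_succ', AlgHom.mul_apply, ih, fracFrob_coe, Function.iterate_succ_apply']

theorem isFrobeniusExt {r : ℕ} (hr : deg p k = r + 1) :
    IsFrobeniusExt (K := FractionRing (WittVector p k))
    (WittVector.frobenius : WittVector p k →+* WittVector p k) (fracFrob (p := p) (k := k)) r where
  coe x := (ofQp_coe x).symm
  comm := fracFrob_coe
  injective := by
    intro i j hij
    wlog h : i ≤ j generalizing i j
    · exact (this hij.symm (le_of_not_ge h)).symm
    by_contra hne
    have hlt : (i : ℕ) < j := lt_of_le_of_ne h fun h => hne (Fin.ext h)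
    -- Equal powers of `σ` agree on Teichmüller lifts, so all elements of `k` would be roots of `X ^
    -- (p ^ (j - i)) - X`, whose degree is less than `q`.
    have h1 : ∀ x : k, x ^ p ^ (i : ℕ) = x ^ p ^ (j : ℕ) := fun x => by
      have h2 := DFunLike.congr_fun hij (algebraMap _ _ (WittVector.teichmuller p x))
      simp only [fracFrob_pow_coe] at h2
      have h3 := congrArg (fun y => WittVector.coeff y 0) (IsFractionRing.injective _ _ h2)
      simpa [WittVector.iterate_frobenius_coeff, WittVector.teichmuller_coeff_zero] using h3
    have h2 : ∀ x : k, x ^ p ^ ((j : ℕ) - i) = x := fun x => by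
      have h3 := h1 x
      rw [← Nat.sub_add_cancel hlt.le, pow_add, pow_mul] at h3
      exact (iterateFrobenius_inj k p i h3).symm
    have hp := (Fact.out : p.Prime).one_lt
    have h3 : 1 < p ^ ((j : ℕ) - i) := Nat.one_lt_pow (Nat.sub_pos_of_lt hlt).ne' hp
    have h4 := Polynomial.card_roots' (X ^ (p ^ ((j : ℕ) - i)) - X : k[X])
    rw [FiniteField.X_pow_card_sub_X_natDegree_eq _ h3] at h4
    have h5 : Fintype.card k ≤ (X ^ (p ^ ((j : ℕ) - i)) - X : k[X]).roots.card := by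
      classical
      refine le_trans ?_ (Multiset.toFinset_card_le _)
      rw [← Finset.card_univ]
      refine Finset.card_le_card fun x _ => ?_
      rw [Multiset.mem_toFinset, mem_roots (FiniteField.X_pow_card_sub_X_ne_zero k h3)]
      simp [h2]
    have h6 := h5.trans h4
    rw [card_eq (p := p), hr, Nat.pow_le_pow_iff_right hp] at h6
    omega
  pow := by
    rw [← hr]
    refine AlgHom.ext fun x => ?_
    obtain ⟨a, b, -, rfl⟩ := IsFractionRing.div_surjective (A := WittVector p k) x
    rw [map_div₀, fracFrob_pow_coe, fracFrob_pow_coe, frobenius_iterate_deg, frobenius_iterate_deg]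
    rfl
  basis := by
    classical
    obtain ⟨ω⟩ := exists_basis_zp (p := p) (k := k)
    rw [hr] at ω
    have hsm : ∀ (a : ℤ_[p]) (x : WittVector p k), algebraMap (WittVector p k)
        (FractionRing (WittVector p k)) (a • x) = (a : ℚ_[p]) • algebraMap _ _ x := fun a x => by
      rw [Algebra.smul_def, Algebra.smul_def, map_mul]
      exact congrArg (· * _) (ofQp_coe a).symm
    have hli : LinearIndependent ℚ_[p] fun i => algebraMap (WittVector p k)
        (FractionRing (WittVector p k)) (ω i) := by
      rw [Fintype.linearIndependent_iff]
      intro g hg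
      obtain ⟨b, hb⟩ := IsLocalization.exist_integer_multiples_of_finset (nonZeroDivisors ℤ_[p])
        (Finset.univ.image g)
      choose c hc using fun i => hb (g i) (Finset.mem_image_of_mem g (Finset.mem_univ i))
      have hb0 : ((b : ℤ_[p]) : ℚ_[p]) ≠ 0 := by
        rw [Ne, PadicInt.coe_eq_zero]
        exact nonZeroDivisors.coe_ne_zero b
      have hc' : ∀ i, ((c i : ℤ_[p]) : ℚ_[p]) = (b : ℤ_[p]) * g i := fun i =>
        (hc i).trans (Algebra.smul_def _ _)
      have h1 : ∑ i, c i • ω i = 0 := by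
        refine IsFractionRing.injective (WittVector p k) (FractionRing (WittVector p k)) ?_
        rw [map_sum, map_zero]
        simp only [hsm, hc', mul_smul]
        rw [← Finset.smul_sum, hg, smul_zero]
      intro i
      have h2 := Fintype.linearIndependent_iff.1 ω.linearIndependent c h1 i
      have h3 := hc' i
      rw [h2] at h3
      exact (mul_eq_zero.1 (h3.symm.trans PadicInt.coe_zero)).resolve_left hb0
    refine ⟨ω, Module.Basis.mk hli ?_, fun i => Module.Basis.mk_apply _ _ i⟩
    rintro x -
    obtain ⟨a, b, hb, rfl⟩ := IsFractionRing.div_surjective (A := WittVector p k) x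
    obtain ⟨n, c, hc, rfl⟩ := WittVector.exists_eq_pow_p_mul b (nonZeroDivisors.ne_zero hb)
    obtain ⟨c, rfl⟩ := WittVector.isUnit_of_coeff_zero_ne_zero c hc
    have hp : (p : FractionRing (WittVector p k)) ≠ 0 := WittVector.FractionRing.p_nonzero p k
    have h1 : algebraMap (WittVector p k) (FractionRing (WittVector p k)) a /
        algebraMap _ _ ((p : WittVector p k) ^ n * c) =
        ((p : ℚ_[p]) ^ n)⁻¹ • algebraMap _ _ (a * ((c⁻¹ : (WittVector p k)ˣ) : WittVector p k)) := by
      have hc' : algebraMap (WittVector p k) (FractionRing (WittVector p k)) c ≠ 0 :=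
        (c.isUnit.map _).ne_zero
      have h2 : algebraMap (WittVector p k) (FractionRing (WittVector p k))
          ((c⁻¹ : (WittVector p k)ˣ) : WittVector p k) * algebraMap _ _ (c : WittVector p k) = 1 := by
        rw [← map_mul, Units.inv_mul, map_one]
      rw [Algebra.smul_def, map_inv₀, map_pow, map_natCast, map_mul, map_mul, map_pow, map_natCast,
        div_eq_iff (mul_ne_zero (pow_ne_zero _ hp) hc')]
      field_simp
      linear_combination (-(algebraMap _ _ a)) * h2
    rw [h1]
    refine Submodule.smul_mem _ _ ?_
    rw [← ω.sum_repr (a * _), map_sum]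
    refine Submodule.sum_mem _ fun i _ => ?_
    rw [hsm]
    exact Submodule.smul_mem _ _ (Submodule.subset_span ⟨i, rfl⟩)

end WittVectors

end FCrystal

/-! ### Galois descent for Witt vectors -/

namespace FCrystal

section Descent

variable {p : ℕ} [Fact p.Prime] {k : Type u} [Field k] [Fintype k] [CharP k p]

theorem galBar_coeff (x : WittVector p (AlgebraicClosure k)) (n : ℕ) :
    (galBar p k x).coeff n = x.coeff n ^ Fintype.card k := rfl

theorem galBar_eq_iterate (x : WittVector p (AlgebraicClosure k)) :
    galBar p k x = (WittVector.frobenius : _ →+* WittVector p (AlgebraicClosure k))^[deg p k] x := by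
  ext n
  rw [galBar_coeff, WittVector.iterate_frobenius_coeff, card_eq (p := p)]

theorem exists_algebraMap_eq {x : WittVector p (AlgebraicClosure k)} (hx : galBar p k x = x) :
    ∃ a, algebraMap (WittVector p k) _ a = x := by
  have hset : Set.range (algebraMap k (AlgebraicClosure k)) =
      {x : AlgebraicClosure k | x ^ Fintype.card k ^ 1 = x} := by
    obtain ⟨h1, h2⟩ := LRep.card_frob_fixed (k := k) one_pos
    refine Set.eq_of_subset_of_ncard_le ?_ ?_ h1
    · rintro _ ⟨a, rfl⟩
      rw [Set.mem_ofPred_eq, pow_one, ← map_pow, FiniteField.pow_card]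
    · rw [h2, pow_one, ← Set.image_univ, Set.ncard_image_of_injective _ (algebraMap k _).injective,
        Set.ncard_univ, Nat.card_eq_fintype_card]
  have h (n : ℕ) : ∃ a, algebraMap k (AlgebraicClosure k) a = x.coeff n := by
    have : x.coeff n ∈ Set.range (algebraMap k (AlgebraicClosure k)) := by
      rw [hset, Set.mem_ofPred_eq, pow_one, ← galBar_coeff, hx]
    exact this
  choose a ha using h
  refine ⟨WittVector.mk p a, ?_⟩
  ext n
  exact ha n

theorem galBar_algebraMap (a : WittVector p k) : galBar p k (algebraMap _ _ a) = algebraMap _ _ a := by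
  ext n
  exact (LRep.frobGen k).commutes (a.coeff n)

theorem galBar_one : galBar p k 1 = 1 := by
  have := galBar_algebraMap (p := p) (k := k) 1
  rwa [map_one] at this

/-- Modulo `p` this is the solvability of `t ^ q - t = b` in `k̄`; completeness for the `p`-adic
topology lifts it. -/
theorem galBar_sub_surjective :
    Function.Surjective (galBar p k - LinearMap.id : WittVector p (AlgebraicClosure k) →ₗ[_] _) := by
  have h1 : IsAdicComplete (Ideal.span {(p : WittVector p k)}) (WittVector p (AlgebraicClosure k)) := by
    rw [← IsAdicComplete.map_algebraMap_iff (S := WittVector p (AlgebraicClosure k)), Ideal.map_span,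
      Set.image_singleton, map_natCast]
    infer_instance
  refine surjective_of_mkQ_comp_surjective (I := Ideal.span {(p : WittVector p k)}) fun y => ?_
  obtain ⟨b, rfl⟩ := Submodule.Quotient.mk_surjective _ y
  obtain ⟨t, ht⟩ := IsAlgClosed.exists_root
    (X ^ Fintype.card k - X - C (b.coeff 0) : (AlgebraicClosure k)[X]) (by
      have h2 : (X + C (b.coeff 0) : (AlgebraicClosure k)[X]).degree < (Fintype.card k : ℕ) := by
        rw [degree_X_add_C]
        exact_mod_cast Fintype.one_lt_card
      rw [sub_sub, degree_sub_eq_left_of_degree_lt (by rwa [degree_X_pow]), degree_X_pow]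
      exact_mod_cast Fintype.card_ne_zero)
  refine ⟨WittVector.teichmuller p t, ?_⟩
  rw [LinearMap.comp_apply, Submodule.mkQ_apply, Submodule.Quotient.eq]
  have h3 : (p : WittVector p (AlgebraicClosure k)) ∣
      galBar p k (WittVector.teichmuller p t) - WittVector.teichmuller p t - b := by
    rw [p_dvd_iff]
    change WittVector.constantCoeff (galBar p k (WittVector.teichmuller p t) -
      WittVector.teichmuller p t - b) = 0
    rw [map_sub, map_sub]
    change (galBar p k (WittVector.teichmuller p t)).coeff 0 - (WittVector.teichmuller p t).coeff 0 -
      b.coeff 0 = 0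
    rw [galBar_coeff, WittVector.teichmuller_coeff_zero]
    simpa using ht
  obtain ⟨w, hw⟩ := h3
  have h4 : (galBar p k - LinearMap.id : WittVector p (AlgebraicClosure k) →ₗ[_] _)
      (WittVector.teichmuller p t) - b = (p : WittVector p k) • w := by
    rw [Algebra.smul_def, map_natCast, ← hw]
    rfl
  rw [h4]
  exact Submodule.smul_mem_smul (Ideal.mem_span_singleton_self _) trivial

variable (p k) in
theorem exists_galBar_sub_eq_one : ∃ β, galBar p k β = β + 1 := by
  obtain ⟨β, hβ⟩ := galBar_sub_surjective (p := p) (k := k) 1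
  refine ⟨β, ?_⟩
  rw [← hβ]
  simp

/-- The element `σ β - β` is fixed by `γ`, and its trace telescopes to `σ ^ a β - β = γ β - β = 1`,
because `γ` acts on `W(k̄)` as `σ ^ a`. -/
theorem exists_trace_eq_one {β : WittVector p (AlgebraicClosure k)} (hβ : galBar p k β = β + 1) :
    ∃ c : WittVector p k, algebraMap _ _ c = WittVector.frobenius β - β ∧
      ∑ i ∈ Finset.range (deg p k), (WittVector.frobenius : WittVector p k →+* _)^[i] c = 1 := by
  have h1 : galBar p k (WittVector.frobenius β - β) = WittVector.frobenius β - β := by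
    have h2 : galBar p k (WittVector.frobenius β) = WittVector.frobenius (galBar p k β) := by
      rw [galBar_eq_iterate, galBar_eq_iterate, ← Function.iterate_succ_apply,
        Function.iterate_succ_apply']
    rw [map_sub, h2, hβ, map_add, map_one]
    ring
  obtain ⟨c, hc⟩ := exists_algebraMap_eq h1
  refine ⟨c, hc, ?_⟩
  have hinj : Function.Injective (algebraMap (WittVector p k) (WittVector p (AlgebraicClosure k))) :=
    WittVector.map_injective _ (algebraMap k _).injective
  have h3 : ∀ a : WittVector p k, algebraMap (WittVector p k) (WittVector p (AlgebraicClosure k))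
      (WittVector.frobenius a) = WittVector.frobenius (algebraMap _ _ a) := fun a => by
    have := (frobBar p k).map_smulₛₗ a 1
    rw [Algebra.smul_def, Algebra.smul_def, mul_one] at this
    change WittVector.frobenius _ = _ * WittVector.frobenius 1 at this
    rw [map_one, mul_one] at this
    exact this.symm
  have h4 : ∀ i : ℕ, algebraMap (WittVector p k) (WittVector p (AlgebraicClosure k))
      ((WittVector.frobenius : WittVector p k →+* _)^[i] c) =
      (WittVector.frobenius : WittVector p (AlgebraicClosure k) →+* _)^[i + 1] β -
        (WittVector.frobenius : WittVector p (AlgebraicClosure k) →+* _)^[i] β := fun i => by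
    induction i with
    | zero => exact hc
    | succ i ih =>
      rw [Function.iterate_succ_apply', h3, ih, map_sub, Function.iterate_succ_apply' _ (i + 1) β,
        Function.iterate_succ_apply' _ i β]
  refine hinj ?_
  rw [map_sum, map_one, Finset.sum_congr rfl fun i _ => h4 i, Finset.sum_range_sub
    (fun i => (WittVector.frobenius : WittVector p (AlgebraicClosure k) →+* _)^[i] β),
    ← galBar_eq_iterate, hβ]
  simp

variable {V : Type*} [AddCommGroup V] [Module (WittVector p k) V]

theorem exists_tmul_eq_of_pi {n : ℕ} {x : WittVector p (AlgebraicClosure k) ⊗[WittVector p k]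
    (Fin n → WittVector p k)} (hx : (galBar p k).rTensor _ x = x) : ∃ v, x = 1 ⊗ₜ v := by
  let e := TensorProduct.piScalarRight (WittVector p k) (WittVector p (AlgebraicClosure k))
    (WittVector p (AlgebraicClosure k)) (Fin n)
  have h1 : ∀ x, e ((galBar p k).rTensor _ x) = fun j => galBar p k (e x j) := fun x => by
    induction x with
    | zero => ext1 j; simp
    | add x y hx hy =>
      rw [map_add, map_add, hx, hy, map_add]
      ext1 j
      simp
    | tmul a v =>
      ext1 j
      simp [e]
  have h2 : ∀ j, galBar p k (e x j) = e x j := fun j => by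
    have := congrFun (h1 x) j
    rw [hx] at this
    exact this.symm
  choose v hv using fun j => exists_algebraMap_eq (h2 j)
  refine ⟨v, e.injective (funext fun j => ?_)⟩
  rw [← hv]
  simp [e, Algebra.smul_def]

theorem lTensor_rTensor_galBar {A B : Type*} [AddCommGroup A] [AddCommGroup B]
    [Module (WittVector p k) A] [Module (WittVector p k) B] (g : A →ₗ[WittVector p k] B)
    (y : WittVector p (AlgebraicClosure k) ⊗[WittVector p k] A) :
    g.lTensor _ ((galBar p k).rTensor A y) = (galBar p k).rTensor B (g.lTensor _ y) :=
  LinearMap.congr_fun ((LinearMap.lTensor_comp_rTensor _ _ _).trans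
    (LinearMap.rTensor_comp_lTensor _ _ _).symm) y

/-- Lift `x` along a free cover. The lift fails to be invariant by an element from the kernel, which
has the form `γ z - z` since `γ - 1` is surjective there; correcting by `z` reduces to the free
case, treated by coordinates. -/
theorem exists_tmul_eq [Module.Finite (WittVector p k) V]
    {x : WittVector p (AlgebraicClosure k) ⊗[WittVector p k] V}
    (hx : (galBar p k).rTensor V x = x) : ∃ v, x = 1 ⊗ₜ v := by
  obtain ⟨n, f, hf⟩ := Module.Finite.exists_fin' (WittVector p k) V
  obtain ⟨y, rfl⟩ := LinearMap.lTensor_surjective (WittVector p (AlgebraicClosure k)) hf x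
  have h1 : f.lTensor (WittVector p (AlgebraicClosure k)) ((galBar p k).rTensor _ y - y) = 0 := by
    rw [map_sub, lTensor_rTensor_galBar, hx, sub_self]
  obtain ⟨z, hz⟩ := (lTensor_exact _ (LinearMap.exact_subtype_ker_map f) hf _).1 h1
  obtain ⟨z, rfl⟩ := LinearMap.rTensor_surjective (LinearMap.ker f) galBar_sub_surjective z
  rw [LinearMap.rTensor_sub, LinearMap.sub_apply, LinearMap.rTensor_id, LinearMap.id_apply, map_sub] at hz
  obtain ⟨v, hv⟩ := exists_tmul_eq_of_pi (p := p) (k := k)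
    (x := y - (LinearMap.ker f).subtype.lTensor _ z) (by
      rw [map_sub, ← lTensor_rTensor_galBar]
      rw [sub_eq_sub_iff_add_eq_add] at hz ⊢
      rw [add_comm y, hz, add_comm])
  refine ⟨f v, ?_⟩
  have h2 := congrArg (f.lTensor (WittVector p (AlgebraicClosure k))) hv
  rw [map_sub, (lTensor_exact _ (LinearMap.exact_subtype_ker_map f) hf _).2 ⟨z, rfl⟩, sub_zero] at h2
  exact h2

/-- The extension `W(k) → W(k̄)` is torsion-free, hence flat, and local, hence faithfully flat. -/
theorem one_tmul_injective :
    Function.Injective fun v : V => (1 : WittVector p (AlgebraicClosure k)) ⊗ₜ[WittVector p k] v := by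
  have hinj : Function.Injective (algebraMap (WittVector p k) (WittVector p (AlgebraicClosure k))) :=
    WittVector.map_injective _ (algebraMap k _).injective
  have : FaithfulSMul (WittVector p k) (WittVector p (AlgebraicClosure k)) :=
    (faithfulSMul_iff_algebraMap_injective _ _).2 hinj
  have : Module.IsTorsionFree (WittVector p k) (WittVector p (AlgebraicClosure k)) := inferInstance
  have : IsLocalHom (algebraMap (WittVector p k) (WittVector p (AlgebraicClosure k))) := by
    refine ⟨fun a ha => WittVector.isUnit_of_coeff_zero_ne_zero a fun h => ?_⟩
    have h1 := ha.map (WittVector.constantCoeff : WittVector p (AlgebraicClosure k) →+* _)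
    refine h1.ne_zero ?_
    change algebraMap k _ (a.coeff 0) = 0
    rw [h, map_zero]
  have : Module.FaithfullyFlat (WittVector p k) (WittVector p (AlgebraicClosure k)) :=
    Module.FaithfullyFlat.of_flat_of_isLocalHom
  exact Module.FaithfullyFlat.tensorProduct_mk_injective V

end Descent

end FCrystal

/-! ### The edge map for `F`-crystals as a twist -/

namespace FCrystal

section Edge

variable {p : ℕ} [Fact p.Prime] {k : Type u} [Field k] [Fintype k] [CharP k p]

theorem barGal_tmul (M : Cat p k) (a : WittVector p (AlgebraicClosure k)) (m : M.obj) :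
    barGal M (a ⊗ₜ m) = galBar p k a ⊗ₜ m := rfl

theorem barFrob_tmul (M : Cat p k) (a : WittVector p (AlgebraicClosure k)) (m : M.obj) :
    barFrob M (a ⊗ₜ m) = WittVector.frobenius a ⊗ₜ frob M.obj m := rfl

theorem barMap_tmul {M N : Cat p k} (f : M ⟶ N) (a : WittVector p (AlgebraicClosure k)) (m : M.obj) :
    barMap f (a ⊗ₜ m) = a ⊗ₜ linMap f.hom m := rfl

theorem galBar_mul (a b : WittVector p (AlgebraicClosure k)) :
    galBar p k (a * b) = galBar p k a * galBar p k b :=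
  map_mul (WittVector.map (LRep.frobGen k : AlgebraicClosure k →+* AlgebraicClosure k)) a b

theorem algebraMap_tmul {V : Type*} [AddCommGroup V] [Module (WittVector p k) V] (c : WittVector p k)
    (v : V) : algebraMap (WittVector p k) (WittVector p (AlgebraicClosure k)) c ⊗ₜ[WittVector p k] v =
      1 ⊗ₜ (c • v) := by
  rw [tmul_smul, smul_tmul', Algebra.smul_def, mul_one]

theorem linMap_comp_apply {M N E : Cat p k} (f : M ⟶ N) (g : N ⟶ E) (x : M.obj) :
    linMap g.hom (linMap f.hom x) = linMap (f ≫ g).hom x := rfl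

theorem linMap_zero_apply {M N : Cat p k} (x : M.obj) : linMap (0 : M ⟶ N).hom x = 0 := rfl

/-- The modified section `s - β i u` is invariant under `γ`, because `γ β = β + 1` absorbs the
cocycle, so it descends to `t`. As `s` and `u` commute with `F`, the defect of `t` comes only from
`σ β - β = c`. -/
theorem isTwist_of_section {M N E : Cat p k} {i : N ⟶ E} {q : E ⟶ M} (w : i ≫ q = 0) (u : M ⟶ N)
    {β : WittVector p (AlgebraicClosure k)} (hβ : galBar p k β = β + 1) {c : WittVector p k}
    (hc : algebraMap _ _ c = WittVector.frobenius β - β)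
    (s : Bar M →ₗ[WittVector p (AlgebraicClosure k)] Bar E)
    (h1 : ∀ x, s (barFrob M x) = barFrob E (s x)) (h2 : ∀ x, barMap q (s x) = x)
    (h3 : ∀ x, barGal E (s x) = s (barGal M x) + barMap i (barMap u (barGal M x))) :
    ∃ t : M.obj →ₗ[WittVector p k] E.obj, (∀ x, linMap q.hom (t x) = x) ∧
      ∀ x, frob E.obj (t x) = t (frob M.obj x) +
        linMap i.hom (-c • linMap u.hom (frob M.obj x)) := by
  have := E.property.1
  have h (m : M.obj) : ∃ v : E.obj, s (1 ⊗ₜ m) - β ⊗ₜ linMap i.hom (linMap u.hom m) = 1 ⊗ₜ v := by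
    refine exists_tmul_eq ?_
    change barGal E _ = _
    rw [map_sub, h3, barGal_tmul, barGal_tmul, barMap_tmul, barMap_tmul, hβ, galBar_one, add_tmul]
    abel
  choose t ht using h
  have ht' (m : M.obj) : s (1 ⊗ₜ m) = 1 ⊗ₜ t m + β ⊗ₜ linMap i.hom (linMap u.hom m) := by
    rw [← ht, sub_add_cancel]
  refine ⟨⟨⟨t, fun x y => one_tmul_injective (p := p) (k := k) ?_⟩, fun a x => one_tmul_injective (p := p) (k := k) ?_⟩, fun x => ?_, fun x => ?_⟩
  · change (1 : WittVector p (AlgebraicClosure k)) ⊗ₜ t (x + y) = 1 ⊗ₜ (t x + t y)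
    rw [tmul_add, ← ht, ← ht, ← ht, tmul_add, map_add, map_add, map_add, tmul_add]
    abel
  · change (1 : WittVector p (AlgebraicClosure k)) ⊗ₜ t (a • x) = 1 ⊗ₜ (a • t x)
    have h4 : s (1 ⊗ₜ (a • x)) = a • s (1 ⊗ₜ x) := by
      rw [tmul_smul, ← algebraMap_smul (WittVector p (AlgebraicClosure k)) a (1 ⊗ₜ[WittVector p k] x),
        map_smul, algebraMap_smul]
    rw [tmul_smul, ← ht, ← ht, h4, map_smul, map_smul, tmul_smul, smul_sub]
  · refine one_tmul_injective (p := p) (k := k) ?_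
    have h4 := h2 (1 ⊗ₜ x)
    rw [ht', map_add, barMap_tmul, barMap_tmul, linMap_comp_apply i q, w, linMap_zero_apply, tmul_zero,
      add_zero] at h4
    exact h4
  · refine one_tmul_injective (p := p) (k := k) ?_
    have h4 := h1 (1 ⊗ₜ x)
    rw [ht', map_add, barFrob_tmul, barFrob_tmul, barFrob_tmul, map_one, ht', ← linMap_frob,
      ← linMap_frob, ← sub_add_cancel (WittVector.frobenius β) β, ← hc, add_tmul, algebraMap_tmul,
      ← add_assoc, add_left_inj, ← sub_eq_iff_eq_add, ← tmul_sub] at h4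
    refine h4.symm.trans (congrArg _ ?_)
    change _ = t (frob M.obj x) + _
    rw [map_smul, neg_smul, sub_eq_add_neg]

/-- The inverse construction adds `β i u` to `t`: the twist cancels the defect of `β` under
Frobenius and leaves its defect 1 under `γ`. -/
theorem exists_section {M N E : Cat p k} {i : N ⟶ E} {q : E ⟶ M} (w : i ≫ q = 0) (u : M ⟶ N)
    {β : WittVector p (AlgebraicClosure k)} (hβ : galBar p k β = β + 1) {c : WittVector p k}
    (hc : algebraMap _ _ c = WittVector.frobenius β - β) (t : M.obj →ₗ[WittVector p k] E.obj)
    (h1 : ∀ x, linMap q.hom (t x) = x)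
    (h2 : ∀ x, frob E.obj (t x) = t (frob M.obj x) +
        linMap i.hom (-c • linMap u.hom (frob M.obj x))) :
    ∃ s : Bar M →ₗ[WittVector p (AlgebraicClosure k)] Bar E,
      (∀ x, s (barFrob M x) = barFrob E (s x)) ∧ (∀ x, barMap q (s x) = x) ∧
      ∀ x, barGal E (s x) = s (barGal M x) + barMap i (barMap u (barGal M x)) := by
  let s : Bar M →ₗ[WittVector p (AlgebraicClosure k)] Bar E :=
    t.baseChange _ + β • (barMap i).comp (barMap u)
  have hs (a : WittVector p (AlgebraicClosure k)) (m : M.obj) :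
      s (a ⊗ₜ m) = a ⊗ₜ t m + (β * a) ⊗ₜ linMap i.hom (linMap u.hom m) := rfl
  refine ⟨s, fun x => ?_, fun x => ?_, fun x => ?_⟩
  · induction x using TensorProduct.induction_on with
    | zero => simp
    | add x y hx hy => rw [map_add, map_add, hx, hy, map_add, map_add]
    | tmul a m =>
      rw [barFrob_tmul, hs, hs, map_add, barFrob_tmul, barFrob_tmul, h2, ← linMap_frob,
        ← linMap_frob, map_mul, ← sub_add_cancel (WittVector.frobenius β) β, ← hc, add_mul, add_tmul,
        map_smul, neg_smul, tmul_add, tmul_neg, ← Algebra.smul_def, smul_tmul]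
      abel
  · induction x using TensorProduct.induction_on with
    | zero => simp
    | add x y hx hy => rw [map_add, map_add, hx, hy]
    | tmul a m =>
      rw [hs, map_add, barMap_tmul, barMap_tmul, h1, linMap_comp_apply i q, w, linMap_zero_apply,
        tmul_zero, add_zero]
  · induction x using TensorProduct.induction_on with
    | zero => simp
    | add x y hx hy =>
      simp only [map_add, hx, hy]
      abel
    | tmul a m =>
      rw [hs, map_add, barGal_tmul, barGal_tmul, barGal_tmul, hs, barMap_tmul, barMap_tmul,
        galBar_mul, hβ, add_mul, one_mul, add_tmul]
      abel

theorem isEdge_iff {β : WittVector p (AlgebraicClosure k)} (hβ : galBar p k β = β + 1)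
    {c : WittVector p k} (hc : algebraMap _ _ c = WittVector.frobenius β - β) {M N : Cat p k}
    (u : M ⟶ N) (e : Ext M N 1) : IsEdge u e ↔ isSemilinearCat.edgeHom (-c) M N u = e := by
  rw [IsSemilinearCat.edgeHom_apply, ← IsSemilinearCat.isTwist_iff]
  constructor
  · rintro ⟨E, i, q, w, hS, s, h1, h2, h3, he⟩
    obtain ⟨t, ht⟩ := isTwist_of_section w u hβ hc s h1 h2 h3
    exact ⟨E, i, q, w, hS, t, ht.1, ht.2, he⟩
  · rintro ⟨E, i, q, w, hS, t, h1, h2, he⟩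
    obtain ⟨s, hs⟩ := exists_section w u hβ hc t h1 h2
    exact ⟨E, i, q, w, hS, s, hs.1, hs.2.1, hs.2.2, he⟩

end Edge

end FCrystal

/-! ### The formula for `F`-crystals -/

namespace FCrystal

section Main

variable {p : ℕ} [Fact p.Prime] {k : Type u} [Field k] [Fintype k] [CharP k p]

attribute [local instance] algebraZp algebraQp

/-- The Frobenius of the isocrystal is injective, hence so is its power `π_M`. Without this the
valuation in the slope sum would be a default value. -/
theorem coeff_zero_charPoly_ne_zero (M : Cat p k) : (charPoly M).coeff 0 ≠ 0 := by
  have := M.property.1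
  intro h
  have h1 : (frobQ M).charpoly.coeff 0 = 0 := by
    rw [← charPoly_map, coeff_map, h, map_zero]
  have h2 : LinearMap.det (frobQ M) = 0 := by
    rw [LinearMap.det_eq_sign_charpoly_coeff, h1, mul_zero]
  have h3 : ∀ n (x : FractionRing (WittVector p k)) (m : M.obj), (isocFrob M.obj)^[n] (x ⊗ₜ m) =
      (WittVector.FractionRing.frobeniusRingHom p k)^[n] x ⊗ₜ (frob M.obj)^[n] m := fun n x m => by
    induction n with
    | zero => rfl
    | succ n ih => rw [Function.iterate_succ_apply', ih, isocFrob_tmul, Function.iterate_succ_apply',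
        Function.iterate_succ_apply']
  have h4 : Function.Injective (frobQ M) := by
    refine (injective_iff_map_eq_zero _).2 fun x hx => ?_
    obtain ⟨a, ha, m, hm⟩ := exists_smul_eq x
    have h5 : (isocFrob M.obj)^[deg p k] (1 ⊗ₜ m) = 0 := by
      rw [h3, iterate_map_one]
      change frobQ M (1 ⊗ₜ m) = 0
      rw [← hm, ← algebraMap_smul (FractionRing (WittVector p k)) a x, map_smul, hx, smul_zero]
    rw [← hm, ← iterate_map_zero (isocFrob M.obj) (deg p k)] at h5
    have h6 := (isocFrob_injective M.property).iterate _ h5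
    rw [← algebraMap_smul (FractionRing (WittVector p k)) a x] at h6
    exact (smul_eq_zero.1 h6).resolve_left (by simpa using ha)
  have h5 := LinearMap.ker_eq_bot.2 h4
  exact absurd h5 (LinearMap.bot_lt_ker_of_det_eq_zero h2).ne'

/-- With `q = p ^ a` and slope sum `v / a`, where `v` is the valuation of the constant term, both
sides are `p ^ (-v n)`. -/
theorem norm_card_rpow_slopeSum (M : Cat p k) (n : ℕ) :
    ‖(Fintype.card k : PadicAlgCl p)‖ ^ ((slopeSum M : ℝ) * (n : ℝ)) = ‖(charPoly M).coeff 0‖ ^ n := by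
  have hp : (0 : ℝ) < p := by exact_mod_cast (Fact.out : p.Prime).pos
  have hd : (deg p k : ℝ) ≠ 0 := by exact_mod_cast (deg_pos (p := p) (k := k)).ne'
  have h1 : ‖(Fintype.card k : PadicAlgCl p)‖ = (p : ℝ) ^ (-(deg p k : ℝ)) := by
    have h2 : (Fintype.card k : PadicAlgCl p) = algebraMap ℚ_[p] (PadicAlgCl p) ((p : ℚ_[p]) ^ deg p k) := by
      rw [card_eq (p := p), map_pow, map_natCast, Nat.cast_pow]
    rw [h2, norm_algebraMap', norm_pow, Padic.norm_p, inv_pow, Real.rpow_neg hp.le, Real.rpow_natCast]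
  rw [h1, Padic.norm_eq_zpow_neg_valuation (coeff_zero_charPoly_ne_zero M), ← Real.rpow_mul hp.le,
    ← Real.rpow_intCast, ← Real.rpow_natCast _ n, ← Real.rpow_mul hp.le]
  congr 1
  rw [slopeSum]
  push_cast
  field_simp

theorem exists_algHom : Nonempty (FractionRing (WittVector p k) →ₐ[ℚ_[p]] PadicAlgCl p) := by
  obtain ⟨r, hr⟩ : ∃ r, deg p k = r + 1 := ⟨deg p k - 1, (Nat.sub_add_cancel deg_pos).symm⟩
  obtain ⟨-, ω, -⟩ := (isFrobeniusExt hr).basis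
  have := Module.Finite.of_basis ω
  have := Algebra.IsAlgebraic.of_finite ℚ_[p] (FractionRing (WittVector p k))
  exact ⟨IsAlgClosed.lift⟩

theorem norm_det_frobQ (M : Cat p k) (j : FractionRing (WittVector p k) →ₐ[ℚ_[p]] PadicAlgCl p) :
    ‖j (LinearMap.det (frobQ M))‖ = ‖(charPoly M).coeff 0‖ := by
  have := M.property.1
  rw [LinearMap.det_eq_sign_charpoly_coeff, ← charPoly_map, coeff_map, map_mul, map_pow, map_neg,
    map_one, norm_mul, norm_pow, norm_neg, norm_one, one_pow, one_mul]
  exact (congrArg norm (j.commutes _)).trans (norm_algebraMap' _ _)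

theorem map_charpoly_frobQ (M : Cat p k) (j : FractionRing (WittVector p k) →ₐ[ℚ_[p]] PadicAlgCl p) :
    haveI := M.property.1
    (frobQ M).charpoly.map (j : FractionRing (WittVector p k) →+* PadicAlgCl p) =
      (charPoly M).map (algebraMap ℚ_[p] (PadicAlgCl p)) := by
  rw [← charPoly_map, Polynomial.map_map]
  congr 1
  exact j.comp_algebraMap

theorem euler_characteristic_formula (M N : Cat p k) :
    (∀ i > 2, Subsingleton (Ext M N i)) ∧ Finite (Ext M N 2) ∧
      ∃ f : (M ⟶ N) →+ Ext M N 1, (∀ u e, IsEdge u e ↔ f u = e) ∧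
        (NoCommonMultipleRoot (minPoly M) (minPoly N) →
          ZDefined f ∧ (zInv f : ℝ) * Nat.card (Ext M N 2) =
            ‖(Fintype.card k : PadicAlgCl p)‖ ^ ((slopeSum M : ℝ) * (rank N : ℝ)) *
              ‖rootProduct (charPoly M) (charPoly N)‖) := by
  obtain ⟨β, hβ⟩ := exists_galBar_sub_eq_one p k
  obtain ⟨c, hc, htr⟩ := exists_trace_eq_one hβ
  obtain ⟨r, hr⟩ : ∃ r, deg p k = r + 1 := ⟨deg p k - 1, (Nat.sub_add_cancel deg_pos).symm⟩
  obtain ⟨j⟩ := exists_algHom (p := p) (k := k)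
  rw [hr] at htr
  have h := isSemilinearCat.zInv_edgeHom (isFrobeniusExt hr) associated_frobenius
    (fun M x hx => (mem_torsion (M := M.obj) x).1 (M.property.2 x hx))
    (fun M => frobPow M.obj) (fun M x => by rw [← hr]; rfl) htr j M N
  -- The edge map belongs to `-c`, while it is `c` that has trace 1; negation on Ext¹ does not
  -- affect `z`.
  have hneg : ∀ u : M ⟶ N, isSemilinearCat.edgeHom (-c) M N (AddEquiv.refl _ u) =
      AddEquiv.neg (Ext M N 1) (isSemilinearCat.edgeHom c M N u) := fun u => by
    change _ = -_
    rw [IsSemilinearCat.edgeHom_apply, IsSemilinearCat.edgeHom_apply, neg_smul, map_neg]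
    rfl
  refine ⟨fun i hi => isSemilinearCat.subsingleton_ext M N hi, h.1, _, isEdge_iff hβ hc, fun hMN => ?_⟩
  obtain ⟨h1, h2⟩ := h.2 hMN
  refine ⟨(zDefined_congr _ _ hneg).1 h1, ?_⟩
  rw [← zInv_congr _ _ hneg, norm_card_rpow_slopeSum, LRep.rootProduct_eq_pairProduct,
    ← map_charpoly_frobQ M j, ← map_charpoly_frobQ N j, ← norm_det_frobQ M j]
  exact h2

end Main

end FCrystal

end

theorem mainTheorem5 (p : ℕ) [Fact p.Prime] (k : Type u) [Field k] [Fintype k] [CharP k p] :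
    (∀ (l : ℕ) [Fact l.Prime], l ≠ p → ∀ M N : LRep.FF l k,
      (∀ i > 2, Subsingleton (LRep.Ext M N i)) ∧
      Finite (LRep.Ext M N 2) ∧
      ∃ f : (M ⟶ N) →+ LRep.Ext M N 1,
        (∀ u e, LRep.IsEdge u e ↔ f u = e) ∧
        (NoCommonMultipleRoot (LRep.minPoly M) (LRep.minPoly N) →
          ZDefined f ∧
          (zInv f : ℝ) * Nat.card (LRep.Ext M N 2) =
            ‖rootProduct (LRep.charPoly M) (LRep.charPoly N)‖)) ∧
    (∀ M N : FCrystal.Cat p k,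
      (∀ i > 2, Subsingleton (FCrystal.Ext M N i)) ∧
      Finite (FCrystal.Ext M N 2) ∧
      ∃ f : (M ⟶ N) →+ FCrystal.Ext M N 1,
        (∀ u e, FCrystal.IsEdge u e ↔ f u = e) ∧
        (NoCommonMultipleRoot (FCrystal.minPoly M) (FCrystal.minPoly N) →
          ZDefined f ∧
          (zInv f : ℝ) * Nat.card (FCrystal.Ext M N 2) =
            ‖(Fintype.card k : PadicAlgCl p)‖ ^
                ((FCrystal.slopeSum M : ℝ) * (FCrystal.rank N : ℝ)) *
              ‖rootProduct (FCrystal.charPoly M) (FCrystal.charPoly N)‖)) := by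
  exact ⟨fun l _ _ M N => LRep.euler_characteristic_formula M N,
    fun M N => FCrystal.euler_characteristic_formula M N⟩
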